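/- **Setting.** Let $Q=(Q_0,Q_1,s,t)$ be a finite quiver with twists $\sigma_\alpha\in\mathrm{Gal}(\mathbb C/\mathbb R)=\{\mathrm{Id},\overline{(?)}\}$, $\alpha\in Q_1$. The semilinear path algebra $\mathbb C_\sigma Q$ is the $\mathbb C$-ring generated by trivial paths $e_i$ and arrows $\alpha$ with relations $e_ie_j=\delta_{ij}e_i$, $\sum_i e_i=1$, $e_{t(\alpha)}\alpha=\alpha=\alpha e_{s(\alpha)}$, $e_ic=ce_i$, $\alpha c=\sigma_\alpha(c)\alpha$ ($c\in\mathbb C$); it is an $\mathbb R$-algebra. Let $\mathbb S\subseteq Q_1$ be a set of loops (the special loops), at most one at each vertex, twisted by conjugation, each associated with $x^2-1$ or $x^2+1$. Write $Q_0=Q_{\mathbb R}\sqcup Q_{\mathbb H}\sqcup Q_{\mathbb C}$ for the vertices with a special loop of polynomial $x^2-1$, with one of polynomial $x^2+1$, and with none. Let $s_i$ be the special loop at $i$ and $S=\{s_i^2-e_i: i\in Q_{\mathbb R}\}\cup\{s_i^2+e_i: i\in Q_{\mathbb H}\}$. Let $Z$ be a set of paths of length at least two which neither start nor end with a special loop and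 do not contain the square of a special loop. Assume that $\mathbb C_\sigma Q/\langle S\cup Z\rangle$ is $\mathbb C$-semilinear clannish of gentle type, that is: at most two arrows start and at most two arrows end at each vertex (special loops included); for each ordinary arrow $\alpha\in Q_1\setminus\mathbb S$ there is at most one arrow $\beta$ with $\alpha\beta$ a path not in $Z$, at most one $\gamma$ with $\gamma\alpha$ a path not in $Z$, at most one $\beta$ with $\alpha\beta$ a path in $Z$, and at most one $\gamma$ with $\gamma\alpha$ a path in $Z$; and all paths in $Z$ have length two. (In $\alpha\beta$ the arrow $\beta$ comes first.) **The idempotent.** Put $\epsilon=\sum_i\epsilon_i$ with $\epsilon_i=(e_i+s_i)/2$ for $i\in Q_{\mathbb R}$ and $\epsilon_i=e_i$ otherwise. Its classes modulo $\langle S\rangle$ and modulo $\langle S\cup Z\rangle$ are idempotent, and are again denoted by $\epsilon$. **The modulated quiver.** $Q^{\mathrm b}$ has the vertices of $Q$; each ordinary arrow $\alpha$ of $Q$ is an arrow of $Q^{\mathrm b}$, and there is a parallel arrow $\alpha^{\mathbf i}$ if both ends of $\alpha$ lie in $Q_{\mathbb R}$ or both lie in $Q_{\mathbb H}$. Put $\mathcal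 M(i)=D$ for $i\in Q_D$, $D\in\{\mathbb R,\mathbb H,\mathbb C\}$. For an arrow of $Q^{\mathrm b}$ coming from $\alpha$ with both ends in $Q_{\mathbb C}$, the bimodule is $\mathbb C$ if $\sigma_\alpha=\mathrm{Id}$ and $\overline{\mathbb C}$ (with $x\cdot c=x\overline c$) if $\sigma_\alpha=\overline{(?)}$; otherwise it is the simple $\mathcal M(t(\alpha))$-$\mathcal M(s(\alpha))$-bimodule: $\mathbb R$ for $(\mathbb R,\mathbb R)$; $\mathbb C$ for $(\mathbb R,\mathbb C)$ and $(\mathbb C,\mathbb R)$; $\mathbb H$ for $(\mathbb R,\mathbb H)$, $(\mathbb H,\mathbb R)$ and $(\mathbb H,\mathbb H)$; columns $\mathbb C^2$ for $(\mathbb H,\mathbb C)$; rows $\mathbb C^2$ for $(\mathbb C,\mathbb H)$. Here $\mathbb H\subset M_2(\mathbb C)$ has the units $\mathbf j=\mathrm{diag}(\mathbf i,-\mathbf i)$, $\mathbf k=\begin{bmatrix}0&1\\-1&0\end{bmatrix}$, $\mathbf l=\mathbf{jk}$. Let $T(Q^{\mathrm b},\mathcal M)$ be the tensor algebra of $\bigoplus_{\alpha}\mathcal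 M(\alpha)$ over $\prod_i\mathcal M(i)$. **The isomorphism $\Phi$.** For a vertex $i$ let $A_i=\mathbb Ce_i+\mathbb Cs_i$ (with $A_i=\mathbb Ce_i$ for $i\in Q_{\mathbb C}$) and let $\phi$ be the isomorphism of $A_i$ with $M_2(\mathbb R)$, $\mathbb H$ or $\mathbb C$ given by $\mathbf i\mapsto\begin{bmatrix}0&-1\\1&0\end{bmatrix}$, $s_i\mapsto\mathrm{diag}(1,-1)$ for $i\in Q_{\mathbb R}$; by $\mathbf i\mapsto\mathbf j$, $s_i\mapsto\mathbf k$ for $i\in Q_{\mathbb H}$; and by $\mathbf i\mapsto\mathbf i$ for $i\in Q_{\mathbb C}$. For an ordinary arrow $\alpha$ let $\phi$ be the compatible isomorphism of bimodules from $A_{t(\alpha)}\alpha A_{s(\alpha)}$ to matrices over $\mathcal M(\alpha)$ (or to pairs of matrices over $\mathcal M(\alpha)$ and $\mathcal M(\alpha^{\mathbf i})$, written as sums), with two rows if $t(\alpha)\in Q_{\mathbb R}$ and one otherwise, and two columns if $s(\alpha)\in Q_{\mathbb R}$ and one otherwise, that sends $\alpha$ to the following value (first for $\sigma_\alpha=\mathrm{Id}$,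 then for $\sigma_\alpha=\overline{(?)}$), according to the types of $(t(\alpha),s(\alpha))$: - $(\mathbb R,\mathbb R)$: $\begin{bmatrix}1&0\\0&1\end{bmatrix}_\alpha+\begin{bmatrix}0&-1\\1&0\end{bmatrix}_{\alpha^{\mathbf i}}$; $\begin{bmatrix}1&0\\0&-1\end{bmatrix}_\alpha+\begin{bmatrix}0&1\\1&0\end{bmatrix}_{\alpha^{\mathbf i}}$. - $(\mathbb R,\mathbb H)$: $\begin{bmatrix}1\\-\mathbf j\end{bmatrix}$; $\begin{bmatrix}1\\\mathbf j\end{bmatrix}$. $(\mathbb R,\mathbb C)$: $\begin{bmatrix}1\\-\mathbf i\end{bmatrix}$; $\begin{bmatrix}1\\\mathbf i\end{bmatrix}$. - $(\mathbb H,\mathbb R)$: $\begin{bmatrix}1&\mathbf j\end{bmatrix}$; $\begin{bmatrix}1&-\mathbf j\end{bmatrix}$. $(\mathbb C,\mathbb R)$: $\begin{bmatrix}1&\mathbf i\end{bmatrix}$; $\begin{bmatrix}1&-\mathbf i\end{bmatrix}$. - $(\mathbb H,\mathbb H)$: $1_\alpha+\mathbf j_{\alpha^{\mathbf i}}$; $\mathbf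 k_\alpha+\mathbf l_{\alpha^{\mathbf i}}$. - $(\mathbb H,\mathbb C)$: the column $\begin{bmatrix}1\\0\end{bmatrix}\in\mathbb C^2$; $\begin{bmatrix}0\\1\end{bmatrix}\in\mathbb C^2$. $(\mathbb C,\mathbb H)$: the row $\begin{bmatrix}1&0\end{bmatrix}\in\mathbb C^2$; $\begin{bmatrix}0&1\end{bmatrix}\in\mathbb C^2$. - $(\mathbb C,\mathbb C)$: $1$; $1$. **Theorem.** There is a unique isomorphism of $\mathbb R$-algebras $\Phi:\epsilon(\mathbb C_\sigma Q/\langle S\rangle)\epsilon\to T(Q^{\mathrm b},\mathcal M)$ that sends, for every $x\in A_i$ and every $x\in A_{t(\alpha)}\alpha A_{s(\alpha)}$ ($\alpha$ ordinary), the element $\epsilon x\epsilon$ to the upper left entry of $\phi(x)$ (in $\mathcal M(i)$, respectively in $\mathcal M(\alpha)$ or $\mathcal M(\alpha)\oplus\mathcal M(\alpha^{\mathbf i})$). The set $I=\Phi(\epsilon\langle p+\langle S\rangle: p\in Z\rangle\epsilon)$ is a two-sided ideal of $T(Q^{\mathrm b},\mathcal M)$, and $\Phi$ induces an isomorphism of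 $\mathbb R$-algebras $$\epsilon(\mathbb C_\sigma Q/\langle S\cup Z\rangle)\epsilon\;\simeq\;T(Q^{\mathrm b},\mathcal M)/I,$$ which sends the class of $\epsilon x\epsilon$ to the class of $\Phi(\epsilon x\epsilon)$ for all $x\in\mathbb C_\sigma Q$. In particular the $\mathbb R$-algebras $\mathbb C_\sigma Q/\langle S\cup Z\rangle$ and $T(Q^{\mathrm b},\mathcal M)/I$ are Morita equivalent. -/

import Mathlib

open scoped Quaternion Matrix
open MulOpposite

noncomputable section

namespace SemilinearClannish

/-! ### Two-sided quotients and corner algebras -/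

/-- The quotient of a ring by a two-sided ideal (an `ℝ`-algebra if `R` is one). -/
abbrev IdealQuotient {R : Type*} [Ring R] (J : TwoSidedIdeal R) : Type _ := J.ringCon.Quotient

/-- The class of an element modulo a two-sided ideal. -/
def IdealQuotient.mk {R : Type*} [Ring R] (J : TwoSidedIdeal R) : R →+* IdealQuotient J :=
  J.ringCon.mk'

/-- The corner `eRe` of an `ℝ`-algebra is an `ℝ`-algebra with unit `e`. -/
instance cornerAlgebra {R : Type*} [Ring R] [Algebra ℝ R] {e : R} (he : IsIdempotentElem e) :
    Algebra ℝ he.Corner where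
  smul r x := ⟨r • x.1, by
    obtain ⟨y, hy⟩ := x.2
    exact ⟨r • y, by simp only [← hy, mul_smul_comm, smul_mul_assoc]⟩⟩
  algebraMap :=
    { toFun := fun r => ⟨r • e, r • e, by
        simp only [mul_smul_comm, smul_mul_assoc, he.eq]⟩
      map_one' := Subtype.ext (one_smul ℝ e)
      map_mul' := fun r s => Subtype.ext (by
        change (r * s) • e = (r • e) * (s • e)
        simp only [mul_smul_comm, smul_mul_assoc, he.eq, smul_smul, mul_comm])
      map_zero' := Subtype.ext (zero_smul ℝ e)
      map_add' := fun r s => Subtype.ext (add_smul r s e) }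
  commutes' r x := Subtype.ext (by
    have h := (Subsemigroup.mem_corner_iff he).mp x.2
    change (r • e) * x.1 = x.1 * (r • e)
    rw [smul_mul_assoc, mul_smul_comm, h.1, h.2])
  smul_def' r x := Subtype.ext (by
    have h := (Subsemigroup.mem_corner_iff he).mp x.2
    change r • x.1 = (r • e) * x.1
    rw [smul_mul_assoc, h.1])

/-- The element `exe` of the corner `eRe`. -/
def compress {R : Type*} [Ring R] {e : R} (he : IsIdempotentElem e) (x : R) : he.Corner :=
  ⟨e * x * e, x, rfl⟩

/-! ### The tensor algebra of a bimodule -/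

/-- The defining relations of the tensor algebra of an `A`-`A`-bimodule `M`: `A` is embedded by a
homomorphism of `ℝ`-algebras, `M` is embedded additively, and the products `a m` and `m a` are
those given by the bimodule. The right action of `a` is the action of `op a`. -/
inductive TensorRing.Rel (A M : Type*) [Ring A] [Algebra ℝ A] [AddCommGroup M] [Module A M]
    [Module Aᵐᵒᵖ M] : FreeAlgebra ℝ (A ⊕ M) → FreeAlgebra ℝ (A ⊕ M) → Prop
  | algebraMap (r : ℝ) : Rel A M (FreeAlgebra.ι ℝ (Sum.inl (algebraMap ℝ A r)))
      (algebraMap ℝ (FreeAlgebra ℝ (A ⊕ M)) r)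
  | ring_add (a b : A) : Rel A M (FreeAlgebra.ι ℝ (Sum.inl (a + b)))
      (FreeAlgebra.ι ℝ (Sum.inl a) + FreeAlgebra.ι ℝ (Sum.inl b))
  | ring_mul (a b : A) : Rel A M (FreeAlgebra.ι ℝ (Sum.inl (a * b)))
      (FreeAlgebra.ι ℝ (Sum.inl a) * FreeAlgebra.ι ℝ (Sum.inl b))
  | module_add (m n : M) : Rel A M (FreeAlgebra.ι ℝ (Sum.inr (m + n)))
      (FreeAlgebra.ι ℝ (Sum.inr m) + FreeAlgebra.ι ℝ (Sum.inr n))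
  | left_smul (a : A) (m : M) : Rel A M (FreeAlgebra.ι ℝ (Sum.inr (a • m)))
      (FreeAlgebra.ι ℝ (Sum.inl a) * FreeAlgebra.ι ℝ (Sum.inr m))
  | right_smul (a : A) (m : M) : Rel A M (FreeAlgebra.ι ℝ (Sum.inr (op a • m)))
      (FreeAlgebra.ι ℝ (Sum.inr m) * FreeAlgebra.ι ℝ (Sum.inl a))

/-- The tensor algebra `T(A, M) = A ⊕ M ⊕ (M ⊗_A M) ⊕ ⋯` of a bimodule `M` over an `ℝ`-algebra `A`
(with `ℝ` acting centrally on `M`), given by its standard presentation: it is the universal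
`ℝ`-algebra with an algebra map from `A` and a compatible `A`-`A`-bilinear map from `M`. -/
def TensorRing (A M : Type*) [Ring A] [Algebra ℝ A] [AddCommGroup M] [Module A M]
    [Module Aᵐᵒᵖ M] [SMulCommClass A Aᵐᵒᵖ M] : Type _ :=
  RingQuot (TensorRing.Rel A M)

section TensorRing

variable (A M : Type*) [Ring A] [Algebra ℝ A] [AddCommGroup M] [Module A M]
    [Module Aᵐᵒᵖ M] [SMulCommClass A Aᵐᵒᵖ M]

instance : Ring (TensorRing A M) := inferInstanceAs (Ring (RingQuot (TensorRing.Rel A M)))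

instance : Algebra ℝ (TensorRing A M) :=
  inferInstanceAs (Algebra ℝ (RingQuot (TensorRing.Rel A M)))

/-- The degree-zero part `A → T(A, M)`. -/
def TensorRing.ofRing (a : A) : TensorRing A M :=
  RingQuot.mkAlgHom ℝ (TensorRing.Rel A M) (FreeAlgebra.ι ℝ (Sum.inl a))

/-- The degree-one part `M → T(A, M)`. -/
def TensorRing.ofModule (m : M) : TensorRing A M :=
  RingQuot.mkAlgHom ℝ (TensorRing.Rel A M) (FreeAlgebra.ι ℝ (Sum.inr m))

end TensorRing

/-! ### The division rings and their simple bimodules -/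

/-- Labels for the division rings `ℝ`, `ℂ`, `ℍ`. -/
inductive DivKind
  | R
  | C
  | H
  deriving DecidableEq

/-- The division ring `ℝ`, `ℂ` or `ℍ`. The units `𝐣, 𝐤, 𝐥` of `ℍ` in the usual embedding
into `M₂(ℂ)` below are Mathlib's `i, j, k`. -/
def DivRing : DivKind → Type
  | .R => ℝ
  | .C => ℂ
  | .H => ℍ[ℝ]

instance : (k : DivKind) → DivisionRing (DivRing k)
  | .R => inferInstanceAs (DivisionRing ℝ)
  | .C => inferInstanceAs (DivisionRing ℂ)
  | .H => inferInstanceAs (DivisionRing ℍ[ℝ])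

instance : (k : DivKind) → Algebra ℝ (DivRing k)
  | .R => inferInstanceAs (Algebra ℝ ℝ)
  | .C => inferInstanceAs (Algebra ℝ ℂ)
  | .H => inferInstanceAs (Algebra ℝ ℍ[ℝ])

/-- `ℍ` as the algebra of complex matrices `[a, b; -b̄, ā]`, with
`𝐣 = diag(i, -i)`, `𝐤 = [0, 1; -1, 0]`, `𝐥 = [0, i; i, 0]`. -/
def quatMatrix (q : ℍ[ℝ]) : Matrix (Fin 2) (Fin 2) ℂ :=
  !![⟨q.re, q.imI⟩, ⟨q.imJ, q.imK⟩; ⟨-q.imJ, q.imK⟩, ⟨q.re, -q.imI⟩]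

theorem quatMatrix_one : quatMatrix 1 = 1 := by
  ext i j
  fin_cases i <;> fin_cases j <;> simp [quatMatrix, Complex.ext_iff]

theorem quatMatrix_zero : quatMatrix 0 = 0 := by
  ext i j
  fin_cases i <;> fin_cases j <;> simp [quatMatrix, Complex.ext_iff]

theorem quatMatrix_add (p q : ℍ[ℝ]) : quatMatrix (p + q) = quatMatrix p + quatMatrix q := by
  ext i j
  fin_cases i <;> fin_cases j <;> simp [quatMatrix, Complex.ext_iff] <;> ring

theorem quatMatrix_mul (p q : ℍ[ℝ]) : quatMatrix (p * q) = quatMatrix p * quatMatrix q := by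
  ext i j
  fin_cases i <;> fin_cases j <;>
    simp [quatMatrix, Complex.ext_iff, Matrix.mul_apply, Fin.sum_univ_two] <;>
    constructor <;> ring

/-- The simple `D_k`-`D_l`-bimodules, for `D_k, D_l ∈ {ℝ, ℂ, ℍ}`. There is one for each pair
`(k, l)`, except that there are two `ℂ`-`ℂ`-bimodules, `ℂ` and `ℂ̄`; they are indexed by
`σ ∈ Gal(ℂ/ℝ)`, which plays no role for the other pairs. The `ℍ`-`ℂ`-bimodule consists of
the columns, the `ℂ`-`ℍ`-bimodule of the rows of length two over `ℂ`. -/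
def SimpleBimod : DivKind → DivKind → Gal(ℂ/ℝ) → Type
  | .R, .R, _ => ℝ
  | .R, .C, _ => ℂ
  | .R, .H, _ => ℍ[ℝ]
  | .C, .R, _ => ℂ
  | .C, .C, _ => ℂ
  | .C, .H, _ => Fin 2 → ℂ
  | .H, .R, _ => ℍ[ℝ]
  | .H, .C, _ => Fin 2 → ℂ
  | .H, .H, _ => ℍ[ℝ]

instance : (k l : DivKind) → (σ : Gal(ℂ/ℝ)) → AddCommGroup (SimpleBimod k l σ)
  | .R, .R, _ => inferInstanceAs (AddCommGroup ℝ)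
  | .R, .C, _ => inferInstanceAs (AddCommGroup ℂ)
  | .R, .H, _ => inferInstanceAs (AddCommGroup ℍ[ℝ])
  | .C, .R, _ => inferInstanceAs (AddCommGroup ℂ)
  | .C, .C, _ => inferInstanceAs (AddCommGroup ℂ)
  | .C, .H, _ => inferInstanceAs (AddCommGroup (Fin 2 → ℂ))
  | .H, .R, _ => inferInstanceAs (AddCommGroup ℍ[ℝ])
  | .H, .C, _ => inferInstanceAs (AddCommGroup (Fin 2 → ℂ))
  | .H, .H, _ => inferInstanceAs (AddCommGroup ℍ[ℝ])

/-- The left action of `D_k`. -/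
def leftAct : (k l : DivKind) → (σ : Gal(ℂ/ℝ)) → DivRing k → SimpleBimod k l σ → SimpleBimod k l σ
  | .R, .R, _ => fun (a x : ℝ) => (a * x : ℝ)
  | .R, .C, _ => fun (a : ℝ) (x : ℂ) => ((a : ℂ) * x : ℂ)
  | .R, .H, _ => fun (a : ℝ) (x : ℍ[ℝ]) => ((a : ℍ[ℝ]) * x : ℍ[ℝ])
  | .C, .R, _ => fun (a x : ℂ) => (a * x : ℂ)
  | .C, .C, _ => fun (a x : ℂ) => (a * x : ℂ)
  | .C, .H, _ => fun (a : ℂ) (x : Fin 2 → ℂ) => (fun i => a * x i : Fin 2 → ℂ)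
  | .H, .R, _ => fun (a x : ℍ[ℝ]) => (a * x : ℍ[ℝ])
  | .H, .C, _ => fun (a : ℍ[ℝ]) (x : Fin 2 → ℂ) => (quatMatrix a *ᵥ x : Fin 2 → ℂ)
  | .H, .H, _ => fun (a x : ℍ[ℝ]) => (a * x : ℍ[ℝ])

/-- The right action of `D_l`; on the `ℂ`-`ℂ`-bimodule with label `σ`, it is `x · c = x σ(c)`. -/
def rightAct : (k l : DivKind) → (σ : Gal(ℂ/ℝ)) → SimpleBimod k l σ → DivRing l → SimpleBimod k l σ
  | .R, .R, _ => fun (x a : ℝ) => (x * a : ℝ)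
  | .R, .C, _ => fun (x a : ℂ) => (x * a : ℂ)
  | .R, .H, _ => fun (x a : ℍ[ℝ]) => (x * a : ℍ[ℝ])
  | .C, .R, _ => fun (x : ℂ) (a : ℝ) => (x * (a : ℂ) : ℂ)
  | .C, .C, σ => fun (x a : ℂ) => (x * σ a : ℂ)
  | .C, .H, _ => fun (x : Fin 2 → ℂ) (a : ℍ[ℝ]) => (x ᵥ* quatMatrix a : Fin 2 → ℂ)
  | .H, .R, _ => fun (x : ℍ[ℝ]) (a : ℝ) => (x * (a : ℍ[ℝ]) : ℍ[ℝ])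
  | .H, .C, _ => fun (x : Fin 2 → ℂ) (a : ℂ) => (fun i => x i * a : Fin 2 → ℂ)
  | .H, .H, _ => fun (x a : ℍ[ℝ]) => (x * a : ℍ[ℝ])

section

variable {R S : Type*} [Semiring R] [Semiring S] (f : R →+* S) (a b : R) (x : S)

theorem hom_mul_mul : f (a * b) * x = f a * (f b * x) := by rw [map_mul, mul_assoc]
theorem hom_add_mul : f (a + b) * x = f a * x + f b * x := by rw [map_add, add_mul]
theorem mul_hom_one : x * f 1 = x := by rw [map_one, mul_one]
theorem mul_hom_zero : x * f 0 = 0 := by rw [map_zero, mul_zero]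
theorem mul_hom_mul : x * f (a * b) = x * f a * f b := by rw [map_mul, mul_assoc]
theorem mul_hom_add : x * f (a + b) = x * f a + x * f b := by rw [map_add, mul_add]

end

theorem mulVec_mul_right (m : Matrix (Fin 2) (Fin 2) ℂ) (c : ℂ) (x : Fin 2 → ℂ) :
    m *ᵥ (fun i => x i * c) = fun i => (m *ᵥ x) i * c := by
  ext i
  simp [Matrix.mulVec, dotProduct, Fin.sum_univ_two]
  ring

theorem mul_left_vecMul (m : Matrix (Fin 2) (Fin 2) ℂ) (c : ℂ) (x : Fin 2 → ℂ) :
    (fun i => c * (x ᵥ* m) i) = (fun i => c * x i) ᵥ* m := by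
  ext i
  simp [Matrix.vecMul, dotProduct, Fin.sum_univ_two]
  ring

instance (k l : DivKind) (σ : Gal(ℂ/ℝ)) : Module (DivRing k) (SimpleBimod k l σ) where
  smul := leftAct k l σ
  one_smul x := by
    cases k <;> cases l
    all_goals first
      | exact one_mul (M := ℝ) _
      | exact one_mul (M := ℂ) _
      | exact one_mul (M := ℍ[ℝ]) _
      | exact funext fun i => one_mul (M := ℂ) _
      | exact (congrArg (· *ᵥ (x : Fin 2 → ℂ)) quatMatrix_one).trans (Matrix.one_mulVec _)
  mul_smul a b x := by
    cases k <;> cases l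
    all_goals first
      | exact mul_assoc (G := ℝ) _ _ _
      | exact mul_assoc (G := ℂ) _ _ _
      | exact mul_assoc (G := ℍ[ℝ]) _ _ _
      | exact funext fun i => mul_assoc (G := ℂ) _ _ _
      | exact (congrArg (· *ᵥ (x : Fin 2 → ℂ)) (quatMatrix_mul a b)).trans
          (Matrix.mulVec_mulVec _ _ _).symm
      | exact hom_mul_mul Complex.ofRealHom a b x
      | exact hom_mul_mul (algebraMap ℝ ℍ[ℝ]) a b x
  smul_zero a := by
    cases k <;> cases l
    all_goals first
      | exact mul_zero (M₀ := ℝ) _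
      | exact mul_zero (M₀ := ℂ) _
      | exact mul_zero (M₀ := ℍ[ℝ]) _
      | exact funext fun i => mul_zero (M₀ := ℂ) _
      | exact Matrix.mulVec_zero (quatMatrix a)
  smul_add a x y := by
    cases k <;> cases l
    all_goals first
      | exact mul_add (R := ℝ) _ _ _
      | exact mul_add (R := ℂ) _ _ _
      | exact mul_add (R := ℍ[ℝ]) _ _ _
      | exact funext fun i => mul_add (R := ℂ) _ _ _
      | exact Matrix.mulVec_add (quatMatrix a) _ _
  add_smul a b x := by
    cases k <;> cases l
    all_goals first
      | exact add_mul (R := ℝ) _ _ _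
      | exact add_mul (R := ℂ) _ _ _
      | exact add_mul (R := ℍ[ℝ]) _ _ _
      | exact funext fun i => add_mul (R := ℂ) _ _ _
      | exact (congrArg (· *ᵥ (x : Fin 2 → ℂ)) (quatMatrix_add a b)).trans
          (Matrix.add_mulVec _ _ _)
      | exact hom_add_mul Complex.ofRealHom a b x
      | exact hom_add_mul (algebraMap ℝ ℍ[ℝ]) a b x
  zero_smul x := by
    cases k <;> cases l
    all_goals first
      | exact zero_mul (M₀ := ℝ) _
      | exact zero_mul (M₀ := ℂ) _
      | exact zero_mul (M₀ := ℍ[ℝ]) _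
      | exact funext fun i => zero_mul (M₀ := ℂ) _
      | exact (congrArg (· *ᵥ (x : Fin 2 → ℂ)) quatMatrix_zero).trans (Matrix.zero_mulVec _)

instance (k l : DivKind) (σ : Gal(ℂ/ℝ)) : Module (DivRing l)ᵐᵒᵖ (SimpleBimod k l σ) where
  smul a x := rightAct k l σ x (unop a)
  one_smul x := by
    cases k <;> cases l
    all_goals first
      | exact mul_one (M := ℝ) _
      | exact mul_one (M := ℂ) _
      | exact mul_one (M := ℍ[ℝ]) _
      | exact mul_hom_one (σ : ℂ →+* ℂ) x
      | exact funext fun i => mul_one (M := ℂ) _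
      | exact (congrArg ((x : Fin 2 → ℂ) ᵥ* ·) quatMatrix_one).trans (Matrix.vecMul_one _)
  mul_smul a b x := by
    cases k <;> cases l
    all_goals first
      | exact (mul_assoc (G := ℝ) _ _ _).symm
      | exact (mul_assoc (G := ℂ) _ _ _).symm
      | exact (mul_assoc (G := ℍ[ℝ]) _ _ _).symm
      | exact mul_hom_mul (σ : ℂ →+* ℂ) (unop b) (unop a) x
      | exact funext fun i => (mul_assoc (G := ℂ) _ _ _).symm
      | exact (congrArg ((x : Fin 2 → ℂ) ᵥ* ·) (quatMatrix_mul (unop b) (unop a))).trans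
          (Matrix.vecMul_vecMul _ _ _).symm
      | exact mul_hom_mul Complex.ofRealHom (unop b) (unop a) x
      | exact mul_hom_mul (algebraMap ℝ ℍ[ℝ]) (unop b) (unop a) x
  smul_zero a := by
    cases k <;> cases l
    all_goals first
      | exact zero_mul (M₀ := ℝ) _
      | exact zero_mul (M₀ := ℂ) _
      | exact zero_mul (M₀ := ℍ[ℝ]) _
      | exact funext fun i => zero_mul (M₀ := ℂ) _
      | exact Matrix.zero_vecMul (quatMatrix (unop a))
  smul_add a x y := by
    cases k <;> cases l
    all_goals first
      | exact add_mul (R := ℝ) _ _ _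
      | exact add_mul (R := ℂ) _ _ _
      | exact add_mul (R := ℍ[ℝ]) _ _ _
      | exact funext fun i => add_mul (R := ℂ) _ _ _
      | exact Matrix.add_vecMul (quatMatrix (unop a)) _ _
  add_smul a b x := by
    cases k <;> cases l
    all_goals first
      | exact mul_add (R := ℝ) _ _ _
      | exact mul_add (R := ℂ) _ _ _
      | exact mul_add (R := ℍ[ℝ]) _ _ _
      | exact mul_hom_add (σ : ℂ →+* ℂ) (unop a) (unop b) x
      | exact funext fun i => mul_add (R := ℂ) _ _ _
      | exact (congrArg ((x : Fin 2 → ℂ) ᵥ* ·) (quatMatrix_add (unop a) (unop b))).trans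
          (Matrix.vecMul_add _ _ _)
      | exact mul_hom_add Complex.ofRealHom (unop a) (unop b) x
      | exact mul_hom_add (algebraMap ℝ ℍ[ℝ]) (unop a) (unop b) x
  zero_smul x := by
    cases k <;> cases l
    all_goals first
      | exact mul_zero (M₀ := ℝ) _
      | exact mul_zero (M₀ := ℂ) _
      | exact mul_zero (M₀ := ℍ[ℝ]) _
      | exact mul_hom_zero (σ : ℂ →+* ℂ) x
      | exact funext fun i => mul_zero (M₀ := ℂ) _
      | exact (congrArg ((x : Fin 2 → ℂ) ᵥ* ·) quatMatrix_zero).trans (Matrix.vecMul_zero _)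

instance (k l : DivKind) (σ : Gal(ℂ/ℝ)) :
    SMulCommClass (DivRing k) (DivRing l)ᵐᵒᵖ (SimpleBimod k l σ) where
  smul_comm a b x := by
    cases k <;> cases l
    all_goals first
      | exact (mul_assoc (G := ℝ) _ _ _).symm
      | exact (mul_assoc (G := ℂ) _ _ _).symm
      | exact (mul_assoc (G := ℍ[ℝ]) _ _ _).symm
      | exact funext fun i => (mul_assoc (G := ℂ) _ _ _).symm
      | exact mulVec_mul_right (quatMatrix a) (unop b) x
      | exact mul_left_vecMul (quatMatrix (unop b)) a x

/-! ### Modulated quivers and their tensor algebras -/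

/-- A modulated quiver over `ℝ` with vertex set `V` and arrow set `E`: every vertex carries one of
the division rings `ℝ, ℂ, ℍ`, and every arrow `α` one of the simple bimodules over the rings at
its target (on the left) and at its source (on the right). The label `twist α` distinguishes the
two simple `ℂ`-`ℂ`-bimodules and is irrelevant for the other arrows. -/
structure ModulatedQuiver (V E : Type*) where
  src : E → V
  tgt : E → V
  ring : V → DivKind
  twist : E → Gal(ℂ/ℝ)

namespace ModulatedQuiver

variable {V E : Type*} (Γ : ModulatedQuiver V E)

/-- The ring `∏ᵢ 𝓜(i)`. -/
abbrev VertexRing : Type _ := ∀ v : V, DivRing (Γ.ring v)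

/-- The bimodule `⨁_α 𝓜(α)` (for a finite quiver). -/
def ArrowBimod : Type _ :=
  ∀ a : E, SimpleBimod (Γ.ring (Γ.tgt a)) (Γ.ring (Γ.src a)) (Γ.twist a)

instance : AddCommGroup Γ.ArrowBimod :=
  inferInstanceAs (AddCommGroup
    (∀ a : E, SimpleBimod (Γ.ring (Γ.tgt a)) (Γ.ring (Γ.src a)) (Γ.twist a)))

instance : Module Γ.VertexRing Γ.ArrowBimod where
  smul r m := fun a => r (Γ.tgt a) • m a
  one_smul m := funext fun a => one_smul (DivRing (Γ.ring (Γ.tgt a))) (m a)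
  mul_smul r s m := funext fun a => mul_smul (r (Γ.tgt a)) (s (Γ.tgt a)) (m a)
  smul_zero r := funext fun a => smul_zero (r (Γ.tgt a))
  smul_add r m n := funext fun a => smul_add (r (Γ.tgt a)) (m a) (n a)
  add_smul r s m := funext fun a => add_smul (r (Γ.tgt a)) (s (Γ.tgt a)) (m a)
  zero_smul m := funext fun a => zero_smul (DivRing (Γ.ring (Γ.tgt a))) (m a)

instance : Module Γ.VertexRingᵐᵒᵖ Γ.ArrowBimod where
  smul r m := fun a => op (unop r (Γ.src a)) • m a
  one_smul m := funext fun a => one_smul (DivRing (Γ.ring (Γ.src a)))ᵐᵒᵖ (m a)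
  mul_smul r s m := funext fun a =>
    mul_smul (op (unop r (Γ.src a))) (op (unop s (Γ.src a))) (m a)
  smul_zero r := funext fun a => smul_zero (op (unop r (Γ.src a)))
  smul_add r m n := funext fun a => smul_add (op (unop r (Γ.src a))) (m a) (n a)
  add_smul r s m := funext fun a =>
    add_smul (op (unop r (Γ.src a))) (op (unop s (Γ.src a))) (m a)
  zero_smul m := funext fun a => zero_smul (DivRing (Γ.ring (Γ.src a)))ᵐᵒᵖ (m a)

instance : SMulCommClass Γ.VertexRing Γ.VertexRingᵐᵒᵖ Γ.ArrowBimod where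
  smul_comm r s m := by
    funext a
    change r (Γ.tgt a) • op (unop s (Γ.src a)) • m a = op (unop s (Γ.src a)) • r (Γ.tgt a) • m a
    exact smul_comm _ _ _

/-- The tensor algebra `T(Q, 𝓜)` of a modulated quiver. -/
abbrev TensorAlg : Type _ := TensorRing Γ.VertexRing Γ.ArrowBimod

end ModulatedQuiver

/-! ### Semilinear path algebras and their quotients -/

/-- An arrow is ordinary, or it is a special loop with polynomial `x² - 1` or `x² + 1`. -/
inductive ArrowType
  | ordinary
  | sqSubOne
  | sqAddOne
  deriving DecidableEq

/-- A quiver with vertices `V` and arrows `E`, with twists in `Gal(ℂ/ℝ)` on the arrows, and with a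
set of special loops: these are twisted by conjugation, each of them is associated with `x² - 1`
or `x² + 1`, and there is at most one at each vertex. -/
structure SemilinearQuiver (V E : Type*) where
  src : E → V
  tgt : E → V
  twist : E → Gal(ℂ/ℝ)
  type : E → ArrowType
  special_loop : ∀ a, type a ≠ .ordinary → src a = tgt a
  special_twist : ∀ a, type a ≠ .ordinary → twist a = Complex.conjAe
  special_unique : ∀ a b, type a ≠ .ordinary → type b ≠ .ordinary → src a = src b → a = b

/-- The generators of a semilinear path algebra as an `ℝ`-algebra. -/
inductive PathGen (V E : Type*)
  | scalar (c : ℂ)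
  | vert (v : V)
  | arrow (a : E)

namespace SemilinearQuiver

variable {V E : Type*} [Fintype V] [Fintype E] (Q : SemilinearQuiver V E)

/-- The relations of the semilinear path algebra: those making `ℂ` act through a homomorphism of
`ℝ`-algebras, and the relations between trivial paths, arrows and scalars. -/
inductive Rel : FreeAlgebra ℝ (PathGen V E) → FreeAlgebra ℝ (PathGen V E) → Prop
  | scalar_real (r : ℝ) : Rel (FreeAlgebra.ι ℝ (.scalar (r : ℂ))) (algebraMap ℝ _ r)
  | scalar_add (c d : ℂ) : Rel (FreeAlgebra.ι ℝ (.scalar (c + d)))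
      (FreeAlgebra.ι ℝ (.scalar c) + FreeAlgebra.ι ℝ (.scalar d))
  | scalar_mul (c d : ℂ) : Rel (FreeAlgebra.ι ℝ (.scalar (c * d)))
      (FreeAlgebra.ι ℝ (.scalar c) * FreeAlgebra.ι ℝ (.scalar d))
  | vert_idem (v : V) : Rel (FreeAlgebra.ι ℝ (.vert v) * FreeAlgebra.ι ℝ (.vert v))
      (FreeAlgebra.ι ℝ (.vert v))
  | vert_orth (v w : V) (h : v ≠ w) :
      Rel (FreeAlgebra.ι ℝ (.vert v) * FreeAlgebra.ι ℝ (.vert w)) 0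
  | vert_sum : Rel (∑ v : V, FreeAlgebra.ι ℝ (.vert v)) 1
  | tgt_mul (a : E) : Rel (FreeAlgebra.ι ℝ (.vert (Q.tgt a)) * FreeAlgebra.ι ℝ (.arrow a))
      (FreeAlgebra.ι ℝ (.arrow a))
  | mul_src (a : E) : Rel (FreeAlgebra.ι ℝ (.arrow a) * FreeAlgebra.ι ℝ (.vert (Q.src a)))
      (FreeAlgebra.ι ℝ (.arrow a))
  | vert_scalar (v : V) (c : ℂ) :
      Rel (FreeAlgebra.ι ℝ (.vert v) * FreeAlgebra.ι ℝ (.scalar c))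
        (FreeAlgebra.ι ℝ (.scalar c) * FreeAlgebra.ι ℝ (.vert v))
  | arrow_scalar (a : E) (c : ℂ) :
      Rel (FreeAlgebra.ι ℝ (.arrow a) * FreeAlgebra.ι ℝ (.scalar c))
        (FreeAlgebra.ι ℝ (.scalar (Q.twist a c)) * FreeAlgebra.ι ℝ (.arrow a))

/-- The semilinear path algebra `ℂ_σ Q`. -/
def PathAlg : Type _ := RingQuot Q.Rel

instance : Ring Q.PathAlg := inferInstanceAs (Ring (RingQuot Q.Rel))

instance : Algebra ℝ Q.PathAlg := inferInstanceAs (Algebra ℝ (RingQuot Q.Rel))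

/-- The generators of `ℂ_σ Q`. -/
def gen (x : PathGen V E) : Q.PathAlg := RingQuot.mkAlgHom ℝ Q.Rel (FreeAlgebra.ι ℝ x)

/-- The trivial path `e_v`. -/
def vert (v : V) : Q.PathAlg := Q.gen (.vert v)

/-- An arrow as an element of `ℂ_σ Q`. -/
def arrow (a : E) : Q.PathAlg := Q.gen (.arrow a)

/-- A complex number as an element of `ℂ_σ Q`. -/
def scalar (c : ℂ) : Q.PathAlg := Q.gen (.scalar c)

/-- The set `S` of the elements `s² - e_v` and `s² + e_v` of `ℂ_σ Q`, for the special loops `s`. -/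
def specialRelations : Set Q.PathAlg :=
  {x | ∃ s, Q.type s = .sqSubOne ∧ x = Q.arrow s * Q.arrow s - Q.vert (Q.src s)} ∪
  {x | ∃ s, Q.type s = .sqAddOne ∧ x = Q.arrow s * Q.arrow s + Q.vert (Q.src s)}

/-- The element of `ℂ_σ Q` given by a sequence of arrows, written from left to right. -/
def pathElem (p : List E) : Q.PathAlg := (p.map Q.arrow).prod

/-- A sequence of arrows is a path (of positive length) if each arrow starts where the next one in
the list ends: `[α, β]` is the path `αβ`, first `β` and then `α`. -/
def IsPath (p : List E) : Prop := p ≠ [] ∧ p.IsChain (fun a b => Q.src a = Q.tgt b)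

/-- The ideal `⟨S⟩` of `ℂ_σ Q`. -/
def idealS : TwoSidedIdeal Q.PathAlg := TwoSidedIdeal.span Q.specialRelations

/-- The ideal `⟨S ∪ Z⟩` of `ℂ_σ Q`, for a set `Z` of paths. -/
def idealSZ (Z : Set (List E)) : TwoSidedIdeal Q.PathAlg :=
  TwoSidedIdeal.span (Q.specialRelations ∪ Q.pathElem '' Z)

/-- The ideal of `ℂ_σ Q / ⟨S⟩` generated by the classes of the paths in `Z`. -/
def idealZ (Z : Set (List E)) : TwoSidedIdeal (IdealQuotient Q.idealS) :=
  TwoSidedIdeal.span ((fun p => IdealQuotient.mk Q.idealS (Q.pathElem p)) '' Z)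

/-- The algebra `ℂ_σ Q / ⟨S ∪ Z⟩` is `ℂ`-semilinear clannish of gentle type. -/
structure IsGentleType (Z : Set (List E)) : Prop where
  isPath : ∀ p ∈ Z, Q.IsPath p
  two_le_length : ∀ p ∈ Z, 2 ≤ p.length
  head_ordinary : ∀ p ∈ Z, ∀ a ∈ p.head?, Q.type a = .ordinary
  last_ordinary : ∀ p ∈ Z, ∀ a ∈ p.getLast?, Q.type a = .ordinary
  no_special_square : ∀ p ∈ Z, ∀ s, Q.type s ≠ .ordinary → ¬ [s, s] <:+: p
  card_out : ∀ v, {a | Q.src a = v}.ncard ≤ 2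
  card_in : ∀ v, {a | Q.tgt a = v}.ncard ≤ 2
  right_notMem : ∀ a, Q.type a = .ordinary → {b | Q.IsPath [a, b] ∧ [a, b] ∉ Z}.Subsingleton
  left_notMem : ∀ a, Q.type a = .ordinary → {c | Q.IsPath [c, a] ∧ [c, a] ∉ Z}.Subsingleton
  right_mem : ∀ a, Q.type a = .ordinary → {b | Q.IsPath [a, b] ∧ [a, b] ∈ Z}.Subsingleton
  left_mem : ∀ a, Q.type a = .ordinary → {c | Q.IsPath [c, a] ∧ [c, a] ∈ Z}.Subsingleton
  length_eq_two : ∀ p ∈ Z, p.length = 2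

open Classical in
/-- The division ring attached to a vertex: `ℝ` if it carries a special loop with polynomial
`x² - 1`, `ℍ` if it carries one with `x² + 1`, and `ℂ` if it carries no special loop. -/
def kind (v : V) : DivKind :=
  if ∃ s, Q.type s = .sqSubOne ∧ Q.src s = v then .R
  else if ∃ s, Q.type s = .sqAddOne ∧ Q.src s = v then .H
  else .C

open Classical in
/-- The special loop at `v`, as an element of `ℂ_σ Q`, if there is one, and `0` otherwise. -/
def loopAt (v : V) : Q.PathAlg :=
  ∑ s : E, if Q.type s ≠ .ordinary ∧ Q.src s = v then Q.arrow s else 0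

/-- The element `ε_v`: it is `(e_v + s_v) / 2` at vertices of type `ℝ`, and `e_v` otherwise. -/
def epsAt (v : V) : Q.PathAlg :=
  if Q.kind v = .R then (1 / 2 : ℝ) • (Q.vert v + Q.loopAt v) else Q.vert v

/-- The element `∑ ε_v` of `ℂ_σ Q` that represents the idempotent `ε`. -/
def eps : Q.PathAlg := ∑ v : V, Q.epsAt v

section idempotent

theorem gen_rel {x y : FreeAlgebra ℝ (PathGen V E)} (h : Q.Rel x y) :
    RingQuot.mkAlgHom ℝ Q.Rel x = RingQuot.mkAlgHom ℝ Q.Rel y :=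
  RingQuot.mkAlgHom_rel ℝ h

theorem vert_mul_vert_self (v : V) : Q.vert v * Q.vert v = Q.vert v := by
  have h := Q.gen_rel (.vert_idem v)
  rwa [map_mul] at h

theorem vert_mul_vert_ne {v w : V} (hvw : v ≠ w) : Q.vert v * Q.vert w = 0 := by
  have h := Q.gen_rel (.vert_orth v w hvw)
  rwa [map_mul, map_zero] at h

theorem vert_tgt_mul (a : E) : Q.vert (Q.tgt a) * Q.arrow a = Q.arrow a := by
  have h := Q.gen_rel (.tgt_mul a)
  rwa [map_mul] at h

theorem arrow_mul_vert_src (a : E) : Q.arrow a * Q.vert (Q.src a) = Q.arrow a := by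
  have h := Q.gen_rel (.mul_src a)
  rwa [map_mul] at h

theorem loopAt_eq {s : E} (hs : Q.type s ≠ .ordinary) : Q.loopAt (Q.src s) = Q.arrow s := by
  classical
  unfold loopAt
  rw [Finset.sum_eq_single s]
  · rw [if_pos ⟨hs, rfl⟩]
  · intro b _ hb
    rw [if_neg]
    rintro ⟨h1, h2⟩
    exact hb (Q.special_unique b s h1 hs h2)
  · intro h
    exact absurd (Finset.mem_univ s) h

theorem exists_of_kind_R {v : V} (h : Q.kind v = .R) :
    ∃ s, Q.type s = .sqSubOne ∧ Q.src s = v := by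
  classical
  by_contra hn
  unfold kind at h
  rw [if_neg hn] at h
  split_ifs at h

theorem vert_mul_epsAt (v : V) : Q.vert v * Q.epsAt v = Q.epsAt v := by
  unfold epsAt
  split_ifs with h
  · obtain ⟨s, hs, rfl⟩ := Q.exists_of_kind_R h
    have hs' : Q.type s ≠ .ordinary := by simp [hs]
    rw [Q.loopAt_eq hs', mul_smul_comm, mul_add, vert_mul_vert_self]
    nth_rewrite 2 [Q.special_loop s hs']
    rw [vert_tgt_mul]
  · exact Q.vert_mul_vert_self v

theorem epsAt_mul_vert (v : V) : Q.epsAt v * Q.vert v = Q.epsAt v := by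
  unfold epsAt
  split_ifs with h
  · obtain ⟨s, hs, rfl⟩ := Q.exists_of_kind_R h
    have hs' : Q.type s ≠ .ordinary := by simp [hs]
    rw [Q.loopAt_eq hs', smul_mul_assoc, add_mul, vert_mul_vert_self, arrow_mul_vert_src]
  · exact Q.vert_mul_vert_self v

theorem epsAt_mul_epsAt_ne {v w : V} (h : v ≠ w) : Q.epsAt v * Q.epsAt w = 0 := by
  rw [← Q.epsAt_mul_vert v, ← Q.vert_mul_epsAt w, mul_assoc, ← mul_assoc (Q.vert v),
    Q.vert_mul_vert_ne h, zero_mul, mul_zero]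

theorem epsAt_sq_sub_mem (v : V) : Q.epsAt v * Q.epsAt v - Q.epsAt v ∈ Q.idealS := by
  unfold epsAt
  split_ifs with h
  · obtain ⟨s, hs, rfl⟩ := Q.exists_of_kind_R h
    have hs' : Q.type s ≠ .ordinary := by simp [hs]
    have h1 : Q.vert (Q.src s) * Q.arrow s = Q.arrow s := by
      nth_rewrite 1 [Q.special_loop s hs']
      exact Q.vert_tgt_mul s
    have h2 : Q.arrow s * Q.arrow s - Q.vert (Q.src s) ∈ Q.idealS :=
      TwoSidedIdeal.subset_span (Or.inl ⟨s, hs, rfl⟩)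
    have h3 := Q.idealS.mul_mem_left (algebraMap ℝ Q.PathAlg (1 / 4)) _ h2
    rw [← Algebra.smul_def] at h3
    convert h3 using 1
    rw [Q.loopAt_eq hs']
    simp only [smul_mul_assoc, mul_smul_comm, mul_add, add_mul, vert_mul_vert_self, h1,
      arrow_mul_vert_src]
    module
  · rw [vert_mul_vert_self, sub_self]
    exact Q.idealS.zero_mem

/-- The element `ε` is idempotent modulo every ideal that contains `S`. -/
theorem isIdempotentElem_eps {J : TwoSidedIdeal Q.PathAlg} (hJ : Q.idealS ≤ J) :
    IsIdempotentElem (IdealQuotient.mk J Q.eps) := by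
  have key : ∀ v, IdealQuotient.mk J (Q.epsAt v * Q.epsAt v) =
      IdealQuotient.mk J (Q.epsAt v) := fun v =>
    (RingCon.eq J.ringCon).mpr ((TwoSidedIdeal.rel_iff J _ _).mpr (hJ (Q.epsAt_sq_sub_mem v)))
  classical
  unfold IsIdempotentElem
  rw [← map_mul]
  unfold eps
  rw [Finset.sum_mul, map_sum, map_sum]
  refine Finset.sum_congr rfl fun v _ => ?_
  rw [Finset.mul_sum, Finset.sum_eq_single v, key v]
  · intro w _ hw
    exact Q.epsAt_mul_epsAt_ne (Ne.symm hw)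
  · intro h
    exact absurd (Finset.mem_univ v) h

theorem idealS_le_idealSZ (Z : Set (List E)) : Q.idealS ≤ Q.idealSZ Z :=
  TwoSidedIdeal.span_mono Set.subset_union_left

theorem isIdempotentElem_S : IsIdempotentElem (IdealQuotient.mk Q.idealS Q.eps) :=
  Q.isIdempotentElem_eps le_rfl

theorem isIdempotentElem_SZ (Z : Set (List E)) :
    IsIdempotentElem (IdealQuotient.mk (Q.idealSZ Z) Q.eps) :=
  Q.isIdempotentElem_eps (Q.idealS_le_idealSZ Z)

end idempotent

/-- The corner `ε (ℂ_σ Q / ⟨S⟩) ε`. -/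
abbrev CornerS : Type _ := Q.isIdempotentElem_S.Corner

/-- The corner `ε (ℂ_σ Q / ⟨S ∪ Z⟩) ε`. -/
abbrev CornerSZ (Z : Set (List E)) : Type _ := (Q.isIdempotentElem_SZ Z).Corner

/-! ### The modulated quiver of `ℂ_σ Q / ⟨S⟩` -/

/-- The arrows of `Q^b`: the arrow `(α, false)`, written `α`, for every ordinary arrow `α` of `Q`,
and a parallel arrow `(α, true)`, written `α^𝐢`, if both ends of `α` are of type `ℝ` or both
are of type `ℍ`. -/
def BasicArrow : Type _ :=
  {p : E × Bool // Q.type p.1 = .ordinary ∧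
    (p.2 = true → Q.kind (Q.src p.1) = Q.kind (Q.tgt p.1) ∧ Q.kind (Q.src p.1) ≠ .C)}

/-- The modulated quiver `(Q^b, 𝓜)`. -/
def basicQuiver : ModulatedQuiver V Q.BasicArrow where
  src b := Q.src b.1.1
  tgt b := Q.tgt b.1.1
  ring := Q.kind
  twist b := Q.twist b.1.1

end SemilinearQuiver

/-! ### The isomorphism `Φ` -/

/-- The image of `z e_v + w s_v` (with `z, w ∈ ℂ`) under the isomorphism of `A_v` with `M₂(ℝ)`,
`ℍ` or `ℂ`, for a vertex `v` of type `ℝ`, `ℍ` or `ℂ`. It is determined by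
`𝐢 ↦ [0, -1; 1, 0]`, `s_v ↦ diag(1, -1)` for type `ℝ`, by `𝐢 ↦ 𝐣`, `s_v ↦ 𝐤` for type `ℍ`, and
is `z` for type `ℂ`, where there is no `s_v`. Elements of `ℍ` and `ℂ` are written as matrices
supported in the upper left corner. -/
def phiVert : (k : DivKind) → (z w : ℂ) → Matrix (Fin 2) (Fin 2) (DivRing k)
  | .R, z, w => (!![z.re, -z.im; z.im, z.re] + !![w.re, -w.im; w.im, w.re] * !![1, 0; 0, -1] :
      Matrix (Fin 2) (Fin 2) ℝ)
  | .C, z, _ => (!![z, 0; 0, 0] : Matrix (Fin 2) (Fin 2) ℂ)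
  | .H, z, w => (!![⟨z.re, z.im, 0, 0⟩ + ⟨w.re, w.im, 0, 0⟩ * ⟨0, 0, 1, 0⟩, 0; 0, 0] :
      Matrix (Fin 2) (Fin 2) ℍ[ℝ])

open Classical in
/-- The component in `𝓜(α)` (for `false`) or in `𝓜(α^𝐢)` (for `true`) of the image of an ordinary
arrow `α` with twist `σ`, target of type `k` and source of type `l`, under the isomorphism of the
bimodule `A_t α A_s` with a bimodule of matrices. These matrices have two rows if `k` is `ℝ` and
one row otherwise, two columns if `l` is `ℝ` and one column otherwise, and are completed by zeros
here. The component at `true` is zero if `α^𝐢` does not exist. -/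
def phiArrow : (k l : DivKind) → (σ : Gal(ℂ/ℝ)) → Bool →
    Matrix (Fin 2) (Fin 2) (SimpleBimod k l σ)
  | .R, .R, σ, false => (if σ = 1 then !![1, 0; 0, 1] else !![1, 0; 0, -1] :
      Matrix (Fin 2) (Fin 2) ℝ)
  | .R, .R, σ, true => (if σ = 1 then !![0, -1; 1, 0] else !![0, 1; 1, 0] :
      Matrix (Fin 2) (Fin 2) ℝ)
  | .R, .H, σ, false => (if σ = 1 then !![1, 0; -⟨0, 1, 0, 0⟩, 0] else !![1, 0; ⟨0, 1, 0, 0⟩, 0] :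
      Matrix (Fin 2) (Fin 2) ℍ[ℝ])
  | .R, .C, σ, false => (if σ = 1 then !![1, 0; -Complex.I, 0] else !![1, 0; Complex.I, 0] :
      Matrix (Fin 2) (Fin 2) ℂ)
  | .H, .R, σ, false => (if σ = 1 then !![1, ⟨0, 1, 0, 0⟩; 0, 0] else !![1, -⟨0, 1, 0, 0⟩; 0, 0] :
      Matrix (Fin 2) (Fin 2) ℍ[ℝ])
  | .H, .H, σ, false => (if σ = 1 then !![1, 0; 0, 0] else !![⟨0, 0, 1, 0⟩, 0; 0, 0] :
      Matrix (Fin 2) (Fin 2) ℍ[ℝ])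
  | .H, .H, σ, true => (if σ = 1 then !![⟨0, 1, 0, 0⟩, 0; 0, 0] else !![⟨0, 0, 0, 1⟩, 0; 0, 0] :
      Matrix (Fin 2) (Fin 2) ℍ[ℝ])
  | .H, .C, σ, false => (if σ = 1 then !![![1, 0], 0; 0, 0] else !![![0, 1], 0; 0, 0] :
      Matrix (Fin 2) (Fin 2) (Fin 2 → ℂ))
  | .C, .R, σ, false => (if σ = 1 then !![1, Complex.I; 0, 0] else !![1, -Complex.I; 0, 0] :
      Matrix (Fin 2) (Fin 2) ℂ)
  | .C, .H, σ, false => (if σ = 1 then !![![1, 0], 0; 0, 0] else !![![0, 1], 0; 0, 0] :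
      Matrix (Fin 2) (Fin 2) (Fin 2 → ℂ))
  | .C, .C, _, false => (!![1, 0; 0, 0] : Matrix (Fin 2) (Fin 2) ℂ)
  | _, _, _, true => 0

/-- The upper left entry of the product of matrices `X · M · Y`, for matrices `X` over `D_k`,
`M` over a `D_k`-`D_l`-bimodule, and `Y` over `D_l`. -/
def cornerEntry {k l : DivKind} {σ : Gal(ℂ/ℝ)} (X : Matrix (Fin 2) (Fin 2) (DivRing k))
    (M : Matrix (Fin 2) (Fin 2) (SimpleBimod k l σ)) (Y : Matrix (Fin 2) (Fin 2) (DivRing l)) :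
    SimpleBimod k l σ :=
  ∑ p, ∑ q, X 0 p • op (Y q 0) • M p q

namespace SemilinearQuiver

variable {V E : Type*} [Fintype V] [Fintype E] (Q : SemilinearQuiver V E)

/-- The element `z e_v + w s_v` of `A_v`. -/
def vertElem (v : V) (z w : ℂ) : Q.PathAlg := Q.scalar z * Q.vert v + Q.scalar w * Q.loopAt v

open Classical in
/-- The element of `⨁ 𝓜(β)` with components the upper left entries of the images of
`(z e + w s) α (z' e + w' s)` in `𝓜(α)` and `𝓜(α^𝐢)`. -/
def phiArrowElem (a : E) (z w z' w' : ℂ) : Q.basicQuiver.ArrowBimod := fun b =>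
  if b.1.1 = a then
    cornerEntry (phiVert (Q.kind (Q.tgt b.1.1)) z w)
      (phiArrow (Q.kind (Q.tgt b.1.1)) (Q.kind (Q.src b.1.1)) (Q.twist b.1.1) b.1.2)
      (phiVert (Q.kind (Q.src b.1.1)) z' w')
  else 0

open Classical in
/-- The values that characterise the isomorphism `Φ : ε (ℂ_σ Q / ⟨S⟩) ε ≃ T(Q^b, 𝓜)`. The corner is
generated by the elements `ε x ε` with `x` in `A_v` or in `A_t α A_s` for an ordinary arrow `α`;
the isomorphisms of these spaces with spaces of matrices are multiplied by `ε` on both sides, where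
`ε_v` becomes the matrix unit `[1, 0; 0, 0]` at the vertices of type `ℝ`. -/
structure IsPhi (Φ : Q.CornerS ≃ₐ[ℝ] Q.basicQuiver.TensorAlg) : Prop where
  vertex : ∀ (v : V) (z w : ℂ),
    Φ (compress Q.isIdempotentElem_S (IdealQuotient.mk Q.idealS (Q.vertElem v z w))) =
      TensorRing.ofRing _ _ (Pi.single v (phiVert (Q.kind v) z w 0 0))
  arrow : ∀ a : E, Q.type a = .ordinary → ∀ z w z' w' : ℂ,
    Φ (compress Q.isIdempotentElem_S (IdealQuotient.mk Q.idealS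
        (Q.vertElem (Q.tgt a) z w * Q.arrow a * Q.vertElem (Q.src a) z' w'))) =
      TensorRing.ofModule _ _ (Q.phiArrowElem a z w z' w')

end SemilinearQuiver

end SemilinearClannish

end

noncomputable section

set_option linter.unusedSectionVars false

namespace SemilinearClannish

/-! ### Corners of rings -/

section Corner

variable {R : Type*} [Ring R] [Algebra ℝ R] {e : R} (he : IsIdempotentElem e)

/-! At a vertex v the algebra A_v is M₂(ℝ), ℍ or ℂ, and ε_v is the matrix unit E₁₁ in the first case
and the identity in the others. Compression by ε therefore replaces A_v by the division ring 𝓜(v),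
and A_t α A_s by 𝓜(α) or 𝓜(α) ⊕ 𝓜(α^𝐢). The proof turns this into two maps between the corner and T
= T(Q^b, 𝓜).

From the corner to T: the values of φ on generators define a homomorphism `pathHom` from ℂ_σ Q to a
corner of M₂(T). The relations reduce to identities between matrix entries, which are finite checks
over the vertex types and the two twists (`phiVert_mul`, `phiArrow_mul_scalar`). The map kills S, so
it induces `matHom`. Since ε goes to E₁₁ (`matHom_eps`), taking the upper left entry gives an
algebra homomorphism `cornerHom` with the prescribed values.

From T to the corner: `divCoef` and `arrowCoef` choose explicit representatives of elements of 𝓜(v)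
in A_v and of the bimodules in A_t α A_s. The chosen copy of ∏ 𝓜(v) commutes with ε, so compression
yields compatible maps, and the universal property gives `tensorHom`. The elements `rowUnit p` and
`colUnit q` play the roles of E₁ₚ and E_q₁ and satisfy ∑ col_q row_q = 1. The central identity
`tensorHom_pathHom` says that the entry (p, q) of the matrix of x goes to row_p x col_q. For p = q =
0 it makes `tensorHom` a left inverse of `cornerHom`.

Surjectivity of `cornerHom` holds because the prescribed values generate T (`subalgebra_eq_top`),
and the same fact gives uniqueness (`IsPhi.eq`). The ideal I is the kernel of the composite of Φ⁻¹
with the projection of the corner modulo ⟨S⟩ onto the corner modulo ⟨S ∪ Z⟩, and this kernel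
corresponds to ε⟨Z⟩ε. Finally, ∑ col_q ε row_q = 1 shows that ε is a full idempotent, and
`isMoritaEquivalent_corner` applies. -/

theorem idem_mul_corner (c : he.Corner) : e * c.1 = c.1 :=
  ((Subsemigroup.mem_corner_iff he).mp c.2).1

theorem corner_mul_idem (c : he.Corner) : c.1 * e = c.1 :=
  ((Subsemigroup.mem_corner_iff he).mp c.2).2

theorem corner_val_mul (c d : he.Corner) : (c * d).1 = c.1 * d.1 := rfl
theorem corner_val_add (c d : he.Corner) : (c + d).1 = c.1 + d.1 := rfl
theorem corner_val_zero : (0 : he.Corner).1 = 0 := rfl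
theorem corner_val_smul (r : ℝ) (c : he.Corner) : (r • c).1 = r • c.1 := rfl

theorem compress_val_self (c : he.Corner) : compress he c.1 = c :=
  Subtype.ext (by
    change e * c.1 * e = c.1
    rw [idem_mul_corner, corner_mul_idem])

/-- The inclusion of a corner as an additive map. -/
def cornerVal : he.Corner →+ R where
  toFun c := c.1
  map_zero' := rfl
  map_add' _ _ := rfl

theorem corner_val_sum {ι : Type*} (s : Finset ι) (f : ι → he.Corner) :
    (∑ i ∈ s, f i).1 = ∑ i ∈ s, (f i).1 :=
  map_sum (cornerVal he) f s

end Corner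

/-! ### Morita equivalence with the corner at a full idempotent -/

section Morita

open CategoryTheory
open scoped ModuleCat.Algebra

universe u

variable {R : Type u} [Ring R] [Algebra ℝ R] {e : R} (he : IsIdempotentElem e)

/-- The additive group `eM`. -/
def cornerPart (e : R) (M : Type*) [AddCommGroup M] [Module R M] : AddSubgroup M where
  carrier := {m | e • m = m}
  zero_mem' := smul_zero e
  add_mem' {a b} ha hb := by
    change e • (a + b) = a + b
    rw [smul_add, ha, hb]
  neg_mem' {a} ha := by
    change e • (-a) = -a
    rw [smul_neg, ha]

theorem smul_cornerPart {M : Type*} [AddCommGroup M] [Module R M] (m : cornerPart e M) :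
    e • m.1 = m.1 := m.2

include he in
theorem idem_smul_mem_cornerPart {M : Type*} [AddCommGroup M] [Module R M] (m : M) :
    e • m ∈ cornerPart e M := by
  change e • e • m = e • m
  rw [smul_smul, he.eq]

instance cornerPartModule (M : Type*) [AddCommGroup M] [Module R M] :
    Module he.Corner (cornerPart e M) where
  smul c m := ⟨c.1 • m.1, by
    change e • c.1 • m.1 = c.1 • m.1
    rw [smul_smul, idem_mul_corner]⟩
  one_smul m := Subtype.ext m.2
  mul_smul c d m := Subtype.ext (mul_smul c.1 d.1 m.1)
  smul_zero c := Subtype.ext (smul_zero c.1)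
  smul_add c m n := Subtype.ext (smul_add c.1 m.1 n.1)
  add_smul c d m := Subtype.ext (add_smul c.1 d.1 m.1)
  zero_smul m := Subtype.ext (zero_smul R m.1)

/-- The restriction of a linear map to `eM → eN`. -/
def cornerPartMap {M N : Type*} [AddCommGroup M] [Module R M] [AddCommGroup N] [Module R N]
    (f : M →ₗ[R] N) : cornerPart e M →ₗ[he.Corner] cornerPart e N where
  toFun m := ⟨f m.1, by
    change e • f m.1 = f m.1
    rw [← map_smul, smul_cornerPart]⟩
  map_add' m n := Subtype.ext (map_add f m.1 n.1)
  map_smul' c m := Subtype.ext (map_smul f c.1 m.1)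

/-- The functor `M ↦ eM` from `R`-modules to `eRe`-modules. -/
def cornerFunctor : ModuleCat.{u} R ⥤ ModuleCat.{u} he.Corner where
  obj M := ModuleCat.of he.Corner (cornerPart e M)
  map f := ModuleCat.ofHom (cornerPartMap he f.hom)
  map_id _ := rfl
  map_comp _ _ := rfl

/-- A real number r acts on eM through the element r • e of the corner, which agrees with r because
e fixes eM. -/
instance cornerFunctor_linear : (cornerFunctor he).Linear ℝ where
  map_smul {M N} f r := by
    ext (m : cornerPart e M)
    apply Subtype.ext
    change algebraMap ℝ R r • f.hom m.1 = (r • e) • f.hom m.1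
    rw [Algebra.smul_def, mul_smul, ← map_smul f.hom e, smul_cornerPart m]

variable {ι : Type} [Fintype ι] (x y : ι → R)

theorem sum_full_smul (hxy : ∑ i, x i * e * y i = 1) {M : Type*} [AddCommGroup M] [Module R M]
    (m : M) : ∑ i, x i • e • y i • m = m := by
  simp_rw [smul_smul, ← mul_assoc]
  rw [← Finset.sum_smul, hxy, one_smul]

/-- Since m = ∑ xᵢ e yᵢ m, a linear map is determined by its values on eM. -/
theorem cornerFunctor_faithful (hxy : ∑ i, x i * e * y i = 1) : (cornerFunctor he).Faithful where
  map_injective {M N f g} h := by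
    ext m
    have key : ∀ m : M, f.hom (e • m) = g.hom (e • m) := fun m =>
      congrArg Subtype.val (LinearMap.congr_fun (congrArg ModuleCat.Hom.hom h)
        (⟨e • m, idem_smul_mem_cornerPart he m⟩ : cornerPart e M))
    rw [← sum_full_smul x y hxy m, map_sum, map_sum]
    refine Finset.sum_congr rfl fun i _ => ?_
    rw [map_smul f.hom, map_smul g.hom, key]

/-- The linear map `M → N` that extends a linear map `eM → eN`. -/
def cornerPartExtend (hxy : ∑ i, x i * e * y i = 1) {M N : Type*} [AddCommGroup M] [Module R M]
    [AddCommGroup N] [Module R N] (g : cornerPart e M →ₗ[he.Corner] cornerPart e N) :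
    M →ₗ[R] N where
  toFun m := ∑ i, x i • (g ⟨e • y i • m, idem_smul_mem_cornerPart he _⟩).1
  map_add' m n := by
    rw [← Finset.sum_add_distrib]
    refine Finset.sum_congr rfl fun i _ => ?_
    rw [← smul_add, ← AddSubgroup.coe_add, ← map_add]
    congr 3
    apply Subtype.ext
    simp only [smul_add, AddSubgroup.coe_add]
  map_smul' a m := by
    rw [RingHom.id_apply]
    -- Inserting 1 = ∑ xⱼ e yⱼ after a writes e yᵢ a m as a combination of the vectors e yⱼ m with
    -- coefficients in eRe, over which g is linear.
    have h1 : ∀ i, (g ⟨e • y i • a • m, idem_smul_mem_cornerPart he _⟩).1 =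
        ∑ j, (e * (y i * a * x j) * e) • (g ⟨e • y j • m, idem_smul_mem_cornerPart he _⟩).1 := by
      intro i
      have h2 : (⟨e • y i • a • m, idem_smul_mem_cornerPart he _⟩ : cornerPart e M) =
          ∑ j, compress he (y i * a * x j) •
            (⟨e • y j • m, idem_smul_mem_cornerPart he _⟩ : cornerPart e M) := by
        apply Subtype.ext
        rw [AddSubgroup.val_finsetSum]
        change _ = ∑ j, (e * (y i * a * x j) * e) • (e • y j • m)
        conv_lhs => rw [← sum_full_smul x y hxy m]
        simp only [Finset.smul_sum, smul_smul]
        refine Finset.sum_congr rfl fun j _ => ?_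
        congr 1
        simp only [mul_assoc]
        rw [← mul_assoc e e, he.eq]
      rw [h2, map_sum, AddSubgroup.val_finsetSum]
      refine Finset.sum_congr rfl fun j _ => ?_
      rw [map_smul]
      rfl
    simp_rw [h1, Finset.smul_sum]
    rw [Finset.sum_comm]
    refine Finset.sum_congr rfl fun j _ => ?_
    rw [← smul_cornerPart (g ⟨e • y j • m, idem_smul_mem_cornerPart he _⟩)]
    simp only [smul_smul, ← Finset.sum_smul]
    congr 1
    simp only [mul_assoc, he.eq]
    conv_rhs => rw [← one_mul (a * _), ← hxy, Finset.sum_mul]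
    simp only [mul_assoc]

/-- `cornerPartExtend` restricts to the given map on eM: for m in eM one has e yᵢ m = (e yᵢ e) m, so
the map commutes with this operation and the sum collapses. -/
theorem cornerFunctor_full (hxy : ∑ i, x i * e * y i = 1) : (cornerFunctor he).Full where
  map_surjective {M N} g := by
    obtain ⟨f, hf⟩ : ∃ f : cornerPart e M →ₗ[he.Corner] cornerPart e N, f = g.hom := ⟨_, rfl⟩
    refine ⟨ModuleCat.ofHom (cornerPartExtend he x y hxy f), ModuleCat.hom_ext (hf ▸ ?_)⟩
    refine LinearMap.ext fun (m : cornerPart e M) => Subtype.ext ?_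
    change ∑ i, x i • (f ⟨e • y i • m.1, _⟩).1 = (f m).1
    have h2 : ∀ i, (⟨e • y i • m.1, idem_smul_mem_cornerPart he _⟩ : cornerPart e M) =
        compress he (y i) • m := by
      intro i
      apply Subtype.ext
      change e • y i • m.1 = (e * y i * e) • m.1
      rw [mul_smul, smul_cornerPart m, mul_smul]
    have h3 : ∀ i, (f ⟨e • y i • m.1, idem_smul_mem_cornerPart he _⟩).1 =
        e • y i • (f m).1 := by
      intro i
      rw [h2, map_smul]
      change (e * y i * e) • (f m).1 = _
      rw [mul_smul, smul_cornerPart, mul_smul]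
    simp_rw [h3]
    exact sum_full_smul x y hxy (f m).1

/-- The `R`-module `Hom_{eRe}(eR, N)` for an `eRe`-module `N`, as a group of maps on `R`. -/
def cornerCoind (N : Type*) [AddCommGroup N] [Module he.Corner N] : AddSubgroup (R →+ N) where
  carrier := {f | ∀ (c : he.Corner) (r : R), f (c.1 * r) = c • f r}
  zero_mem' c r := (smul_zero c).symm
  add_mem' {f g} hf hg c r := by
    rw [AddMonoidHom.add_apply, AddMonoidHom.add_apply, hf, hg, smul_add]
  neg_mem' {f} hf c r := by
    rw [AddMonoidHom.neg_apply, AddMonoidHom.neg_apply, hf, smul_neg]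

/-- Right multiplication on the argument is compatible with left equivariance under eRe.
Equivariance at the unit of the corner reads f(e r) = f(r), so these maps on R amount to maps on eR.
-/
instance cornerCoindModule (N : Type*) [AddCommGroup N] [Module he.Corner N] :
    Module R (cornerCoind he N) where
  smul a f := ⟨f.1.comp (AddMonoidHom.mulRight a), fun c r => by
    change f.1 (c.1 * r * a) = c • f.1 (r * a)
    rw [mul_assoc, f.2]⟩
  one_smul f := Subtype.ext (AddMonoidHom.ext fun r => congrArg f.1 (mul_one r))
  mul_smul a b f := Subtype.ext (AddMonoidHom.ext fun r => congrArg f.1 (mul_assoc r a b).symm)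
  smul_zero a := rfl
  smul_add a f g := rfl
  add_smul a b f := Subtype.ext (AddMonoidHom.ext fun r =>
    (congrArg f.1 (mul_add r a b)).trans (map_add f.1 _ _))
  zero_smul f := Subtype.ext (AddMonoidHom.ext fun r =>
    (congrArg f.1 (mul_zero r)).trans (map_zero f.1))

theorem compress_add (a b : R) : compress he (a + b) = compress he a + compress he b :=
  Subtype.ext (by
    change e * (a + b) * e = e * a * e + e * b * e
    rw [mul_add, add_mul])

/-- The isomorphism of `e Hom_{eRe}(eR, N)` with `N`. -/
def cornerCoindEquiv (N : Type*) [AddCommGroup N] [Module he.Corner N] :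
    cornerPart e (cornerCoind he N) ≃ₗ[he.Corner] N where
  toFun f := f.1.1 e
  map_add' f g := rfl
  map_smul' c f := by
    change f.1.1 (e * c.1) = c • f.1.1 e
    rw [← f.1.2, idem_mul_corner, corner_mul_idem]
  invFun n := ⟨⟨{ toFun := fun r => compress he r • n
                  map_zero' := by
                    have h : compress he (0 : R) = 0 := Subtype.ext (by
                      change e * 0 * e = 0
                      rw [mul_zero, zero_mul])
                    exact (congrArg (· • n) h).trans (zero_smul he.Corner n)
                  map_add' := fun a b => by rw [compress_add, add_smul] }, fun c r => by
      change compress he (c.1 * r) • n = c • compress he r • n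
      rw [smul_smul]
      congr 1
      apply Subtype.ext
      change e * (c.1 * r) * e = c.1 * (e * r * e)
      rw [← mul_assoc, idem_mul_corner, mul_assoc, mul_assoc, ← mul_assoc c.1 e,
        corner_mul_idem]⟩, by
      apply Subtype.ext
      apply AddMonoidHom.ext
      intro r
      change compress he (r * e) • n = compress he r • n
      congr 1
      apply Subtype.ext
      change e * (r * e) * e = e * r * e
      rw [← mul_assoc, mul_assoc, he.eq]⟩
  left_inv f := by
    apply Subtype.ext
    apply Subtype.ext
    apply AddMonoidHom.ext
    intro r
    change compress he r • f.1.1 e = f.1.1 r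
    -- Membership in the e-part reads f(r e) = f(r), and equivariance at the unit of the corner
    -- gives f(e r) = f(r). Hence f factors through r ↦ e r e and is determined by f(e).
    have h1 : f.1.1 (r * e) = f.1.1 r := DFunLike.congr_fun (congrArg Subtype.val f.2) r
    have h2 := f.1.2 1 (r * e)
    rw [one_smul, h1] at h2
    rw [← f.1.2, ← h2]
    change f.1.1 (e * r * e * e) = f.1.1 (e * (r * e))
    rw [mul_assoc, he.eq, mul_assoc]
  right_inv n := by
    change compress he e • n = n
    have h : compress he e = 1 := Subtype.ext (by
      change e * e * e = e
      rw [he.eq, he.eq])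
    rw [h, one_smul]

/-- Idempotency of e is enough here; that e is full is needed only for the functor to be faithful
and full. -/
instance cornerFunctor_essSurj : (cornerFunctor he).EssSurj where
  mem_essImage N := ⟨ModuleCat.of R (cornerCoind he N), ⟨(cornerCoindEquiv he N).toModuleIso⟩⟩

/-- An algebra is Morita equivalent to its corner at a full idempotent. -/
theorem isMoritaEquivalent_corner (hxy : ∑ i, x i * e * y i = 1) :
    IsMoritaEquivalent ℝ R he.Corner := by
  have h1 := cornerFunctor_faithful he x y hxy
  have h2 := cornerFunctor_full he x y hxy
  have h3 : (cornerFunctor he).IsEquivalence := {}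
  exact ⟨⟨⟨(cornerFunctor he).asEquivalence, cornerFunctor_linear he⟩⟩⟩

end Morita

/-! ### Quotients and corners -/

theorem IdealQuotient.mk_eq_zero_iff {R : Type*} [Ring R] (J : TwoSidedIdeal R) (x : R) :
    IdealQuotient.mk J x = 0 ↔ x ∈ J :=
  RingCon.eq J.ringCon

theorem IdealQuotient.mk_surjective {R : Type*} [Ring R] (J : TwoSidedIdeal R) :
    Function.Surjective (IdealQuotient.mk J) := fun x => by
  obtain ⟨r, rfl⟩ := RingCon.mk'_surjective J.ringCon x
  exact ⟨r, rfl⟩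

/-- The algebra homomorphism on a quotient induced by a homomorphism that vanishes on the ideal. -/
def IdealQuotient.lift {R S : Type*} [Ring R] [Algebra ℝ R] [Ring S] [Algebra ℝ S]
    (J : TwoSidedIdeal R) (f : R →ₐ[ℝ] S) (hf : ∀ x ∈ J, f x = 0) : IdealQuotient J →ₐ[ℝ] S :=
  RingCon.liftₐ J.ringCon f fun x y h => by
    have h1 := hf _ ((TwoSidedIdeal.rel_iff J x y).mp h)
    rw [map_sub, sub_eq_zero] at h1
    exact h1

/-- The first isomorphism theorem, transported along an isomorphism `Φ : C ≃ T`. -/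
theorem exists_quotient_algEquiv {C D T : Type*} [Ring C] [Algebra ℝ C] [Ring D] [Algebra ℝ D]
    [Ring T] [Algebra ℝ T] (f : C →ₐ[ℝ] D) (hf : Function.Surjective f) (Φ : C ≃ₐ[ℝ] T)
    (I : TwoSidedIdeal T) (hI : ∀ t, t ∈ I ↔ f (Φ.symm t) = 0) :
    ∃ Ψ : D ≃ₐ[ℝ] IdealQuotient I, ∀ c, Ψ (f c) = IdealQuotient.mk I (Φ c) := by
  let g : IdealQuotient I →ₐ[ℝ] D :=
    IdealQuotient.lift I (f.comp Φ.symm.toAlgHom) fun t ht => (hI t).mp ht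
  have hg : ∀ t, g (IdealQuotient.mk I t) = f (Φ.symm t) := fun t => rfl
  have hb : Function.Bijective g := by
    constructor
    · rw [injective_iff_map_eq_zero]
      intro t ht
      obtain ⟨t, rfl⟩ := IdealQuotient.mk_surjective I t
      rw [hg] at ht
      exact (IdealQuotient.mk_eq_zero_iff I t).mpr ((hI t).mpr ht)
    · intro d
      obtain ⟨c, rfl⟩ := hf d
      exact ⟨IdealQuotient.mk I (Φ c), by rw [hg, AlgEquiv.symm_apply_apply]⟩
  refine ⟨(AlgEquiv.ofBijective g hb).symm, fun c => ?_⟩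
  rw [AlgEquiv.symm_apply_eq]
  change f c = g (IdealQuotient.mk I (Φ c))
  rw [hg, AlgEquiv.symm_apply_apply]

/-! ### Passage from ⟨S⟩ to ⟨S ∪ Z⟩ on quotients and corners -/

namespace SemilinearQuiver

variable {V E : Type*} [Fintype V] [Fintype E] (Q : SemilinearQuiver V E) (Z : Set (List E))

/-- The projection `ℂ_σ Q / ⟨S⟩ → ℂ_σ Q / ⟨S ∪ Z⟩`. -/
def quotMap : IdealQuotient Q.idealS →ₐ[ℝ] IdealQuotient (Q.idealSZ Z) :=
  IdealQuotient.lift Q.idealS (RingCon.mkₐ ℝ (Q.idealSZ Z).ringCon) fun x hx =>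
    (IdealQuotient.mk_eq_zero_iff (Q.idealSZ Z) x).mpr (Q.idealS_le_idealSZ Z hx)

theorem quotMap_mk (x : Q.PathAlg) :
    Q.quotMap Z (IdealQuotient.mk Q.idealS x) = IdealQuotient.mk (Q.idealSZ Z) x := rfl

/-- Third isomorphism theorem: each inclusion is checked on generators of the ideal, and S already
vanishes in the source. -/
theorem quotMap_eq_zero_iff (y : IdealQuotient Q.idealS) :
    Q.quotMap Z y = 0 ↔ y ∈ Q.idealZ Z := by
  constructor
  · obtain ⟨x, rfl⟩ := IdealQuotient.mk_surjective Q.idealS y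
    rw [quotMap_mk, IdealQuotient.mk_eq_zero_iff]
    have h : Q.idealSZ Z ≤ TwoSidedIdeal.comap (IdealQuotient.mk Q.idealS) (Q.idealZ Z) := by
      refine TwoSidedIdeal.span_le.mpr ?_
      rintro x (hx | ⟨p, hp, rfl⟩)
      · change x ∈ TwoSidedIdeal.comap _ _
        rw [TwoSidedIdeal.mem_comap,
          (IdealQuotient.mk_eq_zero_iff Q.idealS x).mpr (TwoSidedIdeal.subset_span hx)]
        exact (Q.idealZ Z).zero_mem
      · change Q.pathElem p ∈ TwoSidedIdeal.comap _ _
        rw [TwoSidedIdeal.mem_comap]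
        exact TwoSidedIdeal.subset_span ⟨p, hp, rfl⟩
    intro hx
    exact (TwoSidedIdeal.mem_comap (IdealQuotient.mk Q.idealS)).mp (h hx)
  · have h : Q.idealZ Z ≤ TwoSidedIdeal.ker (Q.quotMap Z) := by
      refine TwoSidedIdeal.span_le.mpr ?_
      rintro x ⟨p, hp, rfl⟩
      change _ ∈ TwoSidedIdeal.ker (Q.quotMap Z)
      rw [TwoSidedIdeal.mem_ker]
      exact (IdealQuotient.mk_eq_zero_iff (Q.idealSZ Z) _).mpr
        (TwoSidedIdeal.subset_span (Or.inr ⟨p, hp, rfl⟩))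
    intro hy
    exact (TwoSidedIdeal.mem_ker _).mp (h hy)

/-- The projection `ε (ℂ_σ Q / ⟨S⟩) ε → ε (ℂ_σ Q / ⟨S ∪ Z⟩) ε`. -/
def cornerMap : Q.CornerS →ₐ[ℝ] Q.CornerSZ Z where
  toFun c := ⟨Q.quotMap Z c.1, by
    obtain ⟨y, hy⟩ := c.2
    exact ⟨Q.quotMap Z y, by
      change IdealQuotient.mk (Q.idealSZ Z) Q.eps * _ * IdealQuotient.mk (Q.idealSZ Z) Q.eps = _
      rw [← hy, map_mul, map_mul, quotMap_mk]⟩⟩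
  map_one' := rfl
  map_mul' c d := Subtype.ext (map_mul (Q.quotMap Z) c.1 d.1)
  map_zero' := Subtype.ext (map_zero (Q.quotMap Z))
  map_add' c d := Subtype.ext (map_add (Q.quotMap Z) c.1 d.1)
  commutes' r := Subtype.ext (map_smul (Q.quotMap Z) r (IdealQuotient.mk Q.idealS Q.eps))

theorem cornerMap_compress (x : Q.PathAlg) :
    Q.cornerMap Z (compress Q.isIdempotentElem_S (IdealQuotient.mk Q.idealS x)) =
      compress (Q.isIdempotentElem_SZ Z) (IdealQuotient.mk (Q.idealSZ Z) x) := rfl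

/-- A preimage in the quotient by ⟨S⟩ need not lie in the corner; compressing it corrects this
without changing its image. -/
theorem cornerMap_surjective : Function.Surjective (Q.cornerMap Z) := by
  intro c
  obtain ⟨x, hx⟩ := IdealQuotient.mk_surjective _ c.1
  refine ⟨compress Q.isIdempotentElem_S (IdealQuotient.mk Q.idealS x), ?_⟩
  rw [cornerMap_compress, hx, compress_val_self]

theorem cornerMap_eq_zero_iff (c : Q.CornerS) : Q.cornerMap Z c = 0 ↔ c.1 ∈ Q.idealZ Z := by
  rw [← quotMap_eq_zero_iff]
  exact Subtype.ext_iff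

/-- The ideal `Φ(ε ⟨Z⟩ ε)`, and the isomorphism of quotients induced by `Φ`. -/
theorem exists_ideal_of_equiv {T : Type*} [Ring T] [Algebra ℝ T] (Φ : Q.CornerS ≃ₐ[ℝ] T) :
    ∃ I : TwoSidedIdeal T,
      (I : Set T) = {t | ∃ y ∈ Q.idealZ Z, t = Φ (compress Q.isIdempotentElem_S y)} ∧
      ∃ Ψ : Q.CornerSZ Z ≃ₐ[ℝ] IdealQuotient I, ∀ x : Q.PathAlg,
        Ψ (compress (Q.isIdempotentElem_SZ Z) (IdealQuotient.mk (Q.idealSZ Z) x)) =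
          IdealQuotient.mk I
            (Φ (compress Q.isIdempotentElem_S (IdealQuotient.mk Q.idealS x))) := by
  have hI : ∀ t, t ∈ TwoSidedIdeal.ker ((Q.cornerMap Z).comp Φ.symm.toAlgHom) ↔
      Q.cornerMap Z (Φ.symm t) = 0 := fun t => TwoSidedIdeal.mem_ker _
  -- As a kernel, I is two-sided at once. An element c of the corner equals ε c ε, which identifies
  -- this kernel with Φ(ε⟨Z⟩ε).
  refine ⟨TwoSidedIdeal.ker ((Q.cornerMap Z).comp Φ.symm.toAlgHom), ?_, ?_⟩
  · ext t
    rw [SetLike.mem_coe, hI, cornerMap_eq_zero_iff]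
    constructor
    · intro h
      exact ⟨_, h, by rw [compress_val_self, AlgEquiv.apply_symm_apply]⟩
    · rintro ⟨y, hy, rfl⟩
      rw [AlgEquiv.symm_apply_apply]
      exact (Q.idealZ Z).mul_mem_right _ _ ((Q.idealZ Z).mul_mem_left _ _ hy)
  · obtain ⟨Ψ, hΨ⟩ := exists_quotient_algEquiv (Q.cornerMap Z) (Q.cornerMap_surjective Z) Φ _ hI
    exact ⟨Ψ, fun x => by rw [← hΨ, cornerMap_compress]⟩

end SemilinearQuiver

/-! ### Complex coordinates on the division rings and the simple bimodules -/

open Complex (I)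

/-- The coordinates of an element of `D_k`, as an element `x e + y s` of `A_v`. -/
def divCoef : (k : DivKind) → DivRing k → ℂ × ℂ
  | .R => fun d : ℝ => (d, 0)
  | .C => fun d : ℂ => (d, 0)
  | .H => fun d : ℍ[ℝ] => (⟨d.re, d.imI⟩, ⟨d.imJ, d.imK⟩)

/-- The number `κ ∈ {1, 0, -1}` with `s² = κ e` at a vertex of type `k`. -/
def loopSign : DivKind → ℝ
  | .R => 1
  | .C => 0
  | .H => -1

open Classical in
/-- Coordinates `(p, q, r, t)` such that `m` in the component `b` corresponds to
`ε (p α + q s α + r α s' + t s α s') ε`. -/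
def arrowCoef : (k l : DivKind) → (σ : Gal(ℂ/ℝ)) → Bool → SimpleBimod k l σ → ℂ × ℂ × ℂ × ℂ
  | .R, .R, _, false => fun m : ℝ => (m, 0, 0, 0)
  -- For both twists, the upper left entry of φ(-𝐢α) is 0 in the component of α and 1 in that of
  -- α^𝐢.
  | .R, .R, _, true => fun m : ℝ => (-m * I, 0, 0, 0)
  -- Here m acts from the right, and αm = σ(m)α moves it to the left. The same applies to both
  -- coordinates of m for the source type ℍ.
  | .R, .C, σ, false => fun m : ℂ => (σ m, 0, 0, 0)
  | .R, .H, σ, false => fun m : ℍ[ℝ] => (σ ⟨m.re, m.imI⟩, 0, σ ⟨m.imJ, m.imK⟩, 0)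
  | .C, .R, _, false => fun m : ℂ => (m, 0, 0, 0)
  | .C, .C, _, false => fun m : ℂ => (m, 0, 0, 0)
  -- Right multiplication by 𝐤 sends the row [1, 0] to [0, 1] and the row [0, 1] to [-1, 0].
  | .C, .H, σ, false => fun m : Fin 2 → ℂ =>
      if σ = 1 then (m 0, 0, m 1, 0) else (m 1, 0, -m 0, 0)
  | .H, .R, _, false => fun m : ℍ[ℝ] => (⟨m.re, m.imI⟩, ⟨m.imJ, m.imK⟩, 0, 0)
  -- The unit 𝐤 sends the column (1, 0) to (0, -1) and (0, 1) to (1, 0). A complex scalar acts on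
  -- the second row by its conjugate, whence `star`.
  | .H, .C, σ, false => fun m : Fin 2 → ℂ =>
      if σ = 1 then (m 0, -star (m 1), 0, 0) else (star (m 1), m 0, 0, 0)
  -- For either twist φ(α - sαs') lies in 𝓜(α) and φ(α + sαs') lies in 𝓜(α^𝐢). Halving them gives
  -- the two components of φ(α), and the coordinates are those of the left multiple of such a
  -- component that equals m.
  | .H, .H, σ, false => fun m : ℍ[ℝ] =>
      if σ = 1 then (⟨m.re / 2, m.imI / 2⟩, ⟨m.imJ / 2, m.imK / 2⟩, ⟨m.imJ / 2, m.imK / 2⟩,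
        ⟨-m.re / 2, -m.imI / 2⟩)
      else (⟨m.imJ / 2, m.imK / 2⟩, ⟨-m.re / 2, -m.imI / 2⟩, ⟨-m.re / 2, -m.imI / 2⟩,
        ⟨-m.imJ / 2, -m.imK / 2⟩)
  | .H, .H, σ, true => fun m : ℍ[ℝ] =>
      if σ = 1 then (⟨m.imI / 2, -m.re / 2⟩, ⟨-m.imK / 2, m.imJ / 2⟩, ⟨m.imK / 2, -m.imJ / 2⟩,
        ⟨m.imI / 2, -m.re / 2⟩)
      else (⟨m.imK / 2, -m.imJ / 2⟩, ⟨m.imI / 2, -m.re / 2⟩, ⟨-m.imI / 2, m.re / 2⟩,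
        ⟨m.imK / 2, -m.imJ / 2⟩)
  | _, _, _, true => fun _ => 0

theorem gal_cases (σ : Gal(ℂ/ℝ)) : σ = 1 ∨ σ = Complex.conjAe := by
  rcases Complex.real_algHom_eq_id_or_conj (σ : ℂ →ₐ[ℝ] ℂ) with h | h
  · exact Or.inl (AlgEquiv.ext fun z => DFunLike.congr_fun h z)
  · exact Or.inr (AlgEquiv.ext fun z => DFunLike.congr_fun h z)

theorem conjAe_ne_one : (Complex.conjAe : Gal(ℂ/ℝ)) ≠ 1 := by
  intro h
  have h1 := congrArg Complex.im (DFunLike.congr_fun h I)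
  norm_num at h1

/-- The operations of `D_k`, computed by cases. -/
def divAdd : (k : DivKind) → DivRing k → DivRing k → DivRing k
  | .R => fun a b : ℝ => (a + b : ℝ)
  | .C => fun a b : ℂ => (a + b : ℂ)
  | .H => fun a b : ℍ[ℝ] => (a + b : ℍ[ℝ])

theorem div_add_eq (k : DivKind) (a b : DivRing k) : a + b = divAdd k a b := by
  cases k <;> rfl

/-- The multiplication of `D_k`, computed by cases. -/
def divMul : (k : DivKind) → DivRing k → DivRing k → DivRing k
  | .R => fun a b : ℝ => (a * b : ℝ)
  | .C => fun a b : ℂ => (a * b : ℂ)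
  | .H => fun a b : ℍ[ℝ] => (a * b : ℍ[ℝ])

theorem div_mul_eq (k : DivKind) (a b : DivRing k) : a * b = divMul k a b := by
  cases k <;> rfl

/-- The addition of a simple bimodule, computed by cases. -/
def bimodAdd : (k l : DivKind) → (σ : Gal(ℂ/ℝ)) → SimpleBimod k l σ → SimpleBimod k l σ →
    SimpleBimod k l σ
  | .R, .R, _ => fun a b : ℝ => (a + b : ℝ)
  | .R, .C, _ => fun a b : ℂ => (a + b : ℂ)
  | .R, .H, _ => fun a b : ℍ[ℝ] => (a + b : ℍ[ℝ])
  | .C, .R, _ => fun a b : ℂ => (a + b : ℂ)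
  | .C, .C, _ => fun a b : ℂ => (a + b : ℂ)
  | .C, .H, _ => fun a b : Fin 2 → ℂ => (a + b : Fin 2 → ℂ)
  | .H, .R, _ => fun a b : ℍ[ℝ] => (a + b : ℍ[ℝ])
  | .H, .C, _ => fun a b : Fin 2 → ℂ => (a + b : Fin 2 → ℂ)
  | .H, .H, _ => fun a b : ℍ[ℝ] => (a + b : ℍ[ℝ])

theorem bimod_add_eq {k l : DivKind} {σ : Gal(ℂ/ℝ)} (a b : SimpleBimod k l σ) :
    a + b = bimodAdd k l σ a b := by
  cases k <;> cases l <;> rfl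

theorem bimod_smul_eq {k l : DivKind} {σ : Gal(ℂ/ℝ)} (d : DivRing k) (m : SimpleBimod k l σ) :
    d • m = leftAct k l σ d m := rfl

theorem bimod_op_smul_eq {k l : DivKind} {σ : Gal(ℂ/ℝ)} (d : DivRing l)
    (m : SimpleBimod k l σ) : op d • m = rightAct k l σ m d := rfl

theorem arrowCoef_add (k l : DivKind) (σ : Gal(ℂ/ℝ)) (b : Bool) (m n : SimpleBimod k l σ) :
    arrowCoef k l σ b (m + n) = arrowCoef k l σ b m + arrowCoef k l σ b n := by
  rw [bimod_add_eq]
  rcases gal_cases σ with rfl | rfl <;> cases k <;> cases l <;> cases b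
  all_goals first
    | change ℝ at m n
    | change ℂ at m n
    | change ℍ[ℝ] at m n
    | change Fin 2 → ℂ at m n
  all_goals simp [arrowCoef, bimodAdd, conjAe_ne_one, Prod.ext_iff, Complex.ext_iff]
  all_goals ring_nf
  all_goals simp

/-- The coordinates of the product of elements of `A_v`. -/
def vertMul (κ : ℝ) (x y : ℂ × ℂ) : ℂ × ℂ :=
  (x.1 * y.1 + κ * x.2 * star y.2, x.1 * y.2 + x.2 * star y.1)

/-- The coordinates of the product of elements of `A_t` and `A_t α A_s`. -/
def coefLeft (κ : ℝ) (x : ℂ × ℂ) (m : ℂ × ℂ × ℂ × ℂ) : ℂ × ℂ × ℂ × ℂ :=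
  (x.1 * m.1 + κ * x.2 * star m.2.1, x.1 * m.2.1 + x.2 * star m.1,
    x.1 * m.2.2.1 + κ * x.2 * star m.2.2.2, x.1 * m.2.2.2 + x.2 * star m.2.2.1)

/-- The coordinates of the product of elements of `A_t α A_s` and `A_s`. -/
def coefRight (κ : ℝ) (σ : Gal(ℂ/ℝ)) (m : ℂ × ℂ × ℂ × ℂ) (x : ℂ × ℂ) : ℂ × ℂ × ℂ × ℂ :=
  (m.1 * σ x.1 + κ * m.2.2.1 * σ (star x.2), m.2.1 * σ (star x.1) + κ * m.2.2.2 * σ x.2,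
    m.1 * σ x.2 + m.2.2.1 * σ (star x.1), m.2.1 * σ (star x.2) + m.2.2.2 * σ x.1)

theorem divCoef_add (k : DivKind) (a b : DivRing k) :
    divCoef k (a + b) = divCoef k a + divCoef k b := by
  rw [div_add_eq]
  cases k
  all_goals first
    | change ℝ at a b
    | change ℂ at a b
    | change ℍ[ℝ] at a b
  all_goals simp [divCoef, divAdd, Prod.ext_iff, Complex.ext_iff]

/-- The chosen copy of the division ring is the centre ℝ of M₂(ℝ) at type ℝ and all of A_v at the
other types, so it is a subring. -/
theorem divCoef_mul (k : DivKind) (a b : DivRing k) :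
    divCoef k (a * b) = vertMul (loopSign k) (divCoef k a) (divCoef k b) := by
  rw [div_mul_eq]
  cases k
  all_goals first
    | change ℝ at a b
    | change ℂ at a b
    | change ℍ[ℝ] at a b
  all_goals simp [divCoef, divMul, vertMul, loopSign, Prod.ext_iff, Complex.ext_iff]
  all_goals ring_nf
  all_goals simp

theorem divCoef_one (k : DivKind) : divCoef k 1 = (1, 0) := by
  cases k
  · exact congrArg (·, 0) Complex.ofReal_one
  · rfl
  · rfl

theorem divCoef_algebraMap (k : DivKind) (r : ℝ) : divCoef k (algebraMap ℝ _ r) = ((r : ℂ), 0) := by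
  cases k <;> rfl

/-- The representatives respect the actions before ε is applied, so they give a bimodule map into
the whole quotient by ⟨S⟩, which is compressed only afterwards. -/
theorem arrowCoef_smul (k l : DivKind) (σ : Gal(ℂ/ℝ)) (b : Bool) (d : DivRing k)
    (m : SimpleBimod k l σ) :
    arrowCoef k l σ b (d • m) =
      coefLeft (loopSign k) (divCoef k d) (arrowCoef k l σ b m) := by
  rw [bimod_smul_eq]
  rcases gal_cases σ with rfl | rfl <;> cases k <;> cases l <;> cases b
  all_goals first
    | change ℝ at m
    | change ℂ at m
    | change ℍ[ℝ] at m
    | change Fin 2 → ℂ at m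
  all_goals first
    | change ℝ at d
    | change ℂ at d
    | change ℍ[ℝ] at d
  all_goals simp [arrowCoef, leftAct, coefLeft, divCoef, loopSign, conjAe_ne_one, Prod.ext_iff,
    Complex.ext_iff, quatMatrix, Matrix.mulVec, dotProduct]
  all_goals ring_nf
  all_goals simp

theorem arrowCoef_op_smul (k l : DivKind) (σ : Gal(ℂ/ℝ)) (b : Bool) (d : DivRing l)
    (m : SimpleBimod k l σ) :
    arrowCoef k l σ b (op d • m) =
      coefRight (loopSign l) σ (arrowCoef k l σ b m) (divCoef l d) := by
  rw [bimod_op_smul_eq]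
  rcases gal_cases σ with rfl | rfl <;> cases k <;> cases l <;> cases b
  all_goals first
    | change ℝ at m
    | change ℂ at m
    | change ℍ[ℝ] at m
    | change Fin 2 → ℂ at m
  all_goals first
    | change ℝ at d
    | change ℂ at d
    | change ℍ[ℝ] at d
  all_goals simp [arrowCoef, rightAct, coefRight, divCoef, loopSign, conjAe_ne_one, Prod.ext_iff,
    Complex.ext_iff, quatMatrix, Matrix.vecMul, dotProduct]
  all_goals ring_nf
  all_goals simp

/-- The zero of a simple bimodule, computed by cases. -/
def bimodZero : (k l : DivKind) → (σ : Gal(ℂ/ℝ)) → SimpleBimod k l σ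
  | .R, .R, _ => (0 : ℝ)
  | .R, .C, _ => (0 : ℂ)
  | .R, .H, _ => (0 : ℍ[ℝ])
  | .C, .R, _ => (0 : ℂ)
  | .C, .C, _ => (0 : ℂ)
  | .C, .H, _ => (0 : Fin 2 → ℂ)
  | .H, .R, _ => (0 : ℍ[ℝ])
  | .H, .C, _ => (0 : Fin 2 → ℂ)
  | .H, .H, _ => (0 : ℍ[ℝ])

theorem bimod_zero_eq {k l : DivKind} {σ : Gal(ℂ/ℝ)} :
    (0 : SimpleBimod k l σ) = bimodZero k l σ := by
  cases k <;> cases l <;> rfl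

/-! ### Matrix units and the entrywise identities satisfied by φ -/

/-- Left multiplication by this scalar, followed by `ε`, is the row `p` of the matrix units. -/
def unitLeft : DivKind → Fin 2 → ℂ
  | .R => ![1, -I]
  | .C => ![1, 0]
  | .H => ![1, 0]

/-- Right multiplication by this scalar, preceded by `ε`, is the column `q` of the matrix units. -/
def unitRight : DivKind → Fin 2 → ℂ
  | .R => ![1, I]
  | .C => ![1, 0]
  | .H => ![1, 0]

/-- Complex coordinates on a simple bimodule. -/
def bimodCoord : (k l : DivKind) → (σ : Gal(ℂ/ℝ)) → SimpleBimod k l σ → ℂ × ℂ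
  | .R, .R, _ => fun m : ℝ => (m, 0)
  | .R, .C, _ => fun m : ℂ => (m, 0)
  | .R, .H, _ => fun m : ℍ[ℝ] => (⟨m.re, m.imI⟩, ⟨m.imJ, m.imK⟩)
  | .C, .R, _ => fun m : ℂ => (m, 0)
  | .C, .C, _ => fun m : ℂ => (m, 0)
  | .C, .H, _ => fun m : Fin 2 → ℂ => (m 0, m 1)
  | .H, .R, _ => fun m : ℍ[ℝ] => (⟨m.re, m.imI⟩, ⟨m.imJ, m.imK⟩)
  | .H, .C, _ => fun m : Fin 2 → ℂ => (m 0, m 1)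
  | .H, .H, _ => fun m : ℍ[ℝ] => (⟨m.re, m.imI⟩, ⟨m.imJ, m.imK⟩)

theorem divCoef_injective (k : DivKind) : Function.Injective (divCoef k) := by
  intro a b h
  cases k
  · exact Complex.ofReal_injective (congrArg Prod.fst h)
  · exact congrArg Prod.fst h
  · exact QuaternionAlgebra.ext (congrArg (fun x => x.1.re) h) (congrArg (fun x => x.1.im) h)
      (congrArg (fun x => x.2.re) h) (congrArg (fun x => x.2.im) h)

theorem bimodCoord_injective (k l : DivKind) (σ : Gal(ℂ/ℝ)) :
    Function.Injective (bimodCoord k l σ) := by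
  intro a b h
  cases k <;> cases l
  all_goals first
    | exact Complex.ofReal_injective (congrArg Prod.fst h)
    | exact QuaternionAlgebra.ext (congrArg (fun x => x.1.re) h) (congrArg (fun x => x.1.im) h)
        (congrArg (fun x => x.2.re) h) (congrArg (fun x => x.2.im) h)
    | exact funext (Fin.forall_fin_two.mpr ⟨congrArg Prod.fst h, congrArg Prod.snd h⟩)
    | exact congrArg Prod.fst h

theorem bimodCoord_add (k l : DivKind) (σ : Gal(ℂ/ℝ)) (m n : SimpleBimod k l σ) :
    bimodCoord k l σ (m + n) = bimodCoord k l σ m + bimodCoord k l σ n := by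
  rw [bimod_add_eq]
  cases k <;> cases l
  all_goals first
    | change ℝ at m n
    | change ℂ at m n
    | change ℍ[ℝ] at m n
    | change Fin 2 → ℂ at m n
  all_goals simp [bimodCoord, bimodAdd, Prod.ext_iff, Complex.ext_iff]

/-- The quaternion with the given coordinates. -/
def quat (a b c d : ℝ) : ℍ[ℝ] := ⟨a, b, c, d⟩

@[simp] theorem quat_re (a b c d : ℝ) : (quat a b c d).re = a := rfl
@[simp] theorem quat_imI (a b c d : ℝ) : (quat a b c d).imI = b := rfl
@[simp] theorem quat_imJ (a b c d : ℝ) : (quat a b c d).imJ = c := rfl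
@[simp] theorem quat_imK (a b c d : ℝ) : (quat a b c d).imK = d := rfl

theorem phiVert_R (z w : ℂ) :
    phiVert .R z w = (!![z.re + w.re, w.im - z.im; z.im + w.im, z.re - w.re] :
      Matrix (Fin 2) (Fin 2) ℝ) := by
  change (!![z.re, -z.im; z.im, z.re] + !![w.re, -w.im; w.im, w.re] * !![1, 0; 0, -1] :
    Matrix (Fin 2) (Fin 2) ℝ) = _
  ext p q
  fin_cases p <;> fin_cases q <;> simp <;> ring

theorem phiVert_C (z w : ℂ) :
    phiVert .C z w = (!![z, 0; 0, 0] : Matrix (Fin 2) (Fin 2) ℂ) := rfl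

theorem phiVert_H (z w : ℂ) :
    phiVert .H z w = (!![quat z.re z.im w.re w.im, 0; 0, 0] : Matrix (Fin 2) (Fin 2) ℍ[ℝ]) := by
  have h : quat z.re z.im 0 0 + quat w.re w.im 0 0 * quat 0 0 1 0 =
      quat z.re z.im w.re w.im := by
    apply QuaternionAlgebra.ext <;> simp
  rw [← h]
  rfl

open Classical in
theorem phiArrow_RH (σ : Gal(ℂ/ℝ)) : phiArrow .R .H σ false =
    (if σ = 1 then !![1, 0; -quat 0 1 0 0, 0] else !![1, 0; quat 0 1 0 0, 0] :
      Matrix (Fin 2) (Fin 2) ℍ[ℝ]) := rfl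

open Classical in
theorem phiArrow_HR (σ : Gal(ℂ/ℝ)) : phiArrow .H .R σ false =
    (if σ = 1 then !![1, quat 0 1 0 0; 0, 0] else !![1, -quat 0 1 0 0; 0, 0] :
      Matrix (Fin 2) (Fin 2) ℍ[ℝ]) := rfl

open Classical in
theorem phiArrow_HH_false (σ : Gal(ℂ/ℝ)) : phiArrow .H .H σ false =
    (if σ = 1 then !![1, 0; 0, 0] else !![quat 0 0 1 0, 0; 0, 0] :
      Matrix (Fin 2) (Fin 2) ℍ[ℝ]) := rfl

open Classical in
theorem phiArrow_HH_true (σ : Gal(ℂ/ℝ)) : phiArrow .H .H σ true =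
    (if σ = 1 then !![quat 0 1 0 0, 0; 0, 0] else !![quat 0 0 0 1, 0; 0, 0] :
      Matrix (Fin 2) (Fin 2) ℍ[ℝ]) := rfl

open Classical in
theorem phiArrow_RR_false (σ : Gal(ℂ/ℝ)) : phiArrow .R .R σ false =
    (if σ = 1 then !![1, 0; 0, 1] else !![1, 0; 0, -1] : Matrix (Fin 2) (Fin 2) ℝ) := rfl

open Classical in
theorem phiArrow_RR_true (σ : Gal(ℂ/ℝ)) : phiArrow .R .R σ true =
    (if σ = 1 then !![0, -1; 1, 0] else !![0, 1; 1, 0] : Matrix (Fin 2) (Fin 2) ℝ) := rfl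

open Classical in
theorem phiArrow_RC (σ : Gal(ℂ/ℝ)) : phiArrow .R .C σ false =
    (if σ = 1 then !![1, 0; -I, 0] else !![1, 0; I, 0] : Matrix (Fin 2) (Fin 2) ℂ) := rfl

open Classical in
theorem phiArrow_CR (σ : Gal(ℂ/ℝ)) : phiArrow .C .R σ false =
    (if σ = 1 then !![1, I; 0, 0] else !![1, -I; 0, 0] : Matrix (Fin 2) (Fin 2) ℂ) := rfl

open Classical in
theorem phiArrow_HC (σ : Gal(ℂ/ℝ)) : phiArrow .H .C σ false =
    (if σ = 1 then !![![1, 0], 0; 0, 0] else !![![0, 1], 0; 0, 0] : Matrix (Fin 2) (Fin 2) (Fin 2 → ℂ)) := rfl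

open Classical in
theorem phiArrow_CH (σ : Gal(ℂ/ℝ)) : phiArrow .C .H σ false =
    (if σ = 1 then !![![1, 0], 0; 0, 0] else !![![0, 1], 0; 0, 0] : Matrix (Fin 2) (Fin 2) (Fin 2 → ℂ)) := rfl

theorem phiArrow_CC (σ : Gal(ℂ/ℝ)) : phiArrow .C .C σ false =
    (!![1, 0; 0, 0] : Matrix (Fin 2) (Fin 2) ℂ) := rfl

theorem phiArrow_true_eq_zero {k l : DivKind} (σ : Gal(ℂ/ℝ)) (h : ¬ (k = l ∧ k ≠ .C)) :
    phiArrow k l σ true = 0 := by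
  cases k <;> cases l <;> first | rfl | simp at h

/-- Multiplicativity of φ on A_v. It encodes 𝐢² = -1, s𝐢 = -𝐢s and s² = κ for the matrices chosen at
each type. -/
theorem phiVert_mul (k : DivKind) (x y : ℂ × ℂ) (p q : Fin 2) :
    phiVert k x.1 x.2 p 0 * phiVert k y.1 y.2 0 q + phiVert k x.1 x.2 p 1 * phiVert k y.1 y.2 1 q =
      phiVert k (vertMul (loopSign k) x y).1 (vertMul (loopSign k) x y).2 p q := by
  apply divCoef_injective
  rw [divCoef_add, div_mul_eq, div_mul_eq]
  cases k <;> fin_cases p <;> fin_cases q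
  all_goals simp [phiVert_R, phiVert_C, phiVert_H, vertMul, loopSign, divMul, divCoef, Complex.ext_iff, Prod.ext_iff]
  all_goals try ring_nf
  all_goals simp

theorem phiVert_add (k : DivKind) (z w z' w' : ℂ) (p q : Fin 2) :
    phiVert k (z + z') (w + w') p q = phiVert k z w p q + phiVert k z' w' p q := by
  apply divCoef_injective
  rw [divCoef_add]
  cases k <;> fin_cases p <;> fin_cases q
  all_goals simp [phiVert_R, phiVert_C, phiVert_H, divCoef, Complex.ext_iff, Prod.ext_iff]
  all_goals try ring_nf

theorem phiVert_divCoef (k : DivKind) (d : DivRing k) :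
    phiVert k (divCoef k d).1 (divCoef k d).2 0 0 = d := by
  apply divCoef_injective
  cases k
  all_goals first
    | change ℝ at d
    | change ℂ at d
    | change ℍ[ℝ] at d
  all_goals simp [phiVert_R, phiVert_C, phiVert_H, divCoef]

/-- Up to ε, the scalars `unitLeft` and `unitRight` act as E₁ₚ and E_q₁, so every matrix entry
becomes an upper left entry. -/
theorem phiVert_eq_phiVert_zero (k : DivKind) (z w : ℂ) (p q : Fin 2) :
    phiVert k z w p q = phiVert k (unitLeft k p * z * unitRight k q)
      (unitLeft k p * w * star (unitRight k q)) 0 0 := by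
  apply divCoef_injective
  cases k <;> fin_cases p <;> fin_cases q
  all_goals simp [phiVert_R, phiVert_C, phiVert_H, unitLeft, unitRight, divCoef, Complex.ext_iff,
    Prod.ext_iff]
  all_goals ring

/-- The relation αc = σ(c)α for the matrices φ(α). Apart from compatibility with the units at both
ends, this is all that an ordinary arrow has to satisfy. -/
theorem phiArrow_mul_scalar (k l : DivKind) (σ : Gal(ℂ/ℝ)) (b : Bool) (c : ℂ) (p q : Fin 2) :
    op (phiVert l c 0 0 q) • phiArrow k l σ b p 0 + op (phiVert l c 0 1 q) • phiArrow k l σ b p 1 =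
      phiVert k (σ c) 0 p 0 • phiArrow k l σ b 0 q +
        phiVert k (σ c) 0 p 1 • phiArrow k l σ b 1 q := by
  by_cases hb : b = true ∧ ¬ (k = l ∧ k ≠ .C)
  · rw [hb.1, phiArrow_true_eq_zero σ hb.2]
    simp only [Matrix.zero_apply, smul_zero]
  apply bimodCoord_injective
  rw [bimodCoord_add, bimodCoord_add]
  simp only [bimod_smul_eq, bimod_op_smul_eq]
  rcases gal_cases σ with rfl | rfl <;> cases k <;> cases l <;> cases b
  all_goals try exact absurd (by decide) hb
  all_goals fin_cases p <;> fin_cases q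
  all_goals simp [phiArrow_RR_false, phiArrow_RR_true, phiArrow_RC, phiArrow_RH, phiArrow_CR, phiArrow_CC,
    phiArrow_CH, phiArrow_HR, phiArrow_HC, phiArrow_HH_false, phiArrow_HH_true, phiVert_R, phiVert_C, phiVert_H, leftAct,
    rightAct, conjAe_ne_one, Complex.ext_iff,
    Prod.ext_iff, bimodCoord, quatMatrix, Matrix.mulVec, Matrix.vecMul, dotProduct]

/-- At types ℂ and ℍ the unit of A_v is E₁₁, and then the point is that φ(α) has no second row. -/
theorem phiVert_one_smul_phiArrow (k l : DivKind) (σ : Gal(ℂ/ℝ)) (b : Bool) (p q : Fin 2) :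
    phiVert k 1 0 p 0 • phiArrow k l σ b 0 q + phiVert k 1 0 p 1 • phiArrow k l σ b 1 q =
      phiArrow k l σ b p q := by
  by_cases hb : b = true ∧ ¬ (k = l ∧ k ≠ .C)
  · rw [hb.1, phiArrow_true_eq_zero σ hb.2]
    simp only [Matrix.zero_apply, smul_zero, add_zero]
  apply bimodCoord_injective
  rw [bimodCoord_add]
  simp only [bimod_smul_eq]
  rcases gal_cases σ with rfl | rfl <;> cases k <;> cases l <;> cases b
  all_goals try exact absurd (by decide) hb
  all_goals fin_cases p <;> fin_cases q
  all_goals simp [phiArrow_RR_false, phiArrow_RR_true, phiArrow_RC, phiArrow_RH, phiArrow_CR,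
    phiArrow_CC, phiArrow_CH, phiArrow_HR, phiArrow_HC, phiArrow_HH_false, phiArrow_HH_true,
    phiVert_R, phiVert_C, phiVert_H, leftAct, conjAe_ne_one, Complex.ext_iff, Prod.ext_iff,
    bimodCoord, quatMatrix, Matrix.mulVec, dotProduct]

theorem phiVert_one_op_smul_phiArrow (k l : DivKind) (σ : Gal(ℂ/ℝ)) (b : Bool) (p q : Fin 2) :
    op (phiVert l 1 0 0 q) • phiArrow k l σ b p 0 + op (phiVert l 1 0 1 q) • phiArrow k l σ b p 1 =
      phiArrow k l σ b p q := by
  rw [phiArrow_mul_scalar, map_one, phiVert_one_smul_phiArrow]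

/-- Multiplying α by the scalars that stand for E₁ₚ and E_q₁ extracts the entry (p, q) of φ(α), and
the right scalar passes to the left through σ. The components at α and α^𝐢 have to be added, since
only their sum represents α. -/
theorem arrowCoef_phiArrow (k l : DivKind) (σ : Gal(ℂ/ℝ)) (p q : Fin 2) :
    arrowCoef k l σ false (phiArrow k l σ false p q) +
        arrowCoef k l σ true (phiArrow k l σ true p q) =
      (unitLeft k p * σ (unitRight l q), 0, 0, 0) := by
  rcases gal_cases σ with rfl | rfl <;> cases k <;> cases l <;> fin_cases p <;> fin_cases q
  all_goals simp [phiArrow_RR_false, phiArrow_RR_true, phiArrow_RC, phiArrow_RH, phiArrow_CR,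
    phiArrow_CC, phiArrow_CH, phiArrow_HR, phiArrow_HC, phiArrow_HH_false, phiArrow_HH_true,
    arrowCoef, conjAe_ne_one, Complex.ext_iff, Prod.ext_iff, unitLeft, unitRight]
  all_goals norm_num

/-- The component in the arrow `b` of the element with the given coordinates. -/
def coefEntry (k l : DivKind) (σ : Gal(ℂ/ℝ)) (b : Bool) (c : ℂ × ℂ × ℂ × ℂ) : SimpleBimod k l σ :=
  cornerEntry (phiVert k c.1 c.2.1) (phiArrow k l σ b) (phiVert l 1 0) +
    cornerEntry (phiVert k c.2.2.1 c.2.2.2) (phiArrow k l σ b) (phiVert l 0 1)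

theorem bimodCoord_coefEntry (k l : DivKind) (σ : Gal(ℂ/ℝ)) (b : Bool) (c : ℂ × ℂ × ℂ × ℂ) :
    bimodCoord k l σ (coefEntry k l σ b c) =
      ∑ p, ∑ q, bimodCoord k l σ (leftAct k l σ (phiVert k c.1 c.2.1 0 p)
        (rightAct k l σ (phiArrow k l σ b p q) (phiVert l 1 0 q 0))) +
      ∑ p, ∑ q, bimodCoord k l σ (leftAct k l σ (phiVert k c.2.2.1 c.2.2.2 0 p)
        (rightAct k l σ (phiArrow k l σ b p q) (phiVert l 0 1 q 0))) := by
  unfold coefEntry cornerEntry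
  simp only [Fin.sum_univ_two, bimodCoord_add]
  rfl

/-- With `coefEntry_arrowCoef_ne` this makes `arrowCoef` a section of φ followed by the upper left
entry. It is what shows that the prescribed values of Φ exhaust the bimodule of arrows. -/
theorem coefEntry_arrowCoef_self (k l : DivKind) (σ : Gal(ℂ/ℝ)) (b : Bool)
    (hb : b = true → k = l ∧ k ≠ .C) (m : SimpleBimod k l σ) :
    coefEntry k l σ b (arrowCoef k l σ b m) = m := by
  apply bimodCoord_injective
  rw [bimodCoord_coefEntry]
  rcases gal_cases σ with rfl | rfl <;> cases k <;> cases l <;> cases b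
  all_goals try exact absurd (hb rfl) (by decide)
  all_goals first
    | change ℝ at m
    | change ℂ at m
    | change ℍ[ℝ] at m
    | change Fin 2 → ℂ at m
  all_goals simp [phiArrow_RR_false, phiArrow_RR_true, phiArrow_RC, phiArrow_RH, phiArrow_CR,
    phiArrow_CC, phiArrow_CH, phiArrow_HR, phiArrow_HC, phiArrow_HH_false, phiArrow_HH_true,
    phiVert_R, phiVert_C, phiVert_H, leftAct, rightAct, conjAe_ne_one, Complex.ext_iff,
    Prod.ext_iff, bimodCoord, quatMatrix, Matrix.mulVec, Matrix.vecMul, dotProduct,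
    Fin.sum_univ_two, arrowCoef]
  all_goals try ring_nf
  all_goals try simp

theorem coefEntry_arrowCoef_ne (k l : DivKind) (σ : Gal(ℂ/ℝ)) (b : Bool)
    (hb : k = l ∧ k ≠ .C) (m : SimpleBimod k l σ) :
    coefEntry k l σ (!b) (arrowCoef k l σ b m) = 0 := by
  apply bimodCoord_injective
  rw [bimodCoord_coefEntry, bimod_zero_eq]
  rcases gal_cases σ with rfl | rfl <;> cases k <;> cases l <;> cases b
  all_goals try exact absurd hb (by decide)
  all_goals first
    | change ℝ at m
    | change ℍ[ℝ] at m
  all_goals simp [phiArrow_RR_false, phiArrow_RR_true, phiArrow_HH_false, phiArrow_HH_true,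
    phiVert_R, phiVert_H, leftAct, rightAct, conjAe_ne_one, Complex.ext_iff,
    Prod.ext_iff, bimodCoord, bimodZero, Fin.sum_univ_two, arrowCoef]
  all_goals try ring_nf
  all_goals try simp

/-! ### The universal property of the tensor algebra -/

namespace TensorRing

variable (A M : Type*) [Ring A] [Algebra ℝ A] [AddCommGroup M] [Module A M]
    [Module Aᵐᵒᵖ M] [SMulCommClass A Aᵐᵒᵖ M]

theorem mk_rel {x y : FreeAlgebra ℝ (A ⊕ M)} (h : Rel A M x y) :
    RingQuot.mkAlgHom ℝ (Rel A M) x = RingQuot.mkAlgHom ℝ (Rel A M) y :=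
  RingQuot.mkAlgHom_rel ℝ h

theorem ofRing_algebraMap (r : ℝ) :
    ofRing A M (algebraMap ℝ A r) = algebraMap ℝ (TensorRing A M) r :=
  (mk_rel A M (.algebraMap r)).trans (AlgHom.commutes _ r)

theorem ofRing_add (a b : A) : ofRing A M (a + b) = ofRing A M a + ofRing A M b :=
  (mk_rel A M (.ring_add a b)).trans (map_add _ _ _)

theorem ofRing_mul (a b : A) : ofRing A M (a * b) = ofRing A M a * ofRing A M b :=
  (mk_rel A M (.ring_mul a b)).trans (map_mul _ _ _)

theorem ofModule_add (m n : M) : ofModule A M (m + n) = ofModule A M m + ofModule A M n :=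
  (mk_rel A M (.module_add m n)).trans (map_add _ _ _)

theorem ofModule_smul (a : A) (m : M) : ofModule A M (a • m) = ofRing A M a * ofModule A M m :=
  (mk_rel A M (.left_smul a m)).trans (map_mul _ _ _)

theorem ofModule_op_smul (a : A) (m : M) :
    ofModule A M (op a • m) = ofModule A M m * ofRing A M a :=
  (mk_rel A M (.right_smul a m)).trans (map_mul _ _ _)

/-- The degree-zero part as an algebra homomorphism. -/
def ofRingHom : A →ₐ[ℝ] TensorRing A M where
  toFun := ofRing A M
  map_one' := by
    have h := ofRing_algebraMap A M 1
    rwa [map_one, map_one] at h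
  map_mul' := ofRing_mul A M
  map_zero' := by
    have h := ofRing_algebraMap A M 0
    rwa [map_zero, map_zero] at h
  map_add' := ofRing_add A M
  commutes' := ofRing_algebraMap A M

/-- The degree-one part as an additive homomorphism. -/
def ofModuleHom : M →+ TensorRing A M := AddMonoidHom.mk' (ofModule A M) (ofModule_add A M)

variable {A M}

/-- The algebra homomorphism from the tensor algebra given by compatible maps. -/
def lift {C : Type*} [Ring C] [Algebra ℝ C] (f : A →ₐ[ℝ] C) (g : M →+ C)
    (hl : ∀ a m, g (a • m) = f a * g m) (hr : ∀ a m, g (op a • m) = g m * f a) :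
    TensorRing A M →ₐ[ℝ] C :=
  RingQuot.liftAlgHom ℝ ⟨FreeAlgebra.lift ℝ (Sum.elim f g), by
    intro x y h
    induction h with
    | algebraMap r => simp
    | ring_add a b => simp
    | ring_mul a b => simp
    | module_add m n => simp
    | left_smul a m => simp [hl]
    | right_smul a m => simp [hr]⟩

section lift

variable {C : Type*} [Ring C] [Algebra ℝ C] (f : A →ₐ[ℝ] C) (g : M →+ C)
    (hl : ∀ a m, g (a • m) = f a * g m) (hr : ∀ a m, g (op a • m) = g m * f a)

theorem lift_ofRing (a : A) : lift f g hl hr (ofRing A M a) = f a := by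
  change RingQuot.liftAlgHom ℝ _ (RingQuot.mkAlgHom ℝ (Rel A M) _) = _
  rw [RingQuot.liftAlgHom_mkAlgHom_apply, FreeAlgebra.lift_ι_apply]
  rfl

theorem lift_ofModule (m : M) : lift f g hl hr (ofModule A M m) = g m := by
  change RingQuot.liftAlgHom ℝ _ (RingQuot.mkAlgHom ℝ (Rel A M) _) = _
  rw [RingQuot.liftAlgHom_mkAlgHom_apply, FreeAlgebra.lift_ι_apply]
  rfl

end lift

theorem eq_top_of_mem (S : Subalgebra ℝ (TensorRing A M)) (hA : ∀ a, ofRing A M a ∈ S)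
    (hM : ∀ m, ofModule A M m ∈ S) : S = ⊤ := by
  rw [eq_top_iff]
  rintro t -
  obtain ⟨x, rfl⟩ := RingQuot.mkAlgHom_surjective ℝ (Rel A M) t
  induction x using FreeAlgebra.induction with
  | grade0 r =>
    rw [AlgHom.commutes]
    exact S.algebraMap_mem r
  | grade1 i =>
    rcases i with a | m
    · exact hA a
    · exact hM m
  | mul a b ha hb =>
    rw [map_mul]
    exact S.mul_mem ha hb
  | add a b ha hb =>
    rw [map_add]
    exact S.add_mem ha hb

end TensorRing

namespace SemilinearQuiver

variable {V E : Type*} [Fintype V] [Fintype E] (Q : SemilinearQuiver V E)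

/-! ### The universal property of the semilinear path algebra -/

theorem pathAlg_induction {p : Q.PathAlg → Prop} (hs : ∀ c, p (Q.scalar c))
    (hv : ∀ v, p (Q.vert v)) (ha : ∀ a, p (Q.arrow a)) (hmul : ∀ x y, p x → p y → p (x * y))
    (hadd : ∀ x y, p x → p y → p (x + y)) (x : Q.PathAlg) : p x := by
  obtain ⟨x, rfl⟩ := RingQuot.mkAlgHom_surjective ℝ Q.Rel x
  induction x using FreeAlgebra.induction with
  | grade0 r =>
    rw [← Q.gen_rel (.scalar_real r)]
    exact hs r
  | grade1 i =>
    rcases i with c | v | a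
    · exact hs c
    · exact hv v
    · exact ha a
  | mul a b ha hb =>
    rw [map_mul]
    exact hmul _ _ ha hb
  | add a b ha hb =>
    rw [map_add]
    exact hadd _ _ ha hb

theorem scalar_ofReal (r : ℝ) : Q.scalar r = algebraMap ℝ Q.PathAlg r :=
  (Q.gen_rel (.scalar_real r)).trans (AlgHom.commutes _ r)

theorem scalar_add (c d : ℂ) : Q.scalar (c + d) = Q.scalar c + Q.scalar d :=
  (Q.gen_rel (.scalar_add c d)).trans (map_add _ _ _)

theorem scalar_mul (c d : ℂ) : Q.scalar (c * d) = Q.scalar c * Q.scalar d :=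
  (Q.gen_rel (.scalar_mul c d)).trans (map_mul _ _ _)

theorem vert_mul_scalar (v : V) (c : ℂ) : Q.vert v * Q.scalar c = Q.scalar c * Q.vert v := by
  have h := Q.gen_rel (.vert_scalar v c)
  rwa [map_mul, map_mul] at h

theorem arrow_mul_scalar (a : E) (c : ℂ) :
    Q.arrow a * Q.scalar c = Q.scalar (Q.twist a c) * Q.arrow a := by
  have h := Q.gen_rel (.arrow_scalar a c)
  rwa [map_mul, map_mul] at h

theorem sum_vert : ∑ v, Q.vert v = 1 := by
  have h := Q.gen_rel .vert_sum
  rwa [map_sum, map_one] at h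

/-! ### The matrix representation of the path algebra over the tensor algebra -/

/-- The matrix entries of a family of elements of the algebras `A_v`. -/
def vertFun (x : V → ℂ × ℂ) (p q : Fin 2) : Q.basicQuiver.VertexRing :=
  fun v => phiVert (Q.kind v) (x v).1 (x v).2 p q

open Classical in
/-- The matrix entries of an ordinary arrow. -/
def arrowFun (a : E) (p q : Fin 2) : Q.basicQuiver.ArrowBimod := fun b =>
  if b.1.1 = a then
    phiArrow (Q.kind (Q.tgt b.1.1)) (Q.kind (Q.src b.1.1)) (Q.twist b.1.1) b.1.2 p q
  else 0

theorem vertFun_mul (x y : V → ℂ × ℂ) (p q : Fin 2) :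
    Q.vertFun x p 0 * Q.vertFun y 0 q + Q.vertFun x p 1 * Q.vertFun y 1 q =
      Q.vertFun (fun v => vertMul (loopSign (Q.kind v)) (x v) (y v)) p q :=
  funext fun v => phiVert_mul (Q.kind v) (x v) (y v) p q

theorem vertFun_add (x y : V → ℂ × ℂ) (p q : Fin 2) :
    Q.vertFun (x + y) p q = Q.vertFun x p q + Q.vertFun y p q :=
  funext fun v => phiVert_add (Q.kind v) (x v).1 (x v).2 (y v).1 (y v).2 p q

theorem arrowFun_apply_eq {a : E} {b : Q.BasicArrow} (h : b.1.1 = a) (p q : Fin 2) :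
    Q.arrowFun a p q b = phiArrow (Q.kind (Q.tgt b.1.1)) (Q.kind (Q.src b.1.1))
      (Q.twist b.1.1) b.1.2 p q := if_pos h

theorem arrowFun_apply_ne {a : E} {b : Q.BasicArrow} (h : b.1.1 ≠ a) (p q : Fin 2) :
    Q.arrowFun a p q b = 0 := if_neg h

theorem vertFun_smul_arrowFun_one (a : E) (x : V → ℂ × ℂ) (hx : x (Q.tgt a) = (1, 0))
    (p q : Fin 2) :
    Q.vertFun x p 0 • Q.arrowFun a 0 q + Q.vertFun x p 1 • Q.arrowFun a 1 q =
      Q.arrowFun a p q := by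
  funext b
  change Q.vertFun x p 0 (Q.basicQuiver.tgt b) • Q.arrowFun a 0 q b +
    Q.vertFun x p 1 (Q.basicQuiver.tgt b) • Q.arrowFun a 1 q b = _
  by_cases h : b.1.1 = a
  · have e : ∀ r, Q.vertFun x p r (Q.basicQuiver.tgt b) =
        phiVert (Q.kind (Q.tgt b.1.1)) 1 0 p r := by
      intro r
      change phiVert (Q.kind (Q.tgt b.1.1)) (x (Q.tgt b.1.1)).1 (x (Q.tgt b.1.1)).2 p r = _
      rw [h, hx]
    simp only [arrowFun_apply_eq Q h, e]
    exact phiVert_one_smul_phiArrow _ _ _ _ _ _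
  · simp only [arrowFun_apply_ne Q h, smul_zero, add_zero]

theorem vertFun_op_smul_arrowFun_one (a : E) (x : V → ℂ × ℂ) (hx : x (Q.src a) = (1, 0))
    (p q : Fin 2) :
    op (Q.vertFun x 0 q) • Q.arrowFun a p 0 + op (Q.vertFun x 1 q) • Q.arrowFun a p 1 =
      Q.arrowFun a p q := by
  funext b
  change op (Q.vertFun x 0 q (Q.basicQuiver.src b)) • Q.arrowFun a p 0 b +
    op (Q.vertFun x 1 q (Q.basicQuiver.src b)) • Q.arrowFun a p 1 b = _
  by_cases h : b.1.1 = a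
  · have e : ∀ r, Q.vertFun x r q (Q.basicQuiver.src b) =
        phiVert (Q.kind (Q.src b.1.1)) 1 0 r q := by
      intro r
      change phiVert (Q.kind (Q.src b.1.1)) (x (Q.src b.1.1)).1 (x (Q.src b.1.1)).2 r q = _
      rw [h, hx]
    simp only [arrowFun_apply_eq Q h, e]
    exact phiVert_one_op_smul_phiArrow _ _ _ _ _ _
  · simp only [arrowFun_apply_ne Q h, smul_zero, add_zero]

theorem arrowFun_mul_scalar (a : E) (c : ℂ) (p q : Fin 2) :
    op (Q.vertFun (fun _ => (c, 0)) 0 q) • Q.arrowFun a p 0 +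
        op (Q.vertFun (fun _ => (c, 0)) 1 q) • Q.arrowFun a p 1 =
      Q.vertFun (fun _ => (Q.twist a c, 0)) p 0 • Q.arrowFun a 0 q +
        Q.vertFun (fun _ => (Q.twist a c, 0)) p 1 • Q.arrowFun a 1 q := by
  funext b
  change op (Q.vertFun (fun _ => (c, 0)) 0 q (Q.basicQuiver.src b)) • Q.arrowFun a p 0 b +
    op (Q.vertFun (fun _ => (c, 0)) 1 q (Q.basicQuiver.src b)) • Q.arrowFun a p 1 b =
    Q.vertFun (fun _ => (Q.twist a c, 0)) p 0 (Q.basicQuiver.tgt b) • Q.arrowFun a 0 q b +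
    Q.vertFun (fun _ => (Q.twist a c, 0)) p 1 (Q.basicQuiver.tgt b) • Q.arrowFun a 1 q b
  by_cases h : b.1.1 = a
  · simp only [arrowFun_apply_eq Q h]
    rw [← h]
    exact phiArrow_mul_scalar _ _ _ _ _ _ _
  · simp only [arrowFun_apply_ne Q h, smul_zero, add_zero]

/-- The matrix over the tensor algebra of a family of elements of the algebras `A_v`. -/
def vertMat (x : V → ℂ × ℂ) : Matrix (Fin 2) (Fin 2) Q.basicQuiver.TensorAlg :=
  Matrix.of fun p q => TensorRing.ofRing _ _ (Q.vertFun x p q)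

/-- The matrix over the tensor algebra of an ordinary arrow. -/
def ordMat (a : E) : Matrix (Fin 2) (Fin 2) Q.basicQuiver.TensorAlg :=
  Matrix.of fun p q => TensorRing.ofModule _ _ (Q.arrowFun a p q)

theorem vertMat_mul (x y : V → ℂ × ℂ) : Q.vertMat x * Q.vertMat y =
    Q.vertMat fun v => vertMul (loopSign (Q.kind v)) (x v) (y v) := by
  ext p q
  rw [Matrix.mul_apply, Fin.sum_univ_two]
  change TensorRing.ofRing _ _ _ * TensorRing.ofRing _ _ _ +
    TensorRing.ofRing _ _ _ * TensorRing.ofRing _ _ _ = TensorRing.ofRing _ _ _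
  rw [← TensorRing.ofRing_mul, ← TensorRing.ofRing_mul, ← TensorRing.ofRing_add, vertFun_mul]

theorem vertMat_add (x y : V → ℂ × ℂ) : Q.vertMat (x + y) = Q.vertMat x + Q.vertMat y := by
  ext p q
  change TensorRing.ofRing _ _ _ = TensorRing.ofRing _ _ _ + TensorRing.ofRing _ _ _
  rw [vertFun_add, TensorRing.ofRing_add]

/-- `vertMat` as an additive homomorphism. -/
def vertMatHom : (V → ℂ × ℂ) →+ Matrix (Fin 2) (Fin 2) Q.basicQuiver.TensorAlg :=
  AddMonoidHom.mk' Q.vertMat Q.vertMat_add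

theorem vertMat_mul_ordMat_apply (x : V → ℂ × ℂ) (a : E) (p q : Fin 2) :
    (Q.vertMat x * Q.ordMat a) p q = TensorRing.ofModule _ _
      (Q.vertFun x p 0 • Q.arrowFun a 0 q + Q.vertFun x p 1 • Q.arrowFun a 1 q) := by
  rw [Matrix.mul_apply, Fin.sum_univ_two, TensorRing.ofModule_add, TensorRing.ofModule_smul,
    TensorRing.ofModule_smul]
  rfl

theorem ordMat_mul_vertMat_apply (x : V → ℂ × ℂ) (a : E) (p q : Fin 2) :
    (Q.ordMat a * Q.vertMat x) p q = TensorRing.ofModule _ _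
      (op (Q.vertFun x 0 q) • Q.arrowFun a p 0 + op (Q.vertFun x 1 q) • Q.arrowFun a p 1) := by
  rw [Matrix.mul_apply, Fin.sum_univ_two, TensorRing.ofModule_add, TensorRing.ofModule_op_smul,
    TensorRing.ofModule_op_smul]
  rfl

theorem vertMat_mul_ordMat_one (a : E) (x : V → ℂ × ℂ) (hx : x (Q.tgt a) = (1, 0)) :
    Q.vertMat x * Q.ordMat a = Q.ordMat a := by
  ext p q
  rw [vertMat_mul_ordMat_apply, vertFun_smul_arrowFun_one _ _ _ hx]
  rfl

theorem ordMat_mul_vertMat_one (a : E) (x : V → ℂ × ℂ) (hx : x (Q.src a) = (1, 0)) :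
    Q.ordMat a * Q.vertMat x = Q.ordMat a := by
  ext p q
  rw [ordMat_mul_vertMat_apply, vertFun_op_smul_arrowFun_one _ _ _ hx]
  rfl

theorem ordMat_mul_scalar (a : E) (c : ℂ) :
    Q.ordMat a * Q.vertMat (fun _ => (c, 0)) =
      Q.vertMat (fun _ => (Q.twist a c, 0)) * Q.ordMat a := by
  ext p q
  rw [ordMat_mul_vertMat_apply, vertMat_mul_ordMat_apply, arrowFun_mul_scalar]

end SemilinearQuiver

theorem vertMul_one_left (κ : ℝ) (x : ℂ × ℂ) : vertMul κ (1, 0) x = x := by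
  simp [vertMul]

theorem vertMul_one_right (κ : ℝ) (x : ℂ × ℂ) : vertMul κ x (1, 0) = x := by
  simp [vertMul]

theorem vertMul_zero_left (κ : ℝ) (x : ℂ × ℂ) : vertMul κ 0 x = 0 := by
  simp [vertMul]

theorem vertMul_zero_right (κ : ℝ) (x : ℂ × ℂ) : vertMul κ x 0 = 0 := by
  simp [vertMul]

namespace SemilinearQuiver

variable {V E : Type*} [Fintype V] [Fintype E] (Q : SemilinearQuiver V E)

theorem kind_of_sqSubOne {s : E} (hs : Q.type s = .sqSubOne) : Q.kind (Q.src s) = .R :=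
  if_pos ⟨s, hs, rfl⟩

theorem kind_of_sqAddOne {s : E} (hs : Q.type s = .sqAddOne) : Q.kind (Q.src s) = .H := by
  unfold kind
  rw [if_neg, if_pos ⟨s, hs, rfl⟩]
  rintro ⟨s', hs', h⟩
  have := Q.special_unique s' s (by simp [hs']) (by simp [hs]) h
  rw [this, hs] at hs'
  exact absurd hs' (by decide)

theorem exists_of_kind_H {v : V} (h : Q.kind v = .H) :
    ∃ s, Q.type s = .sqAddOne ∧ Q.src s = v := by
  by_contra hn
  unfold kind at h
  rw [if_neg hn] at h
  split_ifs at h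

theorem loopAt_of_kind_C {v : V} (h : Q.kind v = .C) : Q.loopAt v = 0 := by
  unfold loopAt
  refine Finset.sum_eq_zero fun s _ => if_neg ?_
  rintro ⟨hs, rfl⟩
  cases ht : Q.type s with
  | ordinary => exact hs ht
  | sqSubOne =>
    rw [Q.kind_of_sqSubOne ht] at h
    exact absurd h (by decide)
  | sqAddOne =>
    rw [Q.kind_of_sqAddOne ht] at h
    exact absurd h (by decide)

/-- The unit of the corner of the matrix ring that contains the image of the path algebra. -/
def unitMat : Matrix (Fin 2) (Fin 2) Q.basicQuiver.TensorAlg := Q.vertMat fun _ => (1, 0)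

theorem unitMat_mul_vertMat (x : V → ℂ × ℂ) : Q.unitMat * Q.vertMat x = Q.vertMat x := by
  unfold unitMat
  simp only [vertMat_mul, vertMul_one_left]

theorem vertMat_mul_unitMat (x : V → ℂ × ℂ) : Q.vertMat x * Q.unitMat = Q.vertMat x := by
  unfold unitMat
  simp only [vertMat_mul, vertMul_one_right]

theorem isIdempotentElem_unitMat : IsIdempotentElem Q.unitMat := Q.unitMat_mul_vertMat _

open Classical in
/-- The family with one nonzero element. -/
def vertSingle (v : V) (x : ℂ × ℂ) : V → ℂ × ℂ := Pi.single v x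

theorem vertSingle_same (v : V) (x : ℂ × ℂ) : vertSingle v x v = x := by
  simp [vertSingle]

theorem vertSingle_ne {v w : V} (h : w ≠ v) (x : ℂ × ℂ) : vertSingle v x w = 0 := by
  simp [vertSingle, h]

theorem vertMat_mul_single (x : V → ℂ × ℂ) (v : V) (y : ℂ × ℂ) :
    Q.vertMat x * Q.vertMat (vertSingle v y) =
      Q.vertMat (vertSingle v (vertMul (loopSign (Q.kind v)) (x v) y)) := by
  rw [vertMat_mul]
  congr 1
  funext w
  by_cases h : w = v
  · subst h
    rw [vertSingle_same, vertSingle_same]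
  · rw [vertSingle_ne h, vertSingle_ne h, vertMul_zero_right]

theorem vertMat_single_mul (x : V → ℂ × ℂ) (v : V) (y : ℂ × ℂ) :
    Q.vertMat (vertSingle v y) * Q.vertMat x =
      Q.vertMat (vertSingle v (vertMul (loopSign (Q.kind v)) y (x v))) := by
  rw [vertMat_mul]
  congr 1
  funext w
  by_cases h : w = v
  · subst h
    rw [vertSingle_same, vertSingle_same]
  · rw [vertSingle_ne h, vertSingle_ne h, vertMul_zero_left]

/-- The matrix of an arrow. -/
def arrowMat (a : E) : Matrix (Fin 2) (Fin 2) Q.basicQuiver.TensorAlg :=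
  if Q.type a = .ordinary then Q.ordMat a else Q.vertMat (vertSingle (Q.src a) (0, 1))

/-- The matrix of a generator of the path algebra. -/
def genMat : PathGen V E → Matrix (Fin 2) (Fin 2) Q.basicQuiver.TensorAlg
  | .scalar c => Q.vertMat fun _ => (c, 0)
  | .vert v => Q.vertMat (vertSingle v (1, 0))
  | .arrow a => Q.arrowMat a

theorem vertMat_mul_arrowMat_one (a : E) (x : V → ℂ × ℂ) (hx : x (Q.tgt a) = (1, 0)) :
    Q.vertMat x * Q.arrowMat a = Q.arrowMat a := by
  unfold arrowMat
  split_ifs with h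
  · exact Q.vertMat_mul_ordMat_one a x hx
  · rw [vertMat_mul_single, Q.special_loop a h, hx, vertMul_one_left]

theorem arrowMat_mul_vertMat_one (a : E) (x : V → ℂ × ℂ) (hx : x (Q.src a) = (1, 0)) :
    Q.arrowMat a * Q.vertMat x = Q.arrowMat a := by
  unfold arrowMat
  split_ifs with h
  · exact Q.ordMat_mul_vertMat_one a x hx
  · rw [vertMat_single_mul, hx, vertMul_one_right]

theorem arrowMat_mul_scalar (a : E) (c : ℂ) :
    Q.arrowMat a * Q.vertMat (fun _ => (c, 0)) =
      Q.vertMat (fun _ => (Q.twist a c, 0)) * Q.arrowMat a := by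
  unfold arrowMat
  split_ifs with h
  · exact Q.ordMat_mul_scalar a c
  · rw [vertMat_single_mul, vertMat_mul_single, Q.special_twist a h]
    simp [vertMul]

/-- At types ℂ and ℍ only the upper left entry of `unitMat` is nonzero, so the representation is
unital in the corner at `unitMat` rather than, in general, in M₂(T). -/
theorem genMat_mem_corner (g : PathGen V E) : Q.genMat g ∈ Subsemigroup.corner Q.unitMat := by
  rw [Subsemigroup.mem_corner_iff Q.isIdempotentElem_unitMat]
  cases g with
  | scalar c => exact ⟨Q.unitMat_mul_vertMat _, Q.vertMat_mul_unitMat _⟩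
  | vert v => exact ⟨Q.unitMat_mul_vertMat _, Q.vertMat_mul_unitMat _⟩
  | arrow a =>
    exact ⟨Q.vertMat_mul_arrowMat_one a _ rfl, Q.arrowMat_mul_vertMat_one a _ rfl⟩

/-- The generators in the corner of the matrix ring. -/
def genCorner (g : PathGen V E) : Q.isIdempotentElem_unitMat.Corner :=
  ⟨Q.genMat g, Q.genMat_mem_corner g⟩

theorem smul_unitMat (r : ℝ) : r • Q.unitMat = Q.vertMat fun _ => ((r : ℂ), 0) := by
  ext p q
  change r • TensorRing.ofRing _ _ _ = TensorRing.ofRing _ _ _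
  rw [Algebra.smul_def, ← TensorRing.ofRing_algebraMap, ← TensorRing.ofRing_mul]
  congr 1
  funext v
  change algebraMap ℝ (DivRing (Q.kind v)) r * phiVert (Q.kind v) 1 0 p q =
    phiVert (Q.kind v) r 0 p q
  rw [← Algebra.smul_def]
  apply divCoef_injective
  rw [Algebra.smul_def, divCoef_mul, divCoef_algebraMap]
  generalize Q.kind v = k
  cases k <;> fin_cases p <;> fin_cases q
  all_goals simp [phiVert_R, phiVert_C, phiVert_H, vertMul, divCoef, Complex.ext_iff,
    Prod.ext_iff]

theorem genCorner_rel {x y : FreeAlgebra ℝ (PathGen V E)} (h : Q.Rel x y) :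
    FreeAlgebra.lift ℝ Q.genCorner x = FreeAlgebra.lift ℝ Q.genCorner y := by
  induction h with
  | scalar_real r =>
    rw [FreeAlgebra.lift_ι_apply, AlgHom.commutes]
    exact Subtype.ext (Q.smul_unitMat r).symm
  | scalar_add c d =>
    rw [map_add, FreeAlgebra.lift_ι_apply, FreeAlgebra.lift_ι_apply, FreeAlgebra.lift_ι_apply]
    refine Subtype.ext ?_
    change Q.vertMat _ = Q.vertMat _ + Q.vertMat _
    rw [← vertMat_add]
    congr 1
    funext v
    simp
  | scalar_mul c d =>
    rw [map_mul, FreeAlgebra.lift_ι_apply, FreeAlgebra.lift_ι_apply, FreeAlgebra.lift_ι_apply]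
    refine Subtype.ext ?_
    change Q.vertMat _ = Q.vertMat _ * Q.vertMat _
    rw [vertMat_mul]
    congr 1
    funext v
    simp [vertMul]
  | vert_idem v =>
    rw [map_mul, FreeAlgebra.lift_ι_apply]
    refine Subtype.ext ?_
    change Q.vertMat _ * Q.vertMat _ = Q.vertMat _
    rw [vertMat_mul_single, vertSingle_same, vertMul_one_left]
  | vert_orth v w h =>
    rw [map_mul, map_zero, FreeAlgebra.lift_ι_apply, FreeAlgebra.lift_ι_apply]
    refine Subtype.ext ?_
    change Q.vertMat _ * Q.vertMat _ = 0
    rw [vertMat_mul_single, vertSingle_ne h.symm, vertMul_zero_left]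
    have h0 : vertSingle w 0 = (0 : V → ℂ × ℂ) := by
      classical
      exact Pi.single_zero w
    rw [h0]
    exact map_zero Q.vertMatHom
  | vert_sum =>
    rw [map_sum, map_one]
    refine Subtype.ext ?_
    rw [corner_val_sum]
    simp only [FreeAlgebra.lift_ι_apply]
    change ∑ v, Q.vertMatHom (vertSingle v (1, 0)) = Q.vertMat _
    rw [← map_sum]
    change Q.vertMat _ = Q.vertMat _
    congr 1
    classical
    exact Finset.univ_sum_single (fun _ : V => ((1, 0) : ℂ × ℂ))
  | tgt_mul a =>
    rw [map_mul, FreeAlgebra.lift_ι_apply, FreeAlgebra.lift_ι_apply]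
    exact Subtype.ext (Q.vertMat_mul_arrowMat_one a _ (vertSingle_same _ _))
  | mul_src a =>
    rw [map_mul, FreeAlgebra.lift_ι_apply, FreeAlgebra.lift_ι_apply]
    exact Subtype.ext (Q.arrowMat_mul_vertMat_one a _ (vertSingle_same _ _))
  | vert_scalar v c =>
    rw [map_mul, map_mul, FreeAlgebra.lift_ι_apply, FreeAlgebra.lift_ι_apply]
    refine Subtype.ext ?_
    change Q.vertMat _ * Q.vertMat _ = Q.vertMat _ * Q.vertMat _
    rw [vertMat_mul_single, vertMat_single_mul, vertMul_one_left, vertMul_one_right]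
  | arrow_scalar a c =>
    rw [map_mul, map_mul, FreeAlgebra.lift_ι_apply, FreeAlgebra.lift_ι_apply,
      FreeAlgebra.lift_ι_apply]
    exact Subtype.ext (Q.arrowMat_mul_scalar a c)

/-- The matrix representation of the path algebra. -/
def pathHom : Q.PathAlg →ₐ[ℝ] Q.isIdempotentElem_unitMat.Corner :=
  RingQuot.liftAlgHom ℝ ⟨FreeAlgebra.lift ℝ Q.genCorner, fun _ _ h => Q.genCorner_rel h⟩

theorem pathHom_gen (g : PathGen V E) : Q.pathHom (Q.gen g) = Q.genCorner g := by
  change RingQuot.liftAlgHom ℝ _ (RingQuot.mkAlgHom ℝ Q.Rel _) = _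
  rw [RingQuot.liftAlgHom_mkAlgHom_apply, FreeAlgebra.lift_ι_apply]

/-- A special loop acts through φ(s), whose square is κ times the unit of A_v, with κ = 1 for x² - 1
and κ = -1 for x² + 1. -/
theorem pathHom_eq_zero {x : Q.PathAlg} (hx : x ∈ Q.idealS) : Q.pathHom x = 0 := by
  rw [← TwoSidedIdeal.mem_ker]
  revert x
  change Q.idealS ≤ TwoSidedIdeal.ker Q.pathHom
  refine TwoSidedIdeal.span_le.mpr ?_
  have key : ∀ s, Q.type s ≠ .ordinary →
      (Q.pathHom (Q.arrow s * Q.arrow s)).1 =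
        Q.vertMat (vertSingle (Q.src s) (loopSign (Q.kind (Q.src s)), 0)) := by
    intro s hs
    rw [map_mul, arrow, pathHom_gen]
    change Q.arrowMat s * Q.arrowMat s = _
    unfold arrowMat
    rw [if_neg hs, vertMat_mul_single, vertSingle_same]
    simp [vertMul]
  rintro x (⟨s, hs, rfl⟩ | ⟨s, hs, rfl⟩)
  · change _ ∈ TwoSidedIdeal.ker Q.pathHom
    rw [TwoSidedIdeal.mem_ker, map_sub, sub_eq_zero]
    refine Subtype.ext ?_
    rw [key s (by simp [hs]), Q.kind_of_sqSubOne hs, vert, pathHom_gen]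
    change Q.vertMat (vertSingle _ (((1 : ℝ) : ℂ), 0)) = Q.vertMat (vertSingle _ (1, 0))
    rw [Complex.ofReal_one]
  · change _ ∈ TwoSidedIdeal.ker Q.pathHom
    rw [TwoSidedIdeal.mem_ker, map_add]
    refine Subtype.ext ?_
    rw [corner_val_add, key s (by simp [hs]), Q.kind_of_sqAddOne hs, vert, pathHom_gen]
    change Q.vertMat (vertSingle _ (((-1 : ℝ) : ℂ), 0)) + Q.vertMat (vertSingle _ (1, 0)) = 0
    rw [← vertMat_add]
    refine Eq.trans (congrArg Q.vertMat ?_) (map_zero Q.vertMatHom)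
    funext w
    by_cases h : w = Q.src s
    · subst h
      rw [Pi.add_apply, vertSingle_same, vertSingle_same]
      simp
    · rw [Pi.add_apply, vertSingle_ne h, vertSingle_ne h, add_zero]
      rfl

/-- The matrix representation of `ℂ_σ Q / ⟨S⟩`. -/
def matHom : IdealQuotient Q.idealS →ₐ[ℝ] Q.isIdempotentElem_unitMat.Corner :=
  IdealQuotient.lift Q.idealS Q.pathHom fun _ hx => Q.pathHom_eq_zero hx

theorem matHom_mk (x : Q.PathAlg) :
    Q.matHom (IdealQuotient.mk Q.idealS x) = Q.pathHom x := rfl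

end SemilinearQuiver

/-- The coordinates of `ε_v`. -/
def epsCoef : DivKind → ℂ × ℂ
  | .R => (1 / 2, 1 / 2)
  | .C => (1, 0)
  | .H => (1, 0)

/-- At type ℝ the chosen elements are real scalars, hence central; elsewhere ε_v is the unit. This
commutation makes x ↦ εxε multiplicative on the copy of the division ring. -/
theorem vertMul_divCoef_epsCoef (k : DivKind) (d : DivRing k) :
    vertMul (loopSign k) (divCoef k d) (epsCoef k) =
      vertMul (loopSign k) (epsCoef k) (divCoef k d) := by
  cases k
  · change ℝ at d
    change vertMul (1 : ℝ) ((d : ℂ), 0) (1 / 2, 1 / 2) =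
      vertMul (1 : ℝ) (1 / 2, 1 / 2) ((d : ℂ), 0)
    simp [vertMul, mul_comm]
  · rw [epsCoef, vertMul_one_left, vertMul_one_right]
  · rw [epsCoef, vertMul_one_left, vertMul_one_right]

/-- At type ℝ the sum is E₁₁E₁₁ + E₂₁E₁₂ = 1; at the other types ε_v = e_v and the second summand is
zero. This is the local form of the fullness of ε. -/
theorem sum_vertMul_unit (k : DivKind) :
    ∑ q, vertMul (loopSign k) (vertMul (loopSign k) (unitRight k q, 0) (epsCoef k))
      (vertMul (loopSign k) (epsCoef k) (unitLeft k q, 0)) = (1, 0) := by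
  rw [Fin.sum_univ_two]
  cases k <;> simp [vertMul, loopSign, epsCoef, unitLeft, unitRight, Prod.ext_iff,
    Complex.ext_iff]
  all_goals norm_num

/-! ### Arithmetic of ℂ_σ Q / ⟨S⟩ in coordinates -/

namespace SemilinearQuiver

variable {V E : Type*} [Fintype V] [Fintype E] (Q : SemilinearQuiver V E)

/-- The projection `ℂ_σ Q → ℂ_σ Q / ⟨S⟩`. -/
abbrev mkS : Q.PathAlg →+* IdealQuotient Q.idealS := IdealQuotient.mk Q.idealS

theorem vert_mul_loopAt (v : V) : Q.vert v * Q.loopAt v = Q.loopAt v := by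
  unfold loopAt
  rw [Finset.mul_sum]
  refine Finset.sum_congr rfl fun s _ => ?_
  split_ifs with h
  · rw [← h.2, Q.special_loop s h.1, vert_tgt_mul]
  · exact mul_zero _

theorem loopAt_mul_vert (v : V) : Q.loopAt v * Q.vert v = Q.loopAt v := by
  unfold loopAt
  rw [Finset.sum_mul]
  refine Finset.sum_congr rfl fun s _ => ?_
  split_ifs with h
  · rw [← h.2, arrow_mul_vert_src]
  · exact zero_mul _

theorem loopAt_mul_scalar (v : V) (c : ℂ) :
    Q.loopAt v * Q.scalar c = Q.scalar (star c) * Q.loopAt v := by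
  unfold loopAt
  rw [Finset.sum_mul, Finset.mul_sum]
  refine Finset.sum_congr rfl fun s _ => ?_
  split_ifs with h
  · rw [arrow_mul_scalar, Q.special_twist s h.1]
    rfl
  · rw [zero_mul, mul_zero]

/-- The conventions s = 0 and κ = 0 at type ℂ make the formula s² = κe uniform in the type. -/
theorem mkS_loopAt_mul_self (v : V) :
    Q.mkS (Q.loopAt v * Q.loopAt v) = Q.mkS (Q.scalar (loopSign (Q.kind v)) * Q.vert v) := by
  rw [← sub_eq_zero, ← map_sub, IdealQuotient.mk_eq_zero_iff]
  cases h : Q.kind v with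
  | R =>
    obtain ⟨s, hs, rfl⟩ := Q.exists_of_kind_R h
    rw [Q.loopAt_eq (by simp [hs]), scalar_ofReal, loopSign, map_one, one_mul]
    exact TwoSidedIdeal.subset_span (Or.inl ⟨s, hs, rfl⟩)
  | C =>
    rw [Q.loopAt_of_kind_C h, scalar_ofReal, loopSign, map_zero, zero_mul, zero_mul, sub_zero]
    exact Q.idealS.zero_mem
  | H =>
    obtain ⟨s, hs, rfl⟩ := Q.exists_of_kind_H h
    rw [Q.loopAt_eq (by simp [hs]), scalar_ofReal, loopSign, map_neg, map_one, neg_mul, one_mul,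
      sub_neg_eq_add]
    exact TwoSidedIdeal.subset_span (Or.inr ⟨s, hs, rfl⟩)

/-- The class of an element of `A_v`. -/
def el (v : V) (x : ℂ × ℂ) : IdealQuotient Q.idealS := Q.mkS (Q.vertElem v x.1 x.2)

theorem el_add (v : V) (x y : ℂ × ℂ) : Q.el v (x + y) = Q.el v x + Q.el v y := by
  unfold el vertElem
  rw [← map_add, Prod.fst_add, Prod.snd_add, scalar_add, scalar_add, add_mul, add_mul,
    add_add_add_comm]

/-- `el` as an additive homomorphism. -/
def elHom (v : V) : ℂ × ℂ →+ IdealQuotient Q.idealS := AddMonoidHom.mk' (Q.el v) (Q.el_add v)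

theorem el_zero (v : V) : Q.el v 0 = 0 := map_zero (Q.elHom v)

theorem scalar_zero : Q.scalar 0 = 0 := by
  have h := Q.scalar_ofReal 0
  rwa [map_zero, Complex.ofReal_zero] at h

theorem scalar_one : Q.scalar 1 = 1 := by
  have h := Q.scalar_ofReal 1
  rwa [map_one, Complex.ofReal_one] at h

theorem el_fst (v : V) (c : ℂ) : Q.el v (c, 0) = Q.mkS (Q.scalar c * Q.vert v) := by
  unfold el vertElem
  rw [scalar_zero, zero_mul, add_zero]

theorem el_one (v : V) : Q.el v (1, 0) = Q.mkS (Q.vert v) := by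
  rw [el_fst, scalar_one, one_mul]

theorem el_snd (v : V) (c : ℂ) : Q.el v (0, c) = Q.mkS (Q.scalar c * Q.loopAt v) := by
  unfold el vertElem
  rw [scalar_zero, zero_mul, zero_add]

theorem el_of_kind_C {v : V} (h : Q.kind v = .C) (x y : ℂ) : Q.el v (x, y) = Q.el v (x, 0) := by
  unfold el vertElem
  rw [Q.loopAt_of_kind_C h, mul_zero, mul_zero]

theorem el_mul (v : V) (x y : ℂ × ℂ) :
    Q.el v x * Q.el v y = Q.el v (vertMul (loopSign (Q.kind v)) x y) := by
  have h1 : ∀ c d, Q.el v (c, 0) * Q.el v (d, 0) = Q.el v (c * d, 0) := by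
    intro c d
    simp only [el_fst, ← map_mul]
    rw [mul_assoc, ← mul_assoc (Q.vert v), vert_mul_scalar, mul_assoc, vert_mul_vert_self,
      ← mul_assoc, ← scalar_mul]
  have h2 : ∀ c d, Q.el v (c, 0) * Q.el v (0, d) = Q.el v (0, c * d) := by
    intro c d
    simp only [el_fst, el_snd, ← map_mul]
    rw [mul_assoc, ← mul_assoc (Q.vert v), vert_mul_scalar, mul_assoc, vert_mul_loopAt,
      ← mul_assoc, ← scalar_mul]
  have h3 : ∀ c d, Q.el v (0, c) * Q.el v (d, 0) = Q.el v (0, c * star d) := by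
    intro c d
    simp only [el_fst, el_snd, ← map_mul]
    rw [mul_assoc, ← mul_assoc (Q.loopAt v), loopAt_mul_scalar, mul_assoc, loopAt_mul_vert,
      ← mul_assoc, ← scalar_mul]
  have h4 : ∀ c d, Q.el v (0, c) * Q.el v (0, d) =
      Q.el v (loopSign (Q.kind v) * c * star d, 0) := by
    intro c d
    simp only [el_fst, el_snd, ← map_mul]
    rw [mul_assoc, ← mul_assoc (Q.loopAt v), loopAt_mul_scalar, mul_assoc, ← mul_assoc,
      ← scalar_mul, map_mul, mkS_loopAt_mul_self, ← map_mul, ← mul_assoc, ← scalar_mul]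
    congr 3
    ring
  have hx : ∀ z : ℂ × ℂ, Q.el v z = Q.el v (z.1, 0) + Q.el v (0, z.2) := by
    intro z
    rw [← el_add, Prod.mk_add_mk, add_zero, zero_add]
  rw [hx x, hx y, mul_add, add_mul, add_mul, h1, h2, h3, h4, ← el_add, ← el_add, ← el_add]
  congr 1
  simp [vertMul, add_comm]

theorem el_mul_ne {v w : V} (h : v ≠ w) (x y : ℂ × ℂ) : Q.el v x * Q.el w y = 0 := by
  rw [← vertMul_one_right (loopSign (Q.kind v)) x, ← el_mul,
    ← vertMul_one_left (loopSign (Q.kind w)) y, ← el_mul, el_one, el_one, mul_assoc,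
    ← mul_assoc (Q.mkS (Q.vert v)), ← map_mul, Q.vert_mul_vert_ne h, map_zero, zero_mul, mul_zero]

/-- The sum of the classes of elements of the algebras `A_v`. -/
def vertSum (x : V → ℂ × ℂ) : IdealQuotient Q.idealS := ∑ v, Q.el v (x v)

theorem vertSum_mul_el (x : V → ℂ × ℂ) (v : V) (y : ℂ × ℂ) :
    Q.vertSum x * Q.el v y = Q.el v (x v) * Q.el v y := by
  unfold vertSum
  rw [Finset.sum_mul, Finset.sum_eq_single v]
  · intro w _ hw
    exact Q.el_mul_ne hw _ _
  · intro h
    exact absurd (Finset.mem_univ v) h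

theorem el_mul_vertSum (x : V → ℂ × ℂ) (v : V) (y : ℂ × ℂ) :
    Q.el v y * Q.vertSum x = Q.el v y * Q.el v (x v) := by
  unfold vertSum
  rw [Finset.mul_sum, Finset.sum_eq_single v]
  · intro w _ hw
    exact Q.el_mul_ne hw.symm _ _
  · intro h
    exact absurd (Finset.mem_univ v) h

theorem vertSum_mul (x y : V → ℂ × ℂ) : Q.vertSum x * Q.vertSum y =
    Q.vertSum fun v => vertMul (loopSign (Q.kind v)) (x v) (y v) := by
  conv_lhs => rw [vertSum]
  rw [Finset.sum_mul]
  refine Finset.sum_congr rfl fun v _ => ?_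
  rw [el_mul_vertSum, el_mul]

theorem vertSum_add (x y : V → ℂ × ℂ) : Q.vertSum (x + y) = Q.vertSum x + Q.vertSum y := by
  unfold vertSum
  rw [← Finset.sum_add_distrib]
  exact Finset.sum_congr rfl fun v _ => Q.el_add v _ _

theorem vertSum_scalar (c : ℂ) : Q.vertSum (fun _ => (c, 0)) = Q.mkS (Q.scalar c) := by
  unfold vertSum
  simp only [el_fst]
  rw [← map_sum, ← Finset.mul_sum, sum_vert, mul_one]

theorem vertSum_one : Q.vertSum (fun _ => (1, 0)) = 1 := by
  rw [vertSum_scalar, scalar_one, map_one]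

theorem vertSum_single (v : V) (x : ℂ × ℂ) : Q.vertSum (vertSingle v x) = Q.el v x := by
  unfold vertSum
  rw [Finset.sum_eq_single v]
  · rw [vertSingle_same]
  · intro w _ hw
    rw [vertSingle_ne hw, el_zero]
  · intro h
    exact absurd (Finset.mem_univ v) h

theorem mkS_epsAt (v : V) : Q.mkS (Q.epsAt v) = Q.el v (epsCoef (Q.kind v)) := by
  unfold epsAt
  split_ifs with h
  · rw [h, el, vertElem]
    change _ = Q.mkS (Q.scalar (1 / 2) * Q.vert v + Q.scalar (1 / 2) * Q.loopAt v)
    rw [← mul_add, Algebra.smul_def, ← scalar_ofReal]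
    norm_num
  · have h1 : epsCoef (Q.kind v) = (1, 0) := by
      cases hk : Q.kind v with
      | R => exact absurd hk h
      | C => rfl
      | H => rfl
    rw [h1, el_one]

theorem mkS_eps : Q.mkS Q.eps = Q.vertSum fun v => epsCoef (Q.kind v) := by
  unfold eps vertSum
  rw [map_sum]
  exact Finset.sum_congr rfl fun v _ => Q.mkS_epsAt v

/-- The class of the element of `A_t α A_s` with the given coordinates. -/
def arrowEl (a : E) (c : ℂ × ℂ × ℂ × ℂ) : IdealQuotient Q.idealS :=
  Q.el (Q.tgt a) (c.1, c.2.1) * Q.mkS (Q.arrow a) * Q.el (Q.src a) (1, 0) +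
    Q.el (Q.tgt a) (c.2.2.1, c.2.2.2) * Q.mkS (Q.arrow a) * Q.el (Q.src a) (0, 1)

theorem arrowEl_add (a : E) (c d : ℂ × ℂ × ℂ × ℂ) :
    Q.arrowEl a (c + d) = Q.arrowEl a c + Q.arrowEl a d := by
  have h1 : ((c + d).1, (c + d).2.1) = (c.1, c.2.1) + (d.1, d.2.1) := rfl
  have h2 : ((c + d).2.2.1, (c + d).2.2.2) = (c.2.2.1, c.2.2.2) + (d.2.2.1, d.2.2.2) := rfl
  unfold arrowEl
  rw [h1, h2, el_add, el_add]
  noncomm_ring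

/-- `arrowEl` as an additive homomorphism. -/
def arrowElHom (a : E) : ℂ × ℂ × ℂ × ℂ →+ IdealQuotient Q.idealS :=
  AddMonoidHom.mk' (Q.arrowEl a) (Q.arrowEl_add a)

theorem el_tgt_mul_arrow (a : E) : Q.el (Q.tgt a) (1, 0) * Q.mkS (Q.arrow a) =
    Q.mkS (Q.arrow a) := by
  rw [el_one, ← map_mul, vert_tgt_mul]

theorem arrow_mul_el_src (a : E) : Q.mkS (Q.arrow a) * Q.el (Q.src a) (1, 0) =
    Q.mkS (Q.arrow a) := by
  rw [el_one, ← map_mul, arrow_mul_vert_src]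

theorem arrow_mul_el (a : E) (c : ℂ) : Q.mkS (Q.arrow a) * Q.el (Q.src a) (c, 0) =
    Q.el (Q.tgt a) (Q.twist a c, 0) * Q.mkS (Q.arrow a) := by
  rw [el_fst, el_fst, ← map_mul, ← map_mul, ← mul_assoc, arrow_mul_scalar, mul_assoc, mul_assoc,
    arrow_mul_vert_src, vert_tgt_mul]

theorem el_mul_arrowEl (a : E) (x : ℂ × ℂ) (c : ℂ × ℂ × ℂ × ℂ) :
    Q.el (Q.tgt a) x * Q.arrowEl a c =
      Q.arrowEl a (coefLeft (loopSign (Q.kind (Q.tgt a))) x c) := by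
  unfold arrowEl
  simp only [mul_add, ← mul_assoc, el_mul]
  rfl

theorem twist_star (σ : Gal(ℂ/ℝ)) (z : ℂ) : star (σ z) = σ (star z) := by
  rcases gal_cases σ with rfl | rfl <;> simp

theorem twist_ofReal (σ : Gal(ℂ/ℝ)) (r : ℝ) : σ (r : ℂ) = r := σ.commutes r

/-- Scalars to the right of α pass through it by the twist and past s by conjugation, so that only e
or s remains on the right. -/
theorem el_arrow_el (a : E) (x y : ℂ × ℂ) :
    Q.el (Q.tgt a) x * Q.mkS (Q.arrow a) * Q.el (Q.src a) y =
      Q.arrowEl a (x.1 * Q.twist a y.1, x.2 * Q.twist a (star y.1),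
        x.1 * Q.twist a y.2, x.2 * Q.twist a (star y.2)) := by
  have hy : Q.el (Q.src a) y = Q.el (Q.src a) (y.1, 0) * Q.el (Q.src a) (1, 0) +
      Q.el (Q.src a) (y.2, 0) * Q.el (Q.src a) (0, 1) := by
    rw [el_mul, el_mul, ← el_add]
    simp [vertMul]
  have h : ∀ c, Q.el (Q.tgt a) x * Q.mkS (Q.arrow a) * Q.el (Q.src a) (c, 0) =
      Q.el (Q.tgt a) (x.1 * Q.twist a c, x.2 * Q.twist a (star c)) * Q.mkS (Q.arrow a) := by
    intro c
    rw [mul_assoc, arrow_mul_el, ← mul_assoc, el_mul, ← twist_star]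
    simp [vertMul]
  rw [hy, mul_add, ← mul_assoc, ← mul_assoc, h, h]
  rfl

theorem arrowEl_mul_el (a : E) (x : ℂ × ℂ) (c : ℂ × ℂ × ℂ × ℂ) :
    Q.arrowEl a c * Q.el (Q.src a) x =
      Q.arrowEl a (coefRight (loopSign (Q.kind (Q.src a))) (Q.twist a) c x) := by
  conv_lhs => rw [arrowEl]
  rw [add_mul, mul_assoc, mul_assoc _ _ (Q.el (Q.src a) x), el_mul, el_mul, el_arrow_el,
    el_arrow_el, ← arrowEl_add]
  congr 1
  simp only [vertMul, coefRight, Prod.ext_iff, Prod.fst_add, Prod.snd_add, one_mul, zero_mul,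
    mul_zero, mul_one, add_zero, zero_add, star_mul', map_mul, twist_ofReal, star_star]
  simp [twist_ofReal]
  ring_nf
  simp

end SemilinearQuiver

/-! ### Compression by an idempotent and elements commuting with it -/

section compress

variable {R : Type*} [Ring R] [Algebra ℝ R] {e : R} (he : IsIdempotentElem e)

theorem compress_mul_of_commute_left {x : R} (hx : x * e = e * x) (y : R) :
    compress he (x * y) = compress he x * compress he y := by
  refine Subtype.ext ?_
  change e * (x * y) * e = e * x * e * (e * y * e)
  rw [← hx, mul_assoc x e e, he.eq, hx]
  simp only [← mul_assoc]
  rw [mul_assoc e x e, hx, ← mul_assoc, he.eq]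

theorem compress_mul_of_commute_right (x : R) {y : R} (hy : y * e = e * y) :
    compress he (x * y) = compress he x * compress he y := by
  refine Subtype.ext ?_
  change e * (x * y) * e = e * x * e * (e * y * e)
  rw [← hy, mul_assoc y e e, he.eq, hy, mul_assoc, mul_assoc x y e, hy, ← mul_assoc (e * x * e) e y,
    mul_assoc (e * x) e e, he.eq]
  simp only [mul_assoc]

/-- The algebra homomorphism to a corner given by one whose values commute with the idempotent. -/
def compressHom {A : Type*} [Ring A] [Algebra ℝ A] (f : A →ₐ[ℝ] R)
    (hf : ∀ a, f a * e = e * f a) : A →ₐ[ℝ] he.Corner where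
  toFun a := compress he (f a)
  map_one' := Subtype.ext (by
    change e * f 1 * e = e
    rw [map_one, mul_one, he.eq])
  map_mul' a b := by rw [map_mul, compress_mul_of_commute_left he (hf a)]
  map_zero' := Subtype.ext (by
    change e * f 0 * e = 0
    rw [map_zero, mul_zero, zero_mul])
  map_add' a b := by rw [map_add, compress_add]
  commutes' r := Subtype.ext (by
    change e * f (algebraMap ℝ A r) * e = r • e
    rw [AlgHom.commutes, ← Algebra.commutes, mul_assoc, he.eq, Algebra.smul_def])

end compress

theorem coefLeft_one (κ : ℝ) (m : ℂ × ℂ × ℂ × ℂ) : coefLeft κ (1, 0) m = m := by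
  simp [coefLeft]

theorem coefRight_one (κ : ℝ) (σ : Gal(ℂ/ℝ)) (m : ℂ × ℂ × ℂ × ℂ) :
    coefRight κ σ m (1, 0) = m := by
  simp [coefRight]

/-- `arrowCoef` as an additive homomorphism. -/
def arrowCoefHom (k l : DivKind) (σ : Gal(ℂ/ℝ)) (b : Bool) :
    SimpleBimod k l σ →+ ℂ × ℂ × ℂ × ℂ :=
  AddMonoidHom.mk' (arrowCoef k l σ b) (arrowCoef_add k l σ b)

theorem arrowCoef_zero (k l : DivKind) (σ : Gal(ℂ/ℝ)) (b : Bool) : arrowCoef k l σ b 0 = 0 :=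
  map_zero (arrowCoefHom k l σ b)

/-! ### The homomorphism from the tensor algebra to the corner -/

namespace SemilinearQuiver

variable {V E : Type*} [Fintype V] [Fintype E] (Q : SemilinearQuiver V E)

instance : Finite Q.BasicArrow :=
  inferInstanceAs (Finite {p : E × Bool // Q.type p.1 = .ordinary ∧
    (p.2 = true → Q.kind (Q.src p.1) = Q.kind (Q.tgt p.1) ∧ Q.kind (Q.src p.1) ≠ .C)})

instance : Fintype Q.BasicArrow := Fintype.ofFinite _

/-- The embedding of the product of the division rings into `ℂ_σ Q / ⟨S⟩`. -/
def ringHom : Q.basicQuiver.VertexRing →ₐ[ℝ] IdealQuotient Q.idealS where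
  toFun r := Q.vertSum fun v => divCoef (Q.kind v) (r v)
  map_one' := (congrArg Q.vertSum (funext fun v => divCoef_one (Q.kind v))).trans Q.vertSum_one
  map_mul' r s := by
    rw [vertSum_mul]
    exact congrArg Q.vertSum (funext fun v => divCoef_mul (Q.kind v) (r v) (s v))
  map_zero' := by
    refine (congrArg Q.vertSum (funext fun v => ?_)).trans
      ((Q.vertSum_scalar 0).trans (by rw [scalar_zero, map_zero]))
    have h := divCoef_algebraMap (Q.kind v) 0
    rwa [map_zero, Complex.ofReal_zero] at h
  map_add' r s := by
    rw [← vertSum_add]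
    exact congrArg Q.vertSum (funext fun v => divCoef_add (Q.kind v) (r v) (s v))
  commutes' t := by
    refine (congrArg Q.vertSum (funext fun v => divCoef_algebraMap (Q.kind v) t)).trans ?_
    rw [vertSum_scalar, scalar_ofReal]
    rfl

theorem ringHom_apply (r : Q.basicQuiver.VertexRing) :
    Q.ringHom r = Q.vertSum fun v => divCoef (Q.kind v) (r v) := rfl

theorem ringHom_mul_eps (r : Q.basicQuiver.VertexRing) :
    Q.ringHom r * Q.mkS Q.eps = Q.mkS Q.eps * Q.ringHom r := by
  rw [ringHom_apply, mkS_eps, vertSum_mul, vertSum_mul]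
  exact congrArg Q.vertSum (funext fun v => vertMul_divCoef_epsCoef _ _)

theorem vertSum_mul_arrow (x : V → ℂ × ℂ) (a : E) :
    Q.vertSum x * Q.mkS (Q.arrow a) = Q.el (Q.tgt a) (x (Q.tgt a)) * Q.mkS (Q.arrow a) := by
  rw [← el_tgt_mul_arrow, ← mul_assoc, vertSum_mul_el, mul_assoc]

theorem arrow_mul_vertSum (x : V → ℂ × ℂ) (a : E) :
    Q.mkS (Q.arrow a) * Q.vertSum x = Q.mkS (Q.arrow a) * Q.el (Q.src a) (x (Q.src a)) := by
  rw [← arrow_mul_el_src, mul_assoc, el_mul_vertSum, mul_assoc]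

theorem vertSum_mul_arrowEl (x : V → ℂ × ℂ) (a : E) (c : ℂ × ℂ × ℂ × ℂ) :
    Q.vertSum x * Q.arrowEl a c =
      Q.arrowEl a (coefLeft (loopSign (Q.kind (Q.tgt a))) (x (Q.tgt a)) c) := by
  rw [← coefLeft_one (loopSign (Q.kind (Q.tgt a))) c, ← el_mul_arrowEl, ← mul_assoc,
    vertSum_mul_el, mul_assoc, el_mul_arrowEl, el_mul_arrowEl, coefLeft_one]

theorem arrowEl_mul_vertSum (x : V → ℂ × ℂ) (a : E) (c : ℂ × ℂ × ℂ × ℂ) :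
    Q.arrowEl a c * Q.vertSum x =
      Q.arrowEl a (coefRight (loopSign (Q.kind (Q.src a))) (Q.twist a) c (x (Q.src a))) := by
  rw [← coefRight_one (loopSign (Q.kind (Q.src a))) (Q.twist a) c, ← arrowEl_mul_el, mul_assoc,
    el_mul_vertSum, ← mul_assoc, arrowEl_mul_el, arrowEl_mul_el, coefRight_one]

/-- The element of `ℂ_σ Q / ⟨S⟩` given by an element of a simple bimodule. -/
def bimodEl (b : Q.BasicArrow) (m : Q.basicQuiver.ArrowBimod) : IdealQuotient Q.idealS :=
  Q.arrowEl b.1.1 (arrowCoef (Q.kind (Q.tgt b.1.1)) (Q.kind (Q.src b.1.1)) (Q.twist b.1.1) b.1.2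
    (m b))

/-- The additive map from the bimodule of arrows to `ℂ_σ Q / ⟨S⟩`. -/
def moduleHom : Q.basicQuiver.ArrowBimod →+ IdealQuotient Q.idealS :=
  AddMonoidHom.mk' (fun m => ∑ b : Q.BasicArrow, Q.bimodEl b m) fun m n => by
    rw [← Finset.sum_add_distrib]
    refine Finset.sum_congr rfl fun b _ => ?_
    unfold bimodEl
    rw [← arrowEl_add]
    exact congrArg (Q.arrowEl b.1.1) (arrowCoef_add _ _ _ _ (m b) (n b))

theorem moduleHom_apply (m : Q.basicQuiver.ArrowBimod) :
    Q.moduleHom m = ∑ b : Q.BasicArrow, Q.bimodEl b m := rfl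

theorem moduleHom_smul (r : Q.basicQuiver.VertexRing) (m : Q.basicQuiver.ArrowBimod) :
    Q.moduleHom (r • m) = Q.ringHom r * Q.moduleHom m := by
  rw [moduleHom_apply, moduleHom_apply, Finset.mul_sum]
  refine Finset.sum_congr rfl fun b _ => ?_
  unfold bimodEl
  rw [ringHom_apply, vertSum_mul_arrowEl]
  exact congrArg (Q.arrowEl b.1.1) (arrowCoef_smul _ _ _ _ (r (Q.tgt b.1.1)) (m b))

theorem moduleHom_op_smul (r : Q.basicQuiver.VertexRing) (m : Q.basicQuiver.ArrowBimod) :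
    Q.moduleHom (op r • m) = Q.moduleHom m * Q.ringHom r := by
  rw [moduleHom_apply, moduleHom_apply, Finset.sum_mul]
  refine Finset.sum_congr rfl fun b _ => ?_
  unfold bimodEl
  rw [ringHom_apply, arrowEl_mul_vertSum]
  exact congrArg (Q.arrowEl b.1.1) (arrowCoef_op_smul _ _ _ _ (r (Q.src b.1.1)) (m b))

/-- The inverse of `Φ`. -/
def tensorHom : Q.basicQuiver.TensorAlg →ₐ[ℝ] Q.CornerS :=
  TensorRing.lift (compressHom Q.isIdempotentElem_S Q.ringHom Q.ringHom_mul_eps)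
    (AddMonoidHom.mk' (fun m => compress Q.isIdempotentElem_S (Q.moduleHom m)) fun m n => by
      rw [map_add, compress_add])
    (fun r m => by
      change compress _ (Q.moduleHom (r • m)) = compress _ (Q.ringHom r) * compress _ _
      rw [moduleHom_smul, compress_mul_of_commute_left _ (Q.ringHom_mul_eps r)])
    (fun r m => by
      change compress _ (Q.moduleHom (op r • m)) = compress _ _ * compress _ (Q.ringHom r)
      rw [moduleHom_op_smul, compress_mul_of_commute_right _ _ (Q.ringHom_mul_eps r)])

theorem tensorHom_ofRing (r : Q.basicQuiver.VertexRing) :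
    (Q.tensorHom (TensorRing.ofRing _ _ r)).1 =
      Q.mkS Q.eps * Q.ringHom r * Q.mkS Q.eps :=
  congrArg Subtype.val (TensorRing.lift_ofRing (C := Q.CornerS) _ _ _ _ r)

theorem tensorHom_ofModule (m : Q.basicQuiver.ArrowBimod) :
    (Q.tensorHom (TensorRing.ofModule _ _ m)).1 =
      Q.mkS Q.eps * Q.moduleHom m * Q.mkS Q.eps :=
  congrArg Subtype.val (TensorRing.lift_ofModule (C := Q.CornerS) _ _ _ _ m)

end SemilinearQuiver

theorem vertMul_unit (k : DivKind) (x : ℂ × ℂ) (p q : Fin 2) :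
    vertMul (loopSign k) (vertMul (loopSign k) (unitLeft k p, 0) x) (unitRight k q, 0) =
      (unitLeft k p * x.1 * unitRight k q, unitLeft k p * x.2 * star (unitRight k q)) := by
  simp [vertMul]

/-- At type ℂ the second coordinate is spurious: φ drops it while `vertMul` keeps it. That type is
settled in the quotient, where the loop is zero, by `el_eps_phiVert_zero`. -/
theorem vertMul_phiVert_zero {k : DivKind} (hk : k ≠ .C) (x : ℂ × ℂ) :
    vertMul (loopSign k) (vertMul (loopSign k) (epsCoef k) (divCoef k (phiVert k x.1 x.2 0 0)))
        (epsCoef k) =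
      vertMul (loopSign k) (vertMul (loopSign k) (epsCoef k) x) (epsCoef k) := by
  cases k
  · simp [phiVert_R, vertMul, loopSign, epsCoef, divCoef, Prod.ext_iff, Complex.ext_iff]
    ring_nf
    simp
  · exact absurd rfl hk
  · simp [phiVert_H, vertMul, loopSign, epsCoef, divCoef]

theorem divCoef_phiVert_C (x : ℂ × ℂ) :
    divCoef .C (phiVert .C x.1 x.2 0 0) = (x.1, 0) := by
  simp [phiVert_C, divCoef]

theorem outer_mul_inner {R : Type*} [Monoid R] (e a x b : R) :
    e * a * x * (b * e) = e * (a * x * b) * e := by simp only [mul_assoc]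

/-! ### Matrix units in ℂ_σ Q / ⟨S⟩ and the recovery of x from its matrix -/

namespace SemilinearQuiver

variable {V E : Type*} [Fintype V] [Fintype E] (Q : SemilinearQuiver V E)

theorem el_eps_phiVert_zero (v : V) (x : ℂ × ℂ) :
    Q.el v (epsCoef (Q.kind v)) * Q.el v (divCoef (Q.kind v) (phiVert (Q.kind v) x.1 x.2 0 0)) *
        Q.el v (epsCoef (Q.kind v)) =
      Q.el v (epsCoef (Q.kind v)) * Q.el v x * Q.el v (epsCoef (Q.kind v)) := by
  by_cases h : Q.kind v = .C
  · congr 2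
    rw [h, divCoef_phiVert_C]
    exact (Q.el_of_kind_C h x.1 x.2).symm
  · rw [el_mul, el_mul, vertMul_phiVert_zero h, ← el_mul, ← el_mul]

/-- The row `p` of the matrix units, in `ε (ℂ_σ Q / ⟨S⟩)`. -/
def rowUnit (p : Fin 2) : IdealQuotient Q.idealS :=
  Q.mkS Q.eps * Q.vertSum fun v => (unitLeft (Q.kind v) p, 0)

/-- The column `q` of the matrix units, in `(ℂ_σ Q / ⟨S⟩) ε`. -/
def colUnit (q : Fin 2) : IdealQuotient Q.idealS :=
  (Q.vertSum fun v => (unitRight (Q.kind v) q, 0)) * Q.mkS Q.eps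

theorem sum_colUnit_mul_rowUnit : ∑ q, Q.colUnit q * Q.rowUnit q = 1 := by
  have h : ∀ q, Q.colUnit q * Q.rowUnit q = ∑ v, Q.el v (vertMul (loopSign (Q.kind v))
      (vertMul (loopSign (Q.kind v)) (unitRight (Q.kind v) q, 0) (epsCoef (Q.kind v)))
      (vertMul (loopSign (Q.kind v)) (epsCoef (Q.kind v)) (unitLeft (Q.kind v) q, 0))) := by
    intro q
    unfold colUnit rowUnit
    rw [mkS_eps, vertSum_mul, vertSum_mul, vertSum_mul]
    rfl
  simp only [h]
  rw [Finset.sum_comm, ← vertSum_one]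
  refine Finset.sum_congr rfl fun v _ => ?_
  rw [← sum_vertMul_unit (Q.kind v)]
  exact (map_sum (Q.elHom v) _ _).symm

/-- The entry (p, q) of φ(x) is the upper left entry for E₁ₚ x E_q₁, and εyε depends only on the
upper left entry of φ(y). -/
theorem tensorHom_vertMat (x : V → ℂ × ℂ) (p q : Fin 2) :
    (Q.tensorHom (Q.vertMat x p q)).1 = Q.rowUnit p * Q.vertSum x * Q.colUnit q := by
  unfold rowUnit colUnit
  refine (Q.tensorHom_ofRing _).trans ?_
  rw [outer_mul_inner, ringHom_apply, mkS_eps]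
  simp only [vertSum_mul]
  refine Finset.sum_congr rfl fun v _ => ?_
  simp only [← el_mul]
  rw [show Q.vertFun x p q v = phiVert (Q.kind v) (x v).1 (x v).2 p q from rfl,
    phiVert_eq_phiVert_zero]
  refine (Q.el_eps_phiVert_zero v (_, _)).trans ?_
  rw [← vertMul_unit, ← el_mul, ← el_mul]

open Classical in
theorem moduleHom_arrowFun {a : E} (ha : Q.type a = .ordinary) (p q : Fin 2) :
    Q.moduleHom (Q.arrowFun a p q) =
      Q.arrowEl a (unitLeft (Q.kind (Q.tgt a)) p * Q.twist a (unitRight (Q.kind (Q.src a)) q),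
        0, 0, 0) := by
  have h : ∀ b : Q.BasicArrow, Q.bimodEl b (Q.arrowFun a p q) =
      (fun c : E × Bool => if c.1 = a then Q.arrowEl c.1 (arrowCoef (Q.kind (Q.tgt c.1))
        (Q.kind (Q.src c.1)) (Q.twist c.1) c.2 (phiArrow (Q.kind (Q.tgt c.1))
        (Q.kind (Q.src c.1)) (Q.twist c.1) c.2 p q)) else 0) b.1 := by
    intro b
    unfold bimodEl
    by_cases hb : b.1.1 = a
    · rw [arrowFun_apply_eq Q hb]
      exact (if_pos hb).symm
    · rw [arrowFun_apply_ne Q hb]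
      refine Eq.trans ?_ (if_neg hb).symm
      exact (congrArg (Q.arrowEl b.1.1) (arrowCoef_zero _ _ _ _)).trans
        (map_zero (Q.arrowElHom _))
  rw [moduleHom_apply]
  simp only [h]
  -- The sum is extended to all of E × Bool, where it reduces to the two pairs over a. A pair that
  -- is not an arrow of Q^b contributes zero, because φ(α) has no component at a missing α^𝐢.
  rw [Finset.sum_of_injOn (t := (Finset.univ : Finset (E × Bool)))
    (g := fun c : E × Bool => if c.1 = a then Q.arrowEl c.1 (arrowCoef (Q.kind (Q.tgt c.1))
        (Q.kind (Q.src c.1)) (Q.twist c.1) c.2 (phiArrow (Q.kind (Q.tgt c.1))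
        (Q.kind (Q.src c.1)) (Q.twist c.1) c.2 p q)) else 0) (fun b : Q.BasicArrow => b.1)
    (fun b _ c _ hbc => Subtype.ext hbc) (fun _ _ => Finset.mem_coe.mpr (Finset.mem_univ _))
    ?_ (fun _ _ => rfl)]
  · rw [Fintype.sum_prod_type, Finset.sum_eq_single a]
    · simp only [if_true, Fintype.sum_bool]
      rw [← arrowEl_add, add_comm, arrowCoef_phiArrow]
    · intro c _ hc
      simp [hc]
    · intro hn
      exact absurd (Finset.mem_univ a) hn
  · rintro ⟨c, b⟩ _ hc
    by_cases hca : c = a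
    · subst hca
      rw [if_pos rfl]
      have hb : ¬ (b = true → Q.kind (Q.src c) = Q.kind (Q.tgt c) ∧ Q.kind (Q.src c) ≠ .C) :=
        fun hb => hc ⟨⟨(c, b), ha, hb⟩, Finset.mem_coe.mpr (Finset.mem_univ _), rfl⟩
      rw [Classical.not_imp] at hb
      obtain ⟨rfl, hb⟩ := hb
      have h0 := phiArrow_true_eq_zero (Q.twist c) (k := Q.kind (Q.tgt c))
        (l := Q.kind (Q.src c)) fun hk => hb ⟨hk.1.symm, hk.1 ▸ hk.2⟩
      dsimp only
      rw [h0, Matrix.zero_apply, arrowCoef_zero]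
      exact map_zero (Q.arrowElHom _)
    · exact if_neg hca

theorem tensorHom_ordMat {a : E} (ha : Q.type a = .ordinary) (p q : Fin 2) :
    (Q.tensorHom (Q.ordMat a p q)).1 = Q.rowUnit p * Q.mkS (Q.arrow a) * Q.colUnit q := by
  unfold rowUnit colUnit
  refine (Q.tensorHom_ofModule _).trans ?_
  rw [outer_mul_inner, moduleHom_arrowFun Q ha, vertSum_mul_arrow, mul_assoc (Q.el _ _),
    arrow_mul_vertSum, ← mul_assoc (Q.el _ _), el_arrow_el]
  congr 3
  simp

/-- The identity passes to products because ∑ col_r row_r = 1 can be inserted between x and y, which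
is exactly matrix multiplication. It therefore suffices to know it on generators. -/
theorem tensorHom_pathHom (x : Q.PathAlg) (p q : Fin 2) :
    (Q.tensorHom ((Q.pathHom x).1 p q)).1 = Q.rowUnit p * Q.mkS x * Q.colUnit q := by
  induction x using Q.pathAlg_induction generalizing p q with
  | hs c =>
    rw [scalar, pathHom_gen]
    refine (Q.tensorHom_vertMat _ p q).trans ?_
    rw [vertSum_scalar]
    rfl
  | hv v =>
    rw [vert, pathHom_gen]
    refine (Q.tensorHom_vertMat _ p q).trans ?_
    rw [vertSum_single, el_one]
    rfl
  | ha a =>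
    rw [arrow, pathHom_gen]
    change (Q.tensorHom (Q.arrowMat a p q)).1 = Q.rowUnit p * Q.mkS (Q.arrow a) * Q.colUnit q
    unfold arrowMat
    split_ifs with h
    · exact Q.tensorHom_ordMat h p q
    · rw [tensorHom_vertMat, vertSum_single, el_snd, scalar_one, one_mul, Q.loopAt_eq h]
  | hmul x y hx hy =>
    rw [map_mul, corner_val_mul, Matrix.mul_apply, map_sum, corner_val_sum]
    simp only [map_mul, corner_val_mul, hx, hy]
    have h : ∀ r, Q.rowUnit p * Q.mkS x * Q.colUnit r * (Q.rowUnit r * Q.mkS y * Q.colUnit q) =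
        Q.rowUnit p * Q.mkS x * (Q.colUnit r * Q.rowUnit r) * (Q.mkS y * Q.colUnit q) := by
      intro r
      noncomm_ring
    simp only [h]
    rw [← Finset.sum_mul, ← Finset.mul_sum, sum_colUnit_mul_rowUnit]
    noncomm_ring
  | hadd x y hx hy =>
    rw [map_add, corner_val_add, Matrix.add_apply, map_add, corner_val_add, hx, hy, map_add]
    noncomm_ring

end SemilinearQuiver

/-! ### The isomorphism from the corner to the tensor algebra -/

theorem divCoef_zero (k : DivKind) : divCoef k 0 = 0 := by
  have h := divCoef_algebraMap k 0
  rwa [map_zero, Complex.ofReal_zero] at h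

theorem phiVert_zero (k : DivKind) (p q : Fin 2) : phiVert k 0 0 p q = 0 := by
  apply divCoef_injective
  rw [divCoef_zero]
  cases k <;> fin_cases p <;> fin_cases q
  all_goals simp [phiVert_R, phiVert_C, phiVert_H, divCoef, Complex.ext_iff, Prod.ext_iff]

theorem phiVert_epsCoef_one (k : DivKind) : phiVert k (epsCoef k).1 (epsCoef k).2 0 0 = 1 := by
  apply divCoef_injective
  rw [divCoef_one]
  cases k
  all_goals simp [phiVert_R, phiVert_C, phiVert_H, divCoef, epsCoef, Complex.ext_iff, Prod.ext_iff]
  norm_num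

theorem phiVert_epsCoef_zero (k : DivKind) {p q : Fin 2} (h : ¬ (p = 0 ∧ q = 0)) :
    phiVert k (epsCoef k).1 (epsCoef k).2 p q = 0 := by
  apply divCoef_injective
  rw [divCoef_zero]
  cases k <;> fin_cases p <;> fin_cases q
  all_goals first | exact absurd ⟨rfl, rfl⟩ h | skip
  all_goals simp [phiVert_R, phiVert_C, phiVert_H, divCoef, epsCoef, Complex.ext_iff, Prod.ext_iff]

theorem phiVert_eq_of_eq_C {k : DivKind} (h : k = .C) (z w w' : ℂ) (p q : Fin 2) :
    phiVert k z w p q = phiVert k z w' p q := by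
  subst h
  rfl

namespace SemilinearQuiver

variable {V E : Type*} [Fintype V] [Fintype E] (Q : SemilinearQuiver V E)

theorem pathHom_vertElem (v : V) (z w : ℂ) :
    (Q.pathHom (Q.vertElem v z w)).1 = Q.vertMat (vertSingle v (z, w)) := by
  have hz : ∀ c : ℂ, (Q.pathHom (Q.scalar c)).1 = Q.vertMat fun _ => (c, 0) := fun c =>
    congrArg Subtype.val (Q.pathHom_gen (.scalar c))
  have hv : (Q.pathHom (Q.vert v)).1 = Q.vertMat (vertSingle v (1, 0)) :=
    congrArg Subtype.val (Q.pathHom_gen (.vert v))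
  have hs : ∀ s, Q.type s ≠ .ordinary →
      (Q.pathHom (Q.arrow s)).1 = Q.vertMat (vertSingle (Q.src s) (0, 1)) := fun s hs =>
    (congrArg Subtype.val (Q.pathHom_gen (.arrow s))).trans (if_neg hs)
  unfold vertElem
  rw [map_add, map_mul, map_mul, corner_val_add, corner_val_mul, corner_val_mul, hz, hz, hv,
    vertMat_mul_single]
  have loop : ∀ s, Q.type s ≠ .ordinary → Q.src s = v →
      Q.vertMat (vertSingle v (vertMul (loopSign (Q.kind v)) (z, 0) (1, 0))) +
        Q.vertMat (fun _ => (w, 0)) * (Q.pathHom (Q.loopAt v)).1 =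
      Q.vertMat (vertSingle v (z, w)) := by
    rintro s h rfl
    rw [Q.loopAt_eq h, hs s h, vertMat_mul_single, ← vertMat_add]
    congr 1
    funext u
    by_cases hu : u = Q.src s
    · subst hu
      rw [Pi.add_apply, vertSingle_same, vertSingle_same, vertSingle_same]
      simp [vertMul]
    · rw [Pi.add_apply, vertSingle_ne hu, vertSingle_ne hu, vertSingle_ne hu, add_zero]
  cases h : Q.kind v with
  | R =>
    rw [← h]
    obtain ⟨s, h1, h2⟩ := Q.exists_of_kind_R h
    exact loop s (by simp [h1]) h2
  | H =>
    rw [← h]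
    obtain ⟨s, h1, h2⟩ := Q.exists_of_kind_H h
    exact loop s (by simp [h1]) h2
  | C =>
    -- Without a loop at v the coefficient w contributes nothing, and φ ignores it as well.
    rw [Q.loopAt_of_kind_C h, map_zero, corner_val_zero, mul_zero, add_zero, vertMul_one_right]
    ext p q
    refine congrArg (TensorRing.ofRing _ _) (funext fun u => ?_)
    unfold vertFun
    by_cases hu : u = v
    · subst hu
      rw [vertSingle_same, vertSingle_same]
      exact phiVert_eq_of_eq_C h _ _ _ _ _
    · rw [vertSingle_ne hu, vertSingle_ne hu]

theorem matHom_el (v : V) (x : ℂ × ℂ) : (Q.matHom (Q.el v x)).1 = Q.vertMat (vertSingle v x) :=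
  Q.pathHom_vertElem v x.1 x.2

theorem sum_vertSingle (x : V → ℂ × ℂ) : ∑ v, vertSingle v (x v) = x := by
  classical
  exact Finset.univ_sum_single x

theorem matHom_vertSum (x : V → ℂ × ℂ) : (Q.matHom (Q.vertSum x)).1 = Q.vertMat x := by
  unfold vertSum
  rw [map_sum, corner_val_sum]
  simp only [matHom_el]
  conv_rhs => rw [← sum_vertSingle x]
  exact (map_sum Q.vertMatHom _ _).symm

/-- φ(ε_v) is E₁₁ over 𝓜(v) for every type, and summing over the vertices gives E₁₁ over all of T.
-/
theorem matHom_eps : (Q.matHom (Q.mkS Q.eps)).1 = Matrix.single 0 0 1 := by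
  rw [mkS_eps, matHom_vertSum]
  ext p q
  by_cases h : p = 0 ∧ q = 0
  · obtain ⟨rfl, rfl⟩ := h
    rw [Matrix.single_apply_same]
    exact (congrArg (TensorRing.ofRing _ _) (funext fun v => phiVert_epsCoef_one _)).trans
      (map_one (TensorRing.ofRingHom _ _))
  · rw [Matrix.single_apply_of_ne _ _ _ _ _ (fun hn => h ⟨hn.1.symm, hn.2.symm⟩)]
    exact (congrArg (TensorRing.ofRing _ _) (funext fun v => phiVert_epsCoef_zero _ h)).trans
      (map_zero (TensorRing.ofRingHom _ _))

/-- The image of εxε has no entries outside the upper left corner; the vanishing of this one makes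
the upper left entry multiplicative. -/
theorem matHom_corner_apply (c : Q.CornerS) : (Q.matHom c.1).1 0 1 = 0 := by
  have h : (Q.matHom c.1).1 = (Q.matHom c.1).1 * Matrix.single 0 0 1 := by
    rw [← matHom_eps, ← corner_val_mul, ← map_mul]
    exact congrArg (fun y => (Q.matHom y).1) (corner_mul_idem _ c).symm
  rw [h]
  simp [Matrix.mul_apply]

/-- The isomorphism `Φ` as a homomorphism. -/
def cornerHom : Q.CornerS →ₐ[ℝ] Q.basicQuiver.TensorAlg where
  toFun c := (Q.matHom c.1).1 0 0
  map_one' := by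
    change (Q.matHom (Q.mkS Q.eps)).1 0 0 = 1
    rw [matHom_eps, Matrix.single_apply_same]
  map_mul' c d := by
    change (Q.matHom (c.1 * d.1)).1 0 0 = _
    rw [map_mul, corner_val_mul, Matrix.mul_apply, Fin.sum_univ_two, matHom_corner_apply,
      zero_mul, add_zero]
  map_zero' := by
    change (Q.matHom 0).1 0 0 = 0
    rw [map_zero]
    rfl
  map_add' c d := by
    change (Q.matHom (c.1 + d.1)).1 0 0 = _
    rw [map_add]
    rfl
  commutes' r := by
    change (Q.matHom (r • Q.mkS Q.eps)).1 0 0 = _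
    rw [map_smul, corner_val_smul, matHom_eps, Matrix.smul_apply, Matrix.single_apply_same,
      Algebra.algebraMap_eq_smul_one]

theorem cornerHom_compress (y : IdealQuotient Q.idealS) :
    Q.cornerHom (compress Q.isIdempotentElem_S y) = (Q.matHom y).1 0 0 := by
  change (Q.matHom (Q.mkS Q.eps * y * Q.mkS Q.eps)).1 0 0 = _
  rw [map_mul, map_mul, corner_val_mul, corner_val_mul, matHom_eps]
  simp [Matrix.mul_apply, Fin.sum_univ_two]

theorem rowUnit_zero : Q.rowUnit 0 = Q.mkS Q.eps := by
  have h : ∀ k, unitLeft k 0 = 1 := fun k => by cases k <;> rfl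
  unfold rowUnit
  simp only [h]
  rw [vertSum_one, mul_one]

theorem colUnit_zero : Q.colUnit 0 = Q.mkS Q.eps := by
  have h : ∀ k, unitRight k 0 = 1 := fun k => by cases k <;> rfl
  unfold colUnit
  simp only [h]
  rw [vertSum_one, one_mul]

/-- This is `tensorHom_pathHom` at p = q = 0, where the row unit and the column unit are both ε. -/
theorem tensorHom_cornerHom (c : Q.CornerS) : Q.tensorHom (Q.cornerHom c) = c := by
  obtain ⟨x, hx⟩ := IdealQuotient.mk_surjective Q.idealS c.1
  refine Subtype.ext ?_
  refine (congrArg (fun y => (Q.tensorHom ((Q.matHom y).1 0 0)).1) hx.symm).trans ?_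
  rw [matHom_mk, tensorHom_pathHom, rowUnit_zero, colUnit_zero]
  exact (congrArg (fun y => Q.mkS Q.eps * y * Q.mkS Q.eps) hx).trans
    (congrArg Subtype.val (compress_val_self _ c))

open Classical in
theorem cornerHom_vertElem (v : V) (z w : ℂ) :
    Q.cornerHom (compress Q.isIdempotentElem_S (IdealQuotient.mk Q.idealS (Q.vertElem v z w))) =
      TensorRing.ofRing _ _ (Pi.single v (phiVert (Q.kind v) z w 0 0)) := by
  rw [cornerHom_compress, matHom_mk, pathHom_vertElem]
  refine congrArg (TensorRing.ofRing _ _) (funext fun u => ?_)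
  unfold vertFun
  by_cases hu : u = v
  · subst hu
    rw [vertSingle_same]
    exact (Pi.single_eq_same (M := fun v => DivRing (Q.kind v)) u _).symm
  · rw [vertSingle_ne hu]
    exact (phiVert_zero _ _ _).trans
      (Pi.single_eq_of_ne (M := fun v => DivRing (Q.kind v)) hu _).symm

theorem smul_op_smul_apply (r s : Fin 2 → Q.basicQuiver.VertexRing)
    (m : Fin 2 → Fin 2 → Q.basicQuiver.ArrowBimod) (b : Q.BasicArrow) :
    (r 0 • (op (s 0) • m 0 0 + op (s 1) • m 0 1) +
        r 1 • (op (s 0) • m 1 0 + op (s 1) • m 1 1)) b =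
      ∑ p, ∑ q, r p (Q.basicQuiver.tgt b) • op (s q (Q.basicQuiver.src b)) • m p q b := by
  simp only [Fin.sum_univ_two, ← smul_add]
  rfl

theorem cornerHom_arrow {a : E} (ha : Q.type a = .ordinary) (z w z' w' : ℂ) :
    Q.cornerHom (compress Q.isIdempotentElem_S (IdealQuotient.mk Q.idealS
        (Q.vertElem (Q.tgt a) z w * Q.arrow a * Q.vertElem (Q.src a) z' w'))) =
      TensorRing.ofModule _ _ (Q.phiArrowElem a z w z' w') := by
  have h : (Q.pathHom (Q.arrow a)).1 = Q.ordMat a :=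
    (congrArg Subtype.val (Q.pathHom_gen (.arrow a))).trans (if_pos ha)
  rw [cornerHom_compress, matHom_mk, map_mul, map_mul, corner_val_mul, corner_val_mul,
    pathHom_vertElem, pathHom_vertElem, h, mul_assoc, Matrix.mul_apply, Fin.sum_univ_two,
    ordMat_mul_vertMat_apply, ordMat_mul_vertMat_apply]
  refine (congrArg₂ (· + ·) (TensorRing.ofModule_smul _ _ _ _).symm
    (TensorRing.ofModule_smul _ _ _ _).symm).trans ?_
  rw [← TensorRing.ofModule_add]
  refine congrArg (TensorRing.ofModule _ _) (funext fun b => ?_)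
  refine (Q.smul_op_smul_apply (fun p => Q.vertFun (vertSingle (Q.tgt a) (z, w)) 0 p)
    (fun q => Q.vertFun (vertSingle (Q.src a) (z', w')) q 0) (Q.arrowFun a) b).trans ?_
  by_cases hb : b.1.1 = a
  · subst hb
    refine Eq.trans ?_ (if_pos rfl).symm
    unfold cornerEntry
    have e1 : ∀ p, Q.vertFun (vertSingle (Q.tgt b.1.1) (z, w)) 0 p (Q.tgt b.1.1) =
        phiVert (Q.kind (Q.tgt b.1.1)) z w 0 p := fun p => by
      unfold vertFun
      rw [vertSingle_same]
    have e2 : ∀ q, Q.vertFun (vertSingle (Q.src b.1.1) (z', w')) q 0 (Q.src b.1.1) =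
        phiVert (Q.kind (Q.src b.1.1)) z' w' q 0 := fun q => by
      unfold vertFun
      rw [vertSingle_same]
    simp only [← e1, ← e2, ← arrowFun_apply_eq Q (rfl : b.1.1 = b.1.1)]
    rfl
  · refine Eq.trans ?_ (if_neg hb).symm
    simp only [arrowFun_apply_ne Q hb, smul_zero, Finset.sum_const_zero]

/-- The element of the bimodule of arrows with the given coordinates. -/
def coordElem (a : E) (c : ℂ × ℂ × ℂ × ℂ) : Q.basicQuiver.ArrowBimod :=
  Q.phiArrowElem a c.1 c.2.1 1 0 + Q.phiArrowElem a c.2.2.1 c.2.2.2 0 1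

theorem coordElem_apply_eq (b : Q.BasicArrow) (c : ℂ × ℂ × ℂ × ℂ) :
    Q.coordElem b.1.1 c b = coefEntry (Q.kind (Q.tgt b.1.1)) (Q.kind (Q.src b.1.1))
      (Q.twist b.1.1) b.1.2 c := by
  have h : ∀ z w z' w', Q.phiArrowElem b.1.1 z w z' w' b =
      cornerEntry (phiVert (Q.kind (Q.tgt b.1.1)) z w)
        (phiArrow (Q.kind (Q.tgt b.1.1)) (Q.kind (Q.src b.1.1)) (Q.twist b.1.1) b.1.2)
        (phiVert (Q.kind (Q.src b.1.1)) z' w') := fun _ _ _ _ => if_pos rfl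
  unfold coefEntry
  rw [← h, ← h]
  rfl

theorem coordElem_apply_ne {a : E} {b : Q.BasicArrow} (h : b.1.1 ≠ a) (c : ℂ × ℂ × ℂ × ℂ) :
    Q.coordElem a c b = 0 :=
  (congrArg₂ (· + ·) (if_neg h) (if_neg h)).trans (add_zero _)

/-- The coordinates of the component at `b`. -/
def bimodCoef (b : Q.BasicArrow) (m : Q.basicQuiver.ArrowBimod) : ℂ × ℂ × ℂ × ℂ :=
  arrowCoef (Q.kind (Q.tgt b.1.1)) (Q.kind (Q.src b.1.1)) (Q.twist b.1.1) b.1.2 (m b)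

theorem coordElem_bimodCoef_ne {b b' : Q.BasicArrow} (h : b' ≠ b) (m : Q.basicQuiver.ArrowBimod) :
    Q.coordElem b.1.1 (Q.bimodCoef b m) b' = 0 := by
  by_cases hb : b'.1.1 = b.1.1
  · obtain ⟨⟨a, i⟩, hi⟩ := b
    obtain ⟨⟨a', i'⟩, hi'⟩ := b'
    change a' = a at hb
    subst hb
    have hne : i' = !i := by
      cases i <;> cases i' <;> first | rfl | exact absurd rfl h
    subst hne
    refine (Q.coordElem_apply_eq ⟨(a', !i), hi'⟩ _).trans (coefEntry_arrowCoef_ne _ _ _ _ ?_ _)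
    -- Whichever of the two parallel arrows is α^𝐢, its existence forces both ends to have the same
    -- type, different from ℂ.
    cases i
    · exact ⟨(hi'.2 rfl).1.symm, (hi'.2 rfl).1 ▸ (hi'.2 rfl).2⟩
    · exact ⟨(hi.2 rfl).1.symm, (hi.2 rfl).1 ▸ (hi.2 rfl).2⟩
  · exact Q.coordElem_apply_ne hb _

/-- Decomposes an arbitrary element of the bimodule of arrows into values prescribed for Φ, as
needed for generation. -/
theorem sum_coordElem (m : Q.basicQuiver.ArrowBimod) :
    ∑ b : Q.BasicArrow, Q.coordElem b.1.1 (Q.bimodCoef b m) = m := by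
  funext b'
  refine (Finset.sum_apply b' Finset.univ
    fun b : Q.BasicArrow => Q.coordElem b.1.1 (Q.bimodCoef b m)).trans ?_
  rw [Finset.sum_eq_single b']
  · refine (Q.coordElem_apply_eq b' _).trans (coefEntry_arrowCoef_self _ _ _ _ ?_ _)
    exact fun hb => ⟨(b'.2.2 hb).1.symm, (b'.2.2 hb).1 ▸ (b'.2.2 hb).2⟩
  · intro b _ hb
    exact Q.coordElem_bimodCoef_ne hb.symm m
  · intro h
    exact absurd (Finset.mem_univ b') h

open Classical in
/-- The values of `Φ` generate the tensor algebra. -/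
theorem subalgebra_eq_top (S : Subalgebra ℝ Q.basicQuiver.TensorAlg)
    (hv : ∀ (v : V) (z w : ℂ),
      TensorRing.ofRing _ _ (Pi.single v (phiVert (Q.kind v) z w 0 0)) ∈ S)
    (ha : ∀ a : E, Q.type a = .ordinary → ∀ z w z' w' : ℂ,
      TensorRing.ofModule _ _ (Q.phiArrowElem a z w z' w') ∈ S) : S = ⊤ := by
  refine TensorRing.eq_top_of_mem S (fun r => ?_) fun m => ?_
  · have h : r = ∑ v, Pi.single v (r v) := (Finset.univ_sum_single r).symm
    rw [h]
    change TensorRing.ofRingHom _ _ _ ∈ S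
    rw [map_sum]
    refine S.sum_mem fun v _ => ?_
    have h1 := hv v (divCoef (Q.kind v) (r v)).1 (divCoef (Q.kind v) (r v)).2
    have h2 := congrArg (fun d => TensorRing.ofRing Q.basicQuiver.VertexRing
      Q.basicQuiver.ArrowBimod (Pi.single v d)) (phiVert_divCoef (Q.kind v) (r v))
    exact (congrArg (· ∈ S) h2).mp h1
  · rw [← Q.sum_coordElem m]
    change TensorRing.ofModuleHom _ _ _ ∈ S
    rw [map_sum]
    refine S.sum_mem fun b _ => ?_
    change TensorRing.ofModule _ _ (_ + _) ∈ S
    rw [TensorRing.ofModule_add]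
    exact S.add_mem (ha _ b.2.1 _ _ _ _) (ha _ b.2.1 _ _ _ _)

/-- Injectivity comes from the left inverse `tensorHom`, surjectivity from the generators of T in
the range; the other composite never has to be computed. -/
theorem cornerHom_bijective : Function.Bijective Q.cornerHom := by
  refine ⟨Function.LeftInverse.injective Q.tensorHom_cornerHom, ?_⟩
  rw [← AlgHom.range_eq_top]
  exact Q.subalgebra_eq_top _ (fun v z w => ⟨_, Q.cornerHom_vertElem v z w⟩)
    fun a ha z w z' w' => ⟨_, Q.cornerHom_arrow ha z w z' w'⟩

/-- The isomorphism `Φ`. -/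
def cornerEquiv : Q.CornerS ≃ₐ[ℝ] Q.basicQuiver.TensorAlg :=
  AlgEquiv.ofBijective Q.cornerHom Q.cornerHom_bijective

theorem isPhi_cornerEquiv : Q.IsPhi Q.cornerEquiv where
  vertex := Q.cornerHom_vertElem
  arrow _ ha := Q.cornerHom_arrow ha

/-! ### Uniqueness of Φ and the Morita equivalence -/

variable {Q}

/-- Generation is known on the side of T, so the inverses are compared there: they agree on the
prescribed values, hence everywhere. -/
theorem IsPhi.eq {Φ Φ' : Q.CornerS ≃ₐ[ℝ] Q.basicQuiver.TensorAlg} (h : Q.IsPhi Φ)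
    (h' : Q.IsPhi Φ') : Φ = Φ' := by
  have key : AlgHom.equalizer Φ.symm.toAlgHom Φ'.symm.toAlgHom = ⊤ := by
    refine Q.subalgebra_eq_top _ (fun v z w => ?_) fun a ha z w z' w' => ?_
    · change Φ.symm _ = Φ'.symm _
      rw [← h.vertex, AlgEquiv.symm_apply_apply, h.vertex, ← h'.vertex,
        AlgEquiv.symm_apply_apply]
    · change Φ.symm _ = Φ'.symm _
      rw [← h.arrow a ha, AlgEquiv.symm_apply_apply, h.arrow a ha, ← h'.arrow a ha,
        AlgEquiv.symm_apply_apply]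
  have hs : Φ.symm = Φ'.symm := AlgEquiv.ext fun t => by
    have ht : t ∈ AlgHom.equalizer Φ.symm.toAlgHom Φ'.symm.toAlgHom := key ▸ Algebra.mem_top
    exact ht
  rw [← Φ.symm_symm, hs, Φ'.symm_symm]

/-- The relation ∑ col_q row_q = 1 survives the projection modulo Z and shows that ε is still full
there. -/
theorem isMoritaEquivalent_cornerSZ (Z : Set (List E)) :
    IsMoritaEquivalent ℝ (IdealQuotient (Q.idealSZ Z)) (Q.CornerSZ Z) := by
  refine isMoritaEquivalent_corner (Q.isIdempotentElem_SZ Z)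
    (fun q : Fin 2 => Q.quotMap Z (Q.colUnit q)) (fun q => Q.quotMap Z (Q.rowUnit q)) ?_
  rw [← map_one (Q.quotMap Z), ← sum_colUnit_mul_rowUnit, map_sum]
  refine Finset.sum_congr rfl fun q _ => ?_
  rw [map_mul]
  -- Each column unit already ends in ε, so the idempotent in the middle is absorbed.
  congr 1
  change Q.quotMap Z (Q.colUnit q) * Q.quotMap Z (Q.mkS Q.eps) = _
  rw [← map_mul]
  unfold colUnit
  rw [mul_assoc, Q.isIdempotentElem_S.eq]

end SemilinearQuiver

end SemilinearClannish

end

theorem mainTheorem7 {V E : Type*} [Fintype V] [Fintype E]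
    (Q : SemilinearClannish.SemilinearQuiver V E) (Z : Set (List E)) (hZ : Q.IsGentleType Z) :
    ∃ Φ : Q.CornerS ≃ₐ[ℝ] Q.basicQuiver.TensorAlg,
      Q.IsPhi Φ ∧ (∀ Φ' : Q.CornerS ≃ₐ[ℝ] Q.basicQuiver.TensorAlg, Q.IsPhi Φ' → Φ' = Φ) ∧
      ∃ I : TwoSidedIdeal Q.basicQuiver.TensorAlg,
        (I : Set Q.basicQuiver.TensorAlg) =
          {t | ∃ y ∈ Q.idealZ Z,
            t = Φ (SemilinearClannish.compress Q.isIdempotentElem_S y)} ∧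
        (∃ Ψ : Q.CornerSZ Z ≃ₐ[ℝ] SemilinearClannish.IdealQuotient I,
          ∀ x : Q.PathAlg,
            Ψ (SemilinearClannish.compress (Q.isIdempotentElem_SZ Z)
                (SemilinearClannish.IdealQuotient.mk (Q.idealSZ Z) x)) =
              SemilinearClannish.IdealQuotient.mk I
                (Φ (SemilinearClannish.compress Q.isIdempotentElem_S
                  (SemilinearClannish.IdealQuotient.mk Q.idealS x)))) ∧
        IsMoritaEquivalent ℝ (SemilinearClannish.IdealQuotient (Q.idealSZ Z))
          (SemilinearClannish.IdealQuotient I) := by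
  obtain ⟨I, hI, Ψ, hΨ⟩ := Q.exists_ideal_of_equiv Z Q.cornerEquiv
  exact ⟨Q.cornerEquiv, Q.isPhi_cornerEquiv, fun Φ' h => h.eq Q.isPhi_cornerEquiv, I, hI,
    ⟨Ψ, hΨ⟩, IsMoritaEquivalent.trans ℝ (Q.isMoritaEquivalent_cornerSZ Z)
      (IsMoritaEquivalent.of_algEquiv ℝ Ψ)⟩
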